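/- \textbf{Conventions.} Manifolds are smooth, real, finite-dimensional, without boundary, Hausdorff and second countable. A \emph{Lie algebroid structure} $A$ on a vector bundle $E\to M$ consists of a bundle map $\rho:E\to TM$ over $\mathrm{id}_M$ (the anchor) and a Lie bracket on $\Gamma(E)$ with $[e_1,fe_2]=f[e_1,e_2]+(L_{\rho(e_1)}f)e_2$. A \emph{simple quotient} of $E\to M$ is a vector bundle morphism $(q,q_M):(E\to M)\to(\tilde E\to\tilde M)$ such that $q_M$ is a surjective submersion with connected fibers and $q$ is fiberwise surjective. The structure $A$ is \emph{$q$-basic} if there is a (necessarily unique) Lie algebroid structure $q_*A$ on $\tilde E$ such that $q:A\to q_*A$ is a Lie algebroid morphism. A form $\omega\in\Omega^k(E)$ is \emph{$q$-basic} if $\omega=q^*\tilde\omega$ for a (necessarily unique) form $q_*\omega:=\tilde\omega\in\Omega^k(\tilde E)$. A form $\omega\in\Omega^k(E)$ is \emph{linear} if $h_\lambda^*\omega=\lambda\omega$ for all $\lambda\in\mathbb R$, where $h_\lambda$ is scalar multiplication by $\lambda$ on the fibers. For $k\ge 1$ its \emph{components} are the bundle maps $\mu:E\to\Lambda^{k-1}T^*M$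 and $\eta:E\to\Lambda^kT^*M$ given, for $e\in E_x$ and $v_i\in T_xM$, by $$\mu(e)(v_1,\dots,v_{k-1})=\omega|_{0_x}\big(\tfrac{d}{dt}|_{t=0}(te),T0(v_1),\dots,T0(v_{k-1})\big),$$ $$\eta(e)(v_1,\dots,v_k)=(d\omega)|_{0_x}\big(\tfrac{d}{dt}|_{t=0}(te),T0(v_1),\dots,T0(v_k)\big),$$ where $0:M\to E$ is the zero section. A linear form $\omega$ is \emph{$A$-morphic} if the map $T^{\oplus k}E=TE\oplus_E\cdots\oplus_E TE\to\mathbb R$, $(V_1,\dots,V_k)\mapsto\omega(V_1,\dots,V_k)$, is a Lie algebroid morphism from the $k$-fold direct sum $T^{\oplus k}A\to T^{\oplus k}M$ of the tangent Lie algebroid of $A$ to the abelian Lie algebra $\mathbb R$ over a point. The pair $(\mu,\eta)$ satisfies the \emph{IM equations} for $A$ if, for all $e_1,e_2\in\Gamma(E)$, $$i_{\rho(e_1)}\mu(e_2)=-i_{\rho(e_2)}\mu(e_1),$$ $$\mu([e_1,e_2])=L_{\rho(e_1)}\mu(e_2)-i_{\rho(e_2)}d\mu(e_1)-i_{\rho(e_2)}\eta(e_1),$$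 $$\eta([e_1,e_2])=L_{\rho(e_1)}\eta(e_2)-i_{\rho(e_2)}d\eta(e_1).$$ A linear $k$-form $\omega$ on $E$, $k\ge2$, is \emph{kernel-reducible} with underlying simple quotient $q=q_{\mathrm{Ker}(\omega)}$ if $\mathrm{Ker}(\omega)\subseteq TE$ has constant rank, $\mathrm{Ker}(\omega)\subseteq\mathrm{Ker}(d\omega)$, and $q$ is a simple quotient of the vector bundle $E\to M$ which is the quotient map onto the leaf space of the foliation integrating $\mathrm{Ker}(\omega)$, i.e. $\mathrm{Ker}(Tq)=\mathrm{Ker}(\omega)$. Here $\mathrm{Ker}(\omega|_p)=\{V\in T_pE:\ i_V\omega|_p=0\}$. \textbf{Theorem.} Let $A$ be a Lie algebroid structure on a vector bundle $E\to M$ and let $\omega$ be a linear $k$-form on $E$, $k\ge 2$, which is $A$-morphic and kernel-reducible with underlying simple quotient $q=q_{\mathrm{Ker}(\omega)}:E\to\tilde E$ over $q_M:M\to\tilde M$. Then $A$ is $q$-basic, so that there is a unique Lie algebroid structure $q_*A$ on $\tilde E$ for which $q$ is a Lie algebroid morphism, and $\omega$ is $q$-basic. Moreover $q_*\omega$ is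 a linear $(q_*A)$-morphic $k$-form with trivial kernel, and its components $(\tilde\mu,\tilde\eta)$ satisfy, for $x\in M$ and $e\in E_x$, $$\mu(e)=(T_xq_M)^*\tilde\mu(q(e)),\qquad \eta(e)=(T_xq_M)^*\tilde\eta(q(e)),$$ where $(\mu,\eta)$ are the components of $\omega$; one has $$\mathrm{Ker}(\tilde\mu)=0,\qquad \mathrm{Ker}(\tilde\mu^\sharp)=0,$$ where $\tilde\mu^\sharp(v)(\tilde e,v_1,\dots,v_{k-2})=\tilde\mu(\tilde e)(v,v_1,\dots,v_{k-2})$; and $(\tilde\mu,\tilde\eta)$ satisfies the IM equations for $q_*A$. -/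

import Mathlib

open Bundle
open scoped Manifold ContDiff Bundle

noncomputable section

/-! ### Differential forms on manifolds -/

section Forms

variable {V H X : Type*} [NormedAddCommGroup V] [NormedSpace ℝ V] [TopologicalSpace H]
  (I : ModelWithCorners ℝ V H) [TopologicalSpace X] [ChartedSpace H X]

/-- A field of alternating `k`-linear forms on the tangent spaces of `X` (no smoothness yet). -/
abbrev FormField (X : Type*) [TopologicalSpace X] [ChartedSpace H X] (k : ℕ) :=
  ∀ x : X, TangentSpace I x [⋀^Fin k]→L[ℝ] ℝ

variable {I}

/-- The coordinate expression of `Ω` in the chart at `x₀`: the pullback of `Ω` by the inverse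
of the chart. -/
def FormField.inChart {k : ℕ} (Ω : FormField I X k) (x₀ : X) (y : V) : V [⋀^Fin k]→L[ℝ] ℝ :=
  (Ω ((extChartAt I x₀).symm y)).compContinuousLinearMap
    (mfderivWithin 𝓘(ℝ, V) I (extChartAt I x₀).symm (Set.range I) y)

/-- `Ω` is a smooth differential form: its coordinate expressions are smooth. -/
def FormField.IsSmooth {k : ℕ} (Ω : FormField I X k) : Prop :=
  ∀ x₀ : X, ContDiffOn ℝ ∞ (Ω.inChart x₀) (extChartAt I x₀).target

/-- The exterior derivative, computed at `x` in the chart at `x` and pulled back to `T_x X`. -/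
def FormField.d {k : ℕ} (Ω : FormField I X k) : FormField I X (k + 1) := fun x =>
  (extDerivWithin (Ω.inChart x) (Set.range I) (extChartAt I x x)).compContinuousLinearMap
    (mfderiv I 𝓘(ℝ, V) (extChartAt I x) x)

/-- Contraction `i_v Ω` at a point. -/
def contract {k : ℕ} {x : X} (Ω : TangentSpace I x [⋀^Fin (k + 1)]→L[ℝ] ℝ)
    (v : TangentSpace I x) : TangentSpace I x [⋀^Fin k]→L[ℝ] ℝ :=
  ContinuousAlternatingMap.curryLeft (E := V) Ω v

/-- Contraction of a form with a vector field. -/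
def FormField.interior {k : ℕ} (v : ∀ x : X, TangentSpace I x) (Ω : FormField I X (k + 1)) :
    FormField I X k := fun x => contract (Ω x) (v x)

/-- The Lie derivative of a form of positive degree along a vector field,
`L_v Ω = i_v dΩ + d i_v Ω`. -/
def FormField.lieDeriv {k : ℕ} (v : ∀ x : X, TangentSpace I x) (Ω : FormField I X (k + 1)) :
    FormField I X (k + 1) := Ω.d.interior v + (Ω.interior v).d

/-- The kernel `{v ∈ T_x X | i_v Ω_x = 0}`. -/
def FormField.ker {k : ℕ} (Ω : FormField I X (k + 1)) (x : X) : Submodule ℝ (TangentSpace I x) :=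
  LinearMap.ker
    (ContinuousAlternatingMap.curryLeft (E := V) (Ω x) : V →ₗ[ℝ] V [⋀^Fin k]→L[ℝ] ℝ)

/-- The pullback `f^* Ω`. -/
def FormField.pullback {V' H' X' : Type*} [NormedAddCommGroup V'] [NormedSpace ℝ V']
    [TopologicalSpace H'] {I' : ModelWithCorners ℝ V' H'} [TopologicalSpace X']
    [ChartedSpace H' X'] {k : ℕ} (f : X → X') (Ω : FormField I' X' k) : FormField I X k :=
  fun x => (Ω (f x)).compContinuousLinearMap (mfderiv I I' f x)

end Forms

/-! ### Lie algebroids and simple quotients of vector bundles -/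

section Bundles

variable {B H M : Type*} [NormedAddCommGroup B] [NormedSpace ℝ B] [TopologicalSpace H]
  (I : ModelWithCorners ℝ B H) [TopologicalSpace M] [ChartedSpace H M]
  (F : Type*) [NormedAddCommGroup F] [NormedSpace ℝ F]
  (E : M → Type*) [TopologicalSpace (TotalSpace F E)] [∀ x, TopologicalSpace (E x)]
  [∀ x, AddCommGroup (E x)] [∀ x, Module ℝ (E x)] [FiberBundle F E] [VectorBundle ℝ F E]

variable {I} in
/-- The directional derivative `v · f` of a function at a point. -/
def dirDeriv {x : M} (v : TangentSpace I x) (f : M → ℝ) : ℝ := mfderiv I 𝓘(ℝ, ℝ) f x v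

/-- A Lie algebroid structure on the vector bundle `E → M`: a smooth anchor `ρ : E → TM`
over the identity and a Lie bracket on the smooth sections of `E` satisfying the Leibniz
identity. -/
@[ext]
structure LieAlgebroid [IsManifold I ∞ M] where
  /-- the anchor -/
  anchor : ∀ x : M, E x →ₗ[ℝ] TangentSpace I x
  contMDiff_anchor : ContMDiff (I.prod 𝓘(ℝ, F)) I.tangent ∞
    (fun p : TotalSpace F E => (⟨p.proj, anchor p.proj p.2⟩ : TangentBundle I M))
  /-- the bracket on sections -/
  bracket : Cₛ^∞⟮I; F, E⟯ →ₗ[ℝ] Cₛ^∞⟮I; F, E⟯ →ₗ[ℝ] Cₛ^∞⟮I; F, E⟯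
  bracket_self : ∀ e, bracket e e = 0
  jacobi : ∀ e₁ e₂ e₃,
    bracket e₁ (bracket e₂ e₃) = bracket (bracket e₁ e₂) e₃ + bracket e₂ (bracket e₁ e₃)
  leibniz : ∀ (e₁ e₂ fe₂ : Cₛ^∞⟮I; F, E⟯) (f : M → ℝ), ContMDiff I 𝓘(ℝ, ℝ) ∞ f →
    (∀ x, fe₂ x = f x • e₂ x) →
    ∀ x, bracket e₁ fe₂ x = f x • bracket e₁ e₂ x + dirDeriv (anchor x (e₁ x)) f • e₂ x

variable {I F E}

/-- The vector field `ρ(e)`. -/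
def LieAlgebroid.anchorField [IsManifold I ∞ M] (A : LieAlgebroid I F E)
    (e : Cₛ^∞⟮I; F, E⟯) (x : M) : TangentSpace I x := A.anchor x (e x)

section TwoBundles

variable {B' H' M' : Type*} [NormedAddCommGroup B'] [NormedSpace ℝ B'] [TopologicalSpace H']
  {I' : ModelWithCorners ℝ B' H'} [TopologicalSpace M'] [ChartedSpace H' M']
  {F' : Type*} [NormedAddCommGroup F'] [NormedSpace ℝ F']
  {E' : M' → Type*} [TopologicalSpace (TotalSpace F' E')] [∀ x, TopologicalSpace (E' x)]
  [∀ x, AddCommGroup (E' x)] [∀ x, Module ℝ (E' x)] [FiberBundle F' E'] [VectorBundle ℝ F' E']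

/-- The map of total spaces defined by a family of maps of fibres. -/
def totalMap (qM : M → M') (q : ∀ x, E x →ₗ[ℝ] E' (qM x)) (p : TotalSpace F E) :
    TotalSpace F' E' := ⟨qM p.proj, q p.proj p.2⟩

variable (I I' F F') in
/-- `(q, q_M)` is a simple quotient of the vector bundle `E → M`: a smooth vector bundle morphism
which is fibrewise surjective, over a surjective submersion `q_M` with connected fibres. -/
structure IsSimpleQuotient (qM : M → M') (q : ∀ x, E x →ₗ[ℝ] E' (qM x)) : Prop where
  contMDiff_base : ContMDiff I I' ∞ qM
  surjective_base : Function.Surjective qM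
  submersion_base : ∀ x, Function.Surjective (mfderiv I I' qM x)
  connected_fibers : ∀ y, IsConnected (qM ⁻¹' {y})
  contMDiff_total : ContMDiff (I.prod 𝓘(ℝ, F)) (I'.prod 𝓘(ℝ, F')) ∞
    (totalMap qM q : TotalSpace F E → TotalSpace F' E')
  surjective_fiber : ∀ x, Function.Surjective (q x)

/-- The smooth vector bundle morphism `(Φ, φ) : E → E'` is a Lie algebroid morphism `A → A'`:
it intertwines the anchors, and if `Φ ∘ e₁ = ∑ fₐ (bₐ ∘ φ)` and `Φ ∘ e₂ = ∑ g_c (b'_c ∘ φ)`, then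
`Φ ∘ [e₁, e₂] = ∑ fₐ g_c ([bₐ, b'_c] ∘ φ) + ∑ (ρ(e₁) g_c) (b'_c ∘ φ) - ∑ (ρ(e₂) fₐ) (bₐ ∘ φ)`. -/
structure IsLieAlgebroidMorphism [IsManifold I ∞ M] [IsManifold I' ∞ M']
    (A : LieAlgebroid I F E) (A' : LieAlgebroid I' F' E')
    (φ : M → M') (Φ : ∀ x, E x →ₗ[ℝ] E' (φ x)) : Prop where
  contMDiff_base : ContMDiff I I' ∞ φ
  contMDiff_total : ContMDiff (I.prod 𝓘(ℝ, F)) (I'.prod 𝓘(ℝ, F')) ∞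
    (totalMap φ Φ : TotalSpace F E → TotalSpace F' E')
  anchor : ∀ x (e : E x), mfderiv I I' φ x (A.anchor x e) = A'.anchor (φ x) (Φ x e)
  bracket : ∀ (e₁ e₂ : Cₛ^∞⟮I; F, E⟯) (m n : ℕ) (f : Fin m → M → ℝ) (g : Fin n → M → ℝ)
    (b : Fin m → Cₛ^∞⟮I'; F', E'⟯) (b' : Fin n → Cₛ^∞⟮I'; F', E'⟯),
    (∀ a, ContMDiff I 𝓘(ℝ, ℝ) ∞ (f a)) → (∀ c, ContMDiff I 𝓘(ℝ, ℝ) ∞ (g c)) →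
    (∀ x, Φ x (e₁ x) = ∑ a, f a x • b a (φ x)) →
    (∀ x, Φ x (e₂ x) = ∑ c, g c x • b' c (φ x)) →
    ∀ x, Φ x (A.bracket e₁ e₂ x) =
      ∑ a, ∑ c, (f a x * g c x) • A'.bracket (b a) (b' c) (φ x)
      + ∑ c, dirDeriv (A.anchor x (e₁ x)) (g c) • b' c (φ x)
      - ∑ a, dirDeriv (A.anchor x (e₂ x)) (f a) • b a (φ x)

end TwoBundles

/-! ### Linear forms on the total space of a vector bundle -/

/-- `Ω` is linear: `h_c^* Ω = c Ω` for all real `c`, where `h_c` is multiplication by `c` on the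
fibres of `E`. -/
def IsLinearForm {k : ℕ} (Ω : FormField (I.prod 𝓘(ℝ, F)) (TotalSpace F E) k) : Prop :=
  ∀ c : ℝ, FormField.pullback (fun p : TotalSpace F E => (⟨p.proj, c • p.2⟩ : TotalSpace F E)) Ω
    = fun p => c • Ω p

variable (I F) in
/-- The vertical vector `d/dt|_{t=0} (t e)` at the zero vector over `x`. -/
def vert {x : M} (e : E x) :
    TangentSpace (I.prod 𝓘(ℝ, F)) (⟨x, (0 : E x)⟩ : TotalSpace F E) :=
  (mfderiv 𝓘(ℝ, ℝ) (I.prod 𝓘(ℝ, F)) (fun t : ℝ => (⟨x, t • e⟩ : TotalSpace F E)) 0 :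
    ℝ →L[ℝ] B × F) 1

variable (I F E) in
/-- The tangent map `T0 : T_x M → T_{0_x} E` of the zero section. -/
def tangentZero (x : M) : TangentSpace I x →L[ℝ]
    TangentSpace (I.prod 𝓘(ℝ, F)) (⟨x, (0 : E x)⟩ : TotalSpace F E) :=
  mfderiv I (I.prod 𝓘(ℝ, F)) (fun y : M => (⟨y, (0 : E y)⟩ : TotalSpace F E)) x

/-- The value at the zero section: `(e, v₁, …, v_k) ↦ Ω_{0_x}(d/dt|₀ (t e), T0 v₁, …, T0 v_k)`. -/
def coreContraction {k : ℕ} (Ω : FormField (I.prod 𝓘(ℝ, F)) (TotalSpace F E) (k + 1))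
    (x : M) (e : E x) : TangentSpace I x [⋀^Fin k]→L[ℝ] ℝ :=
  (contract (Ω ⟨x, 0⟩) (vert I F e)).compContinuousLinearMap (tangentZero I F E x)

/-- The component `μ : E → Λ^{k-1} T^*M` of a linear `k`-form `Ω = dΛ_μ + Λ_η`. -/
def muComp {k : ℕ} (Ω : FormField (I.prod 𝓘(ℝ, F)) (TotalSpace F E) (k + 1))
    (x : M) (e : E x) : TangentSpace I x [⋀^Fin k]→L[ℝ] ℝ := coreContraction Ω x e

/-- The component `η : E → Λ^k T^*M` of a linear `k`-form `Ω = dΛ_μ + Λ_η`. -/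
def etaComp {k : ℕ} (Ω : FormField (I.prod 𝓘(ℝ, F)) (TotalSpace F E) k)
    (x : M) (e : E x) : TangentSpace I x [⋀^Fin k]→L[ℝ] ℝ := coreContraction Ω.d x e

/-- The IM equations for a pair of bundle maps `μ : E → Λ^{k-1} T^*M`, `η : E → Λ^k T^*M`,
`k = n + 2`. -/
structure SatisfiesIM [IsManifold I ∞ M] {n : ℕ} (A : LieAlgebroid I F E)
    (μ : ∀ x : M, E x → TangentSpace I x [⋀^Fin (n + 1)]→L[ℝ] ℝ)
    (η : ∀ x : M, E x → TangentSpace I x [⋀^Fin (n + 2)]→L[ℝ] ℝ) : Prop where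
  eq₁ : ∀ e₁ e₂ : Cₛ^∞⟮I; F, E⟯,
    FormField.interior (A.anchorField e₁) (fun x => μ x (e₂ x)) =
      -FormField.interior (A.anchorField e₂) (fun x => μ x (e₁ x))
  eq₂ : ∀ e₁ e₂ : Cₛ^∞⟮I; F, E⟯,
    (fun x => μ x (A.bracket e₁ e₂ x)) =
      FormField.lieDeriv (A.anchorField e₁) (fun x => μ x (e₂ x))
      - FormField.interior (A.anchorField e₂) (FormField.d (fun x => μ x (e₁ x)))
      - FormField.interior (A.anchorField e₂) (fun x => η x (e₁ x))
  eq₃ : ∀ e₁ e₂ : Cₛ^∞⟮I; F, E⟯,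
    (fun x => η x (A.bracket e₁ e₂ x)) =
      FormField.lieDeriv (A.anchorField e₁) (fun x => η x (e₂ x))
      - FormField.interior (A.anchorField e₂) (FormField.d (fun x => η x (e₁ x)))

/-! ### The tangent prolongation `T^{⊕k} A → T^{⊕k} M` and morphic forms -/

variable (M I) in
/-- The manifold `T^{⊕k} M`, as the total space of the vector bundle `Hom(ℝ^k, TM)`; the point
`⟨x, w⟩` is the tuple `(v₁, …, v_k)`, `v_i = w(ε_i) ∈ T_x M`, for the standard basis `ε` of `ℝ^k`. -/
abbrev TangentSum (k : ℕ) [IsManifold I ∞ M] : Type _ :=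
  TotalSpace ((Fin k → ℝ) →L[ℝ] B)
    (fun x : M => Bundle.Trivial M (Fin k → ℝ) x →L[ℝ] TangentSpace I x)

variable (I) in
/-- The model with corners of `T^{⊕k} M`. -/
abbrev tangentSumModel (k : ℕ) := I.prod 𝓘(ℝ, (Fin k → ℝ) →L[ℝ] B)

/-- The `i`-th vector of a point of `T^{⊕k} M`. -/
def TangentSum.vec {k : ℕ} [IsManifold I ∞ M] (w : TangentSum M I k) (i : Fin k) :
    TangentSpace I w.proj := (w.2 : (Fin k → ℝ) →L[ℝ] B) (Pi.single i 1)

variable (F E) in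
/-- The fibre of `T^{⊕k} E → T^{⊕k} M` over `w = (x; v₁, …, v_k)`. By definition it consists of
the tuples `(V₁, …, V_k)` of vectors tangent to `E` at a common point `e ∈ E_x`, with
`Tp(V_i) = v_i`. In the coordinates `T_e E = T_x M × F` given by the preferred chart at `x` and the
preferred trivialization at `x` (the same for all `e ∈ E_x`) one has `V_i = (v_i, u_i)`, so the
tuple is the element `(e, u)` of `E_x × F^k`. The vector space structure of the fibre is the tangent
of the fibrewise operations of `E`, that is the componentwise one on `E_x × F^k`. -/
abbrev TangentSumFiber {k : ℕ} [IsManifold I ∞ M] (w : TangentSum M I k) : Type _ :=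
  E w.proj × (Fin k → F)

/-- The vector `V_i` of an element of `T^{⊕k} E`. -/
def TangentSumFiber.vec {k : ℕ} [IsManifold I ∞ M] {w : TangentSum M I k}
    (ξ : TangentSumFiber F E w) (i : Fin k) :
    TangentSpace (I.prod 𝓘(ℝ, F)) (⟨w.proj, ξ.1⟩ : TotalSpace F E) := (w.vec i, ξ.2 i)

/-- The function `Ω̲ : T^{⊕k} E → ℝ`, `(V₁, …, V_k) ↦ Ω(V₁, …, V_k)`. -/
def evalForm {k : ℕ} [IsManifold I ∞ M] (Ω : FormField (I.prod 𝓘(ℝ, F)) (TotalSpace F E) k)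
    (w : TangentSum M I k) (ξ : TangentSumFiber F E w) : ℝ := Ω ⟨w.proj, ξ.1⟩ ξ.vec

/-- The anchor of `T^{⊕k} A`. It sends `(V₁, …, V_k)` to the tangent vector of `T^{⊕k} M` at `w`
obtained from `(Tρ(V₁), …, Tρ(V_k))` by the canonical flip of `TTM`: in the coordinates of the
preferred chart at `x` one has `Tρ(V_i) = (v_i, a_i)`, a vector tangent to `TM` at `ρ(e)`, and the
result has the component `ρ(e)` along `M` and the components `(a₁, …, a_k)` along the fibre. -/
def LieAlgebroid.tangentSumAnchor [IsManifold I ∞ M] (A : LieAlgebroid I F E) {k : ℕ}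
    (w : TangentSum M I k) (ξ : TangentSumFiber F E w) :
    TangentSpace (tangentSumModel I k) w :=
  (A.anchor w.proj ξ.1,
    ∑ i, (ContinuousLinearMap.proj i : (Fin k → ℝ) →L[ℝ] ℝ).smulRight
      ((mfderiv (I.prod 𝓘(ℝ, F)) I.tangent
        (fun p : TotalSpace F E => (⟨p.proj, A.anchor p.proj p.2⟩ : TangentBundle I M))
        ⟨w.proj, ξ.1⟩ (ξ.vec i) : B × B).2))

variable (I F E) in
/-- Labels for the generating sections of `T^{⊕k} E → T^{⊕k} M`. -/
inductive LiftedSection (k : ℕ) where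
  /-- the tangent lift `(v₁, …, v_k) ↦ (Te(v₁), …, Te(v_k))` -/
  | tangent (e : Cₛ^∞⟮I; F, E⟯) : LiftedSection k
  /-- the core lift `(v₁, …, v_k) ↦ (T0(v₁), …, T0(v_j) + d/dt|₀ (t e), …, T0(v_k))` -/
  | core (j : Fin k) (e : Cₛ^∞⟮I; F, E⟯) : LiftedSection k

/-- The section of `T^{⊕k} E → T^{⊕k} M` labelled by a lift. -/
def LiftedSection.toSection {k : ℕ} [IsManifold I ∞ M] :
    LiftedSection I F E k → ∀ w : TangentSum M I k, TangentSumFiber F E w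
  | .tangent e, w => (e w.proj, fun i =>
      (mfderiv I (I.prod 𝓘(ℝ, F)) (fun y : M => (⟨y, e y⟩ : TotalSpace F E)) w.proj (w.vec i) :
        B × F).2)
  | .core j e, w => (0, fun i =>
      (tangentZero I F E w.proj (w.vec i) + (if i = j then vert I F (e w.proj) else 0) :
        B × F).2)

/-- The brackets in `T^{⊕k} A` of the generating sections: `[Te₁, Te₂] = T[e₁, e₂]`, the brackets
of a tangent lift with a core lift in the `j`-th place are the core lifts of `[e₁, e₂]` in the
`j`-th place, and core lifts commute. -/
def LieAlgebroid.liftBracket [IsManifold I ∞ M] (A : LieAlgebroid I F E) {k : ℕ} :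
    LiftedSection I F E k → LiftedSection I F E k →
      ∀ w : TangentSum M I k, TangentSumFiber F E w
  | .tangent e₁, .tangent e₂ => (LiftedSection.tangent (A.bracket e₁ e₂)).toSection
  | .tangent e₁, .core j e₂ => (LiftedSection.core j (A.bracket e₁ e₂)).toSection
  | .core j e₁, .tangent e₂ => (LiftedSection.core j (A.bracket e₁ e₂)).toSection
  | .core _ _, .core _ _ => 0

/-- A smooth function on `T^{⊕k} M`. -/
def IsSmoothCoeff {k : ℕ} [IsManifold I ∞ M] (f : TangentSum M I k → ℝ) : Prop :=
  ContMDiff (tangentSumModel I k) 𝓘(ℝ, ℝ) ∞ f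

/-- The section `∑ fₐ sₐ` of `T^{⊕k} E → T^{⊕k} M`. The lifts generate the sections over
`C^∞(T^{⊕k} M)`, so (locally) every section is of this form. -/
def combine {k : ℕ} [IsManifold I ∞ M] {m : ℕ} (f : Fin m → TangentSum M I k → ℝ)
    (s : Fin m → LiftedSection I F E k) (w : TangentSum M I k) : TangentSumFiber F E w :=
  ∑ a, f a w • (s a).toSection w

/-- The bracket `[∑ fₐ sₐ, ∑ g_c t_c]` in `T^{⊕k} A`, given by the brackets of the generating
sections and the Leibniz identity. -/
def LieAlgebroid.tangentSumBracket [IsManifold I ∞ M] (A : LieAlgebroid I F E) {k m n : ℕ}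
    (f : Fin m → TangentSum M I k → ℝ) (s : Fin m → LiftedSection I F E k)
    (g : Fin n → TangentSum M I k → ℝ) (t : Fin n → LiftedSection I F E k)
    (w : TangentSum M I k) : TangentSumFiber F E w :=
  ∑ a, ∑ c, (f a w * g c w) • A.liftBracket (s a) (t c) w
  + ∑ c, dirDeriv (A.tangentSumAnchor w (combine f s w)) (g c) • (t c).toSection w
  - ∑ a, dirDeriv (A.tangentSumAnchor w (combine g t w)) (f a) • (s a).toSection w

/-- The form `Ω` is `A`-morphic: it is linear, and `Ω̲ : T^{⊕k} A → ℝ` is a Lie algebroid morphism to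
the abelian Lie algebra `ℝ` over a point, that is
`Ω̲([σ, τ]) = ρ(σ) · Ω̲(τ) - ρ(τ) · Ω̲(σ)` for sections `σ = ∑ fₐ sₐ` and `τ = ∑ g_c t_c`. -/
structure IsMorphic [IsManifold I ∞ M] {k : ℕ} (A : LieAlgebroid I F E)
    (Ω : FormField (I.prod 𝓘(ℝ, F)) (TotalSpace F E) k) : Prop where
  linear : IsLinearForm Ω
  cocycle : ∀ (m n : ℕ) (f : Fin m → TangentSum M I k → ℝ) (s : Fin m → LiftedSection I F E k)
    (g : Fin n → TangentSum M I k → ℝ) (t : Fin n → LiftedSection I F E k),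
    (∀ a, IsSmoothCoeff (f a)) → (∀ c, IsSmoothCoeff (g c)) → ∀ w : TangentSum M I k,
    evalForm Ω w (A.tangentSumBracket f s g t w) =
      dirDeriv (A.tangentSumAnchor w (combine f s w)) (fun w' => evalForm Ω w' (combine g t w'))
      - dirDeriv (A.tangentSumAnchor w (combine g t w)) (fun w' => evalForm Ω w' (combine f s w'))

/-! ### Kernel-reducible forms -/

/-- The linear form `Ω` is kernel-reducible with underlying simple quotient
`q = q_{Ker(Ω)} : E → E'`: the kernel has constant rank, `Ker(Ω) ⊆ Ker(dΩ)`, and `q` is a simple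
quotient of the vector bundle `E` which is the quotient map onto the leaf space of the foliation
integrating `Ker(Ω)`. As the fibres of a simple quotient are connected, the latter says that the
tangent distribution `Ker(Tq)` of the `q`-fibres is `Ker(Ω)`. -/
structure IsKernelReducible
    {B' H' M' : Type*} [NormedAddCommGroup B'] [NormedSpace ℝ B'] [TopologicalSpace H']
    (I' : ModelWithCorners ℝ B' H') [TopologicalSpace M'] [ChartedSpace H' M']
    (F' : Type*) [NormedAddCommGroup F'] [NormedSpace ℝ F']
    {E' : M' → Type*} [TopologicalSpace (TotalSpace F' E')] [∀ x, TopologicalSpace (E' x)]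
    [∀ x, AddCommGroup (E' x)] [∀ x, Module ℝ (E' x)] [FiberBundle F' E'] [VectorBundle ℝ F' E']
    {k : ℕ} (Ω : FormField (I.prod 𝓘(ℝ, F)) (TotalSpace F E) (k + 1))
    (qM : M → M') (q : ∀ x, E x →ₗ[ℝ] E' (qM x)) : Prop where
  constant_rank : ∃ r : ℕ, ∀ p, Module.finrank ℝ (Ω.ker p) = r
  ker_le : ∀ p, Ω.ker p ≤ Ω.d.ker p
  simple : IsSimpleQuotient I F I' F' qM q
  ker_tangent : ∀ p : TotalSpace F E,
    LinearMap.ker (mfderiv (I.prod 𝓘(ℝ, F)) (I'.prod 𝓘(ℝ, F'))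
      (totalMap qM q : TotalSpace F E → TotalSpace F' E') p).toLinearMap = Ω.ker p

end Bundles

end

/-! Descent of the form. The kernel of ω is tangent to the fibres of q and lies in Ker(dω), so both
ω and dω vanish as soon as one argument is vertical. In submersion coordinates this says that the
coefficients of ω do not change along the fibres. The fibres of q on E are connected, since each is
an affine family over a connected fibre of q_M, and so ω = q^*ω̃ (`FormField.exists_eq_pullback`,
`IsSimpleQuotient.isPreconnected_fiber_total`). As Ker(Tq) = Ker(ω), the kernel of ω̃ is trivial.
Linearity of ω̃ follows because pullback along a surjective submersion is injective, and the
formulas for the components follow because contraction at the zero section is natural.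

Morphic forms and IM equations. A linear form is determined by its first jet along the zero section,
and a section e satisfies e^*ω = dμ(e) + η(e). Hence the function defined by ω on T^{⊕k}E takes the
value dμ(e) + η(e) on a tangent lift and ±μ(e) on a core lift. The anchor of a tangent lift acts on
such functions by the Lie derivative along ρ(e), and that of a core lift by inserting ρ(e). The
cocycle condition on two core lifts, on a tangent and a core lift, and on two tangent lifts then
becomes the three IM equations. Linear combinations of lifts are handled by the Leibniz rule. This
gives the equivalence `isMorphic_iff`, which is applied once on E and once on the quotient.

Descent of the algebroid. Trivial kernel of ω̃ means that μ̃ and μ̃^♯ are both injective. Let e and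
e₂ project to sections of the quotient. The second IM equation, solved for d(i_{ρ(e)}μ(e₂)), shows
that this form is horizontal, whatever the bracket is. So i_{ρ(e)}μ(e₂) is basic, and injectivity of
μ̃^♯ makes Tq_M(ρ(e)) constant along the fibres (`anchorField_agree`). The first IM equation shows
that Tq_M(ρ(e)) = 0 when e projects to zero (`anchor_ker`). Together these give the quotient anchor.
The second IM equation now exhibits μ([e₁,e₂]) as the pullback of a form depending only on the
projected sections, and injectivity of μ̃ turns this into a well-defined quotient bracket
(`exists_quotient_bracket`). Bilinearity, Jacobi and Leibniz are checked on lifts. The IM equations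
descend by injectivity of pullback, and `isMorphic_iff` shows that ω̃ is morphic. -/

noncomputable section

set_option linter.unusedSectionVars false

/-! ### Smooth families of alternating maps -/

section AlternatingCalculus

variable {U V W : Type*} [NormedAddCommGroup U] [NormedSpace ℝ U]
  [NormedAddCommGroup V] [NormedSpace ℝ V] [NormedAddCommGroup W] [NormedSpace ℝ W]

/-- Currying of the first argument, as a continuous linear map. -/
def curryLeftCLM (V : Type*) [NormedAddCommGroup V] [NormedSpace ℝ V] (k : ℕ) :
    (V [⋀^Fin (k + 1)]→L[ℝ] ℝ) →L[ℝ] V →L[ℝ] V [⋀^Fin k]→L[ℝ] ℝ :=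
  (ContinuousAlternatingMap.curryLeftLI (𝕜 := ℝ) (E := V) (F := ℝ)
    (n := k)).toContinuousLinearMap

theorem contDiff_curryLeft (V : Type*) [NormedAddCommGroup V] [NormedSpace ℝ V] (k : ℕ)
    (n : WithTop ℕ∞) : ContDiff ℝ n (fun α : V [⋀^Fin (k + 1)]→L[ℝ] ℝ => α.curryLeft) := by
  have h := ContinuousLinearMap.contDiff (𝕜 := ℝ) (n := n) (E := V [⋀^Fin (k + 1)]→L[ℝ] ℝ)
    (F := V →L[ℝ] V [⋀^Fin k]→L[ℝ] ℝ) (curryLeftCLM V k)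
  exact h

/-- Induction on the degree: currying off the first argument is continuous linear, and applying a
smooth family of linear maps to a smooth vector is smooth. In degree zero an alternating map is a
constant. -/
theorem ContDiffWithinAt.alternating_apply {n : WithTop ℕ∞} {s : Set U} {x : U} {k : ℕ}
    {α : U → V [⋀^Fin k]→L[ℝ] ℝ} {v : Fin k → U → V} (hα : ContDiffWithinAt ℝ n α s x)
    (hv : ∀ i, ContDiffWithinAt ℝ n (v i) s x) :
    ContDiffWithinAt ℝ n (fun y => α y (fun i => v i y)) s x := by
  induction k with
  | zero =>
    have h : (fun y => α y (fun i => v i y)) =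
        fun y => (ContinuousAlternatingMap.constOfIsEmptyLIE ℝ V ℝ (Fin 0)).symm (α y) := by
      funext y
      have : α y = (ContinuousAlternatingMap.constOfIsEmptyLIE ℝ V ℝ (Fin 0))
        (α y (fun i => v i y)) := by
        ext w; simp [Subsingleton.elim w (fun i => v i y)]
      conv_rhs => rw [this]
      simp
    rw [h]
    exact (ContinuousAlternatingMap.constOfIsEmptyLIE ℝ V ℝ
      (Fin 0)).symm.toContinuousLinearEquiv.contDiff.contDiffAt.comp_contDiffWithinAt x hα
  | succ k ih =>
    have h1 : ContDiffWithinAt ℝ n (fun y => (α y).curryLeft (v 0 y)) s x := by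
      refine ContDiffWithinAt.clm_apply ?_ (hv 0)
      exact (contDiff_curryLeft V k n).contDiffAt.comp_contDiffWithinAt x hα
    have h2 := ih h1 (fun i => hv i.succ)
    refine h2.congr (fun y _ => ?_) ?_ <;>
    · simp only [ContinuousAlternatingMap.curryLeft_apply_apply]
      congr 1; funext i; exact Fin.cases rfl (fun _ => rfl) i

/-- An alternating map is determined by its values on tuples of basis vectors. These are finitely
many, so the injective evaluation map into a finite power of ℝ has a linear left inverse. -/
theorem exists_leftInverse_alternating_eval [FiniteDimensional ℝ V] (k : ℕ) :
    ∃ (N : ℕ) (w : Fin N → Fin k → V) (L : (Fin N → ℝ) →L[ℝ] V [⋀^Fin k]→L[ℝ] ℝ),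
      ∀ α : V [⋀^Fin k]→L[ℝ] ℝ, L (fun j => α (w j)) = α := by
  let b := Module.finBasis ℝ V
  let e := Fintype.equivFin (Fin k → Fin (Module.finrank ℝ V))
  let w : Fin (Fintype.card (Fin k → Fin (Module.finrank ℝ V))) → Fin k → V :=
    fun j i => b (e.symm j i)
  let ev : (V [⋀^Fin k]→L[ℝ] ℝ) →ₗ[ℝ] (Fin (Fintype.card _) → ℝ) :=
    { toFun := fun α j => α (w j)
      map_add' := fun _ _ => rfl
      map_smul' := fun _ _ => rfl }
  have hinj : Function.Injective ev := by
    intro α β h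
    have h' : α.toAlternatingMap = β.toAlternatingMap := by
      refine Module.Basis.ext_alternating b fun v _ => ?_
      have := congrFun h (e v)
      simpa [ev, w] using this
    ext v
    exact congrArg (fun γ : V [⋀^Fin k]→ₗ[ℝ] ℝ => γ v) h'
  obtain ⟨L, hL⟩ := ev.exists_leftInverse_of_injective (LinearMap.ker_eq_bot.mpr hinj)
  exact ⟨_, w, LinearMap.toContinuousLinearMap L, fun α => LinearMap.congr_fun hL α⟩

/-- In finite dimension a family is rebuilt by one fixed linear map from finitely many of its
evaluations, so smoothness may be tested on constant arguments. -/
theorem contDiffWithinAt_alternating_iff [FiniteDimensional ℝ V] {n : WithTop ℕ∞} {s : Set U}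
    {x : U} {k : ℕ} {α : U → V [⋀^Fin k]→L[ℝ] ℝ} :
    ContDiffWithinAt ℝ n α s x ↔ ∀ v : Fin k → V, ContDiffWithinAt ℝ n (fun y => α y v) s x := by
  refine ⟨fun h v => h.alternating_apply fun i => contDiffWithinAt_const, fun h => ?_⟩
  obtain ⟨N, w, L, hL⟩ := exists_leftInverse_alternating_eval (V := V) k
  have : α = fun y => L (fun j => α y (w j)) := funext fun y => (hL _).symm
  rw [this]
  exact L.contDiff.contDiffAt.comp_contDiffWithinAt x
    (contDiffWithinAt_pi.mpr fun j => h (w j))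

theorem ContDiffAt.alternating_apply {n : WithTop ℕ∞} {x : U} {k : ℕ}
    {α : U → V [⋀^Fin k]→L[ℝ] ℝ} {v : Fin k → U → V} (hα : ContDiffAt ℝ n α x)
    (hv : ∀ i, ContDiffAt ℝ n (v i) x) :
    ContDiffAt ℝ n (fun y => α y (fun i => v i y)) x :=
  ContDiffWithinAt.alternating_apply hα hv

theorem contDiffAt_alternating_iff [FiniteDimensional ℝ V] {n : WithTop ℕ∞}
    {x : U} {k : ℕ} {α : U → V [⋀^Fin k]→L[ℝ] ℝ} :
    ContDiffAt ℝ n α x ↔ ∀ v : Fin k → V, ContDiffAt ℝ n (fun y => α y v) x :=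
  contDiffWithinAt_alternating_iff

theorem ContDiffAt.alternating_comp [FiniteDimensional ℝ W] {n : WithTop ℕ∞} {x : U}
    {k : ℕ} {α : U → V [⋀^Fin k]→L[ℝ] ℝ} {L : U → W →L[ℝ] V} (hα : ContDiffAt ℝ n α x)
    (hL : ContDiffAt ℝ n L x) :
    ContDiffAt ℝ n (fun y => (α y).compContinuousLinearMap (L y)) x :=
  contDiffAt_alternating_iff.mpr fun v =>
    hα.alternating_apply fun i => hL.clm_apply (contDiffAt_const (c := v i))

theorem ContDiffAt.extDeriv {x : V} {k : ℕ}
    {α : V → V [⋀^Fin k]→L[ℝ] ℝ} (hα : ContDiffAt ℝ ∞ α x) :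
    ContDiffAt ℝ ∞ (_root_.extDeriv α) x :=
  have h : ContDiff ℝ ∞ (fun f : V →L[ℝ] V [⋀^Fin k]→L[ℝ] ℝ =>
      ContinuousAlternatingMap.alternatizeUncurryFin f) :=
    ContinuousLinearMap.contDiff (𝕜 := ℝ) (n := ∞) (E := V →L[ℝ] V [⋀^Fin k]→L[ℝ] ℝ)
    (F := V [⋀^Fin (k + 1)]→L[ℝ] ℝ)
    (ContinuousAlternatingMap.alternatizeUncurryFinCLM ℝ V ℝ (n := k))
  h.contDiffAt.comp x (hα.fderiv_right (m := ∞) (by simp))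

/-- The derivative of `y ↦ α y (v y)`. -/
theorem fderiv_alternating_apply {x u : U} {k : ℕ} {α : U → V [⋀^Fin k]→L[ℝ] ℝ}
    {v : U → Fin k → V} (hα : DifferentiableAt ℝ α x) (hv : DifferentiableAt ℝ v x) :
    fderiv ℝ (fun y => α y (v y)) x u = fderiv ℝ α x u (v x) +
      ∑ i, α x (Function.update (v x) i (fderiv ℝ v x u i)) := by
  have h := fderiv_continuousAlternatingMap_apply_apply (g := fun i y => v y i) hα
    (differentiableAt_pi.mp hv) u
  simp only [fderiv_apply hv] at h
  rw [h]
  rfl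

/-- The coordinate expression of the Lie derivative. -/
theorem extDeriv_curryLeft_add {x : V} {k : ℕ} {α : V → V [⋀^Fin (k + 1)]→L[ℝ] ℝ}
    {X : V → V} (hα : DifferentiableAt ℝ α x) (hX : DifferentiableAt ℝ X x)
    (v : Fin (k + 1) → V) :
    (extDeriv α x).curryLeft (X x) v + extDeriv (fun y => (α y).curryLeft (X y)) x v =
      fderiv ℝ α x (X x) v + ∑ i, α x (Function.update v i (fderiv ℝ X x (v i))) := by
  have hc : DifferentiableAt ℝ (fun y => (α y).curryLeft (X y)) x := by
    refine DifferentiableAt.clm_apply ?_ hX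
    exact ((contDiff_curryLeft V k 1).differentiable one_ne_zero).differentiableAt.comp x hα
  rw [ContinuousAlternatingMap.curryLeft_apply_apply, extDeriv_apply hα, extDeriv_apply hc,
    Fin.sum_univ_succ, add_assoc, ← Finset.sum_add_distrib]
  -- The leading term of dα(X, v) is the derivative of α along X. Term i + 1 of dα(X, v) pairs with
  -- term i of d(i_X α): the derivatives of α cancel and only the derivative of X along `v i`
  -- remains.
  congr 1
  · have : fderiv ℝ (fun y => α y v) x (X x) = fderiv ℝ α x (X x) v := by
      simpa using fderiv_alternating_apply (u := X x) hα (differentiableAt_const v)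
    simpa using this
  · refine Finset.sum_congr rfl fun i _ => ?_
    have e1 : ∀ y, (fun j : Fin (k+1) => (Matrix.vecCons (X y) (i.removeNth v) : Fin (k+1) → V) j)
        = Matrix.vecCons (X y) (i.removeNth v) := fun _ => rfl
    have h2 : fderiv ℝ (fun y => (α y).curryLeft (X y) (i.removeNth v)) x (v i) =
        fderiv ℝ α x (v i) (Matrix.vecCons (X x) (i.removeNth v)) +
          α x (Matrix.vecCons (fderiv ℝ X x (v i)) (i.removeNth v)) := by
      have hv : DifferentiableAt ℝ (fun y => (Matrix.vecCons (X y) (i.removeNth v) :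
          Fin (k+1) → V)) x := by
        rw [differentiableAt_pi]
        intro j
        exact Fin.cases hX (fun _ => differentiableAt_const _) j
      have := fderiv_alternating_apply (u := v i) hα hv
      simp only [ContinuousAlternatingMap.curryLeft_apply_apply]
      rw [this, Fin.sum_univ_succ]
      congr 1
      have hd : ∀ j, fderiv ℝ (fun y => (Matrix.vecCons (X y) (i.removeNth v) :
          Fin (k+1) → V)) x (v i) j = (Matrix.vecCons (fderiv ℝ X x (v i)) 0 : Fin (k+1) → V) j := by
        intro j
        rw [fderiv_pi (fun j => (differentiableAt_pi.mp hv) j)]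
        refine Fin.cases ?_ (fun l => ?_) j
        · simp
        · simp
      rw [Finset.sum_eq_zero, add_zero]
      · congr 1
        rw [hd]
        ext j; refine Fin.cases ?_ (fun l => ?_) j <;> simp
      · intro j _
        rw [hd]
        exact (α x).map_coord_zero j.succ (by simp)
    rw [h2]
    have h3 : fderiv ℝ (fun y => α y (i.succ.removeNth (Matrix.vecCons (X x) v))) x (v i) =
        fderiv ℝ α x (v i) (Matrix.vecCons (X x) (i.removeNth v)) := by
      have h4 : (i.succ.removeNth (Matrix.vecCons (X x) v) : Fin (k+1) → V) =
        Matrix.vecCons (X x) (i.removeNth v) := by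
        ext j; refine Fin.cases ?_ (fun l => ?_) j <;> simp [Fin.removeNth]
      rw [h4]
      simpa using fderiv_alternating_apply (u := v i) hα
        (differentiableAt_const (Matrix.vecCons (X x) (i.removeNth v)))
    have h5 : α x (Function.update v i (fderiv ℝ X x (v i))) =
        (-1) ^ (i : ℕ) • α x (Matrix.vecCons (fderiv ℝ X x (v i)) (i.removeNth v)) := by
      rw [← ContinuousAlternatingMap.map_insertNth, Fin.insertNth_removeNth]
    rw [h5]
    simp only [Matrix.cons_val_succ, h3, Fin.val_succ, pow_succ]
    ring

end AlternatingCalculus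

/-! ### Coordinate expressions of forms on manifolds -/

section FormCharts

variable {V H X : Type*} [NormedAddCommGroup V] [NormedSpace ℝ V] [TopologicalSpace H]
  {I : ModelWithCorners ℝ V H} [TopologicalSpace X] [ChartedSpace H X]

theorem FormField.ext {k : ℕ} {Ω Ω' : FormField I X k} (h : ∀ x (w : Fin k → TangentSpace I x), Ω x w = Ω' x w) :
    Ω = Ω' := funext fun x => ContinuousAlternatingMap.ext (h x)

theorem FormField.inChart_apply {k : ℕ} (Ω : FormField I X k) (x₀ : X) (y : V) (v : Fin k → V) :
    Ω.inChart x₀ y v = Ω ((extChartAt I x₀).symm y) (fun i =>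
      mfderivWithin 𝓘(ℝ, V) I (extChartAt I x₀).symm (Set.range I) y (v i)) := rfl

theorem FormField.pullback_apply {V' H' X' : Type*} [NormedAddCommGroup V'] [NormedSpace ℝ V']
    [TopologicalSpace H'] {I' : ModelWithCorners ℝ V' H'} [TopologicalSpace X']
    [ChartedSpace H' X'] {k : ℕ} (f : X → X') (Ω : FormField I' X' k) (x : X)
    (v : Fin k → TangentSpace I x) :
    FormField.pullback (I := I) f Ω x v = Ω (f x) (fun i => mfderiv I I' f x (v i)) := rfl

theorem FormField.interior_apply {k : ℕ} (v : ∀ x : X, TangentSpace I x)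
    (Ω : FormField I X (k + 1)) (x : X) (w : Fin k → TangentSpace I x) :
    Ω.interior v x w = Ω x (Matrix.vecCons (v x) w) := rfl

theorem minSmoothness_two_le_infty : minSmoothness ℝ 2 ≤ ∞ := by
  simp only [minSmoothness_of_isRCLikeNormedField]
  exact ENat.LEInfty.out

variable [I.Boundaryless]

/-- The tangent space at x is identified with the model space through the preferred chart at x, so
this chart has identity derivative there. Without boundary the range of the model is everything, and
the within-derivative is an ordinary one. -/
theorem FormField.d_eq {k : ℕ} [IsManifold I 1 X] (Ω : FormField I X k) (x : X) :
    Ω.d x = extDeriv (Ω.inChart x) (extChartAt I x x) := by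
  have h : ∀ (s : Set V), s = Set.univ → ∀ L : V →L[ℝ] V, L = ContinuousLinearMap.id ℝ V →
      (extDerivWithin (Ω.inChart x) s (extChartAt I x x)).compContinuousLinearMap L =
        extDeriv (Ω.inChart x) (extChartAt I x x) := by
    rintro s rfl L rfl
    rw [extDerivWithin_univ]
    ext; simp
  exact h _ I.range_eq_univ _ mfderiv_extChartAt_self

theorem FormField.inChart_self_apply {k : ℕ} [IsManifold I 1 X] (Ω : FormField I X k) (x : X)
    (w : Fin k → V) : Ω.inChart x (extChartAt I x x) w = Ω x w := by
  have h : ∀ y, y = x → ∀ L : Fin k → (V →L[ℝ] V),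
      (∀ i, L i = ContinuousLinearMap.id ℝ V) → (Ω y : V [⋀^Fin k]→L[ℝ] ℝ) (fun i => L i (w i)) =
        (Ω x : V [⋀^Fin k]→L[ℝ] ℝ) w := by
    rintro y rfl L hL
    simp [hL]
  exact h _ (extChartAt_to_inv x) (fun _ => _) (fun _ => mfderivWithin_range_extChartAt_symm)

theorem FormField.inChart_self {k : ℕ} [IsManifold I 1 X] (Ω : FormField I X k) (x : X) :
    Ω.inChart x (extChartAt I x x) = Ω x :=
  ContinuousAlternatingMap.ext fun w => Ω.inChart_self_apply x w

theorem extChartAt_target_mem_nhds_of_mem {x₀ : X} {y : V} (hy : y ∈ (extChartAt I x₀).target) :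
    (extChartAt I x₀).target ∈ nhds y :=
  (isOpen_extChartAt_target x₀).mem_nhds hy

theorem mdifferentiableAt_extChartAt_symm [IsManifold I 1 X] {x₀ : X} {y : V}
    (hy : y ∈ (extChartAt I x₀).target) :
    MDifferentiableAt 𝓘(ℝ, V) I (extChartAt I x₀).symm y := by
  have h := mdifferentiableWithinAt_extChartAt_symm (I := I) hy
  rwa [I.range_eq_univ, mdifferentiableWithinAt_univ] at h

theorem contMDiffAt_extChartAt_symm [IsManifold I ∞ X] {x₀ : X} {y : V}
    (hy : y ∈ (extChartAt I x₀).target) :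
    ContMDiffAt 𝓘(ℝ, V) I ∞ (extChartAt I x₀).symm y :=
  (contMDiffOn_extChartAt_symm x₀ y hy).contMDiffAt (extChartAt_target_mem_nhds_of_mem hy)

variable {V' H' X' : Type*} [NormedAddCommGroup V'] [NormedSpace ℝ V']
  [TopologicalSpace H'] {I' : ModelWithCorners ℝ V' H'} [I'.Boundaryless] [TopologicalSpace X']
  [ChartedSpace H' X']

theorem contDiffAt_writtenInCharts [IsManifold I ∞ X] [IsManifold I' ∞ X'] {f : X → X'}
    (hf : ContMDiff I I' ∞ f) {x₀ : X} {x₀' : X'} {y : V} (hy : y ∈ (extChartAt I x₀).target)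
    (hfy : f ((extChartAt I x₀).symm y) ∈ (extChartAt I' x₀').source) :
    ContDiffAt ℝ ∞ (extChartAt I' x₀' ∘ f ∘ (extChartAt I x₀).symm) y := by
  rw [← contMDiffAt_iff_contDiffAt]
  rw [extChartAt_source] at hfy
  exact (contMDiffAt_extChartAt' hfy).comp y
    ((hf _).comp y (contMDiffAt_extChartAt_symm hy))

theorem mfderiv_comp_mfderivWithin_extChartAt_symm [IsManifold I 1 X] [IsManifold I' 1 X']
    {f : X → X'} {x₀ : X} {x₀' : X'} {y : V}
    (hf : MDifferentiableAt I I' f ((extChartAt I x₀).symm y))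
    (hy : y ∈ (extChartAt I x₀).target)
    (hfy : f ((extChartAt I x₀).symm y) ∈ (extChartAt I' x₀').source) (v : V) :
    (mfderiv I I' f ((extChartAt I x₀).symm y)
      (mfderivWithin 𝓘(ℝ, V) I (extChartAt I x₀).symm (Set.range I) y v) : V') =
    mfderivWithin 𝓘(ℝ, V') I' (extChartAt I' x₀').symm (Set.range I')
        (extChartAt I' x₀' (f ((extChartAt I x₀).symm y)))
      (fderiv ℝ (extChartAt I' x₀' ∘ f ∘ (extChartAt I x₀).symm) y v) := by
  have hσ := mdifferentiableAt_extChartAt_symm (I := I) hy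
  have he : MDifferentiableAt I' 𝓘(ℝ, V') (extChartAt I' x₀')
      (f ((extChartAt I x₀).symm y)) :=
    mdifferentiableAt_extChartAt (by rwa [extChartAt_source] at hfy)
  have h1 : fderiv ℝ (extChartAt I' x₀' ∘ f ∘ (extChartAt I x₀).symm) y v =
      mfderiv I' 𝓘(ℝ, V') (extChartAt I' x₀') (f ((extChartAt I x₀).symm y))
        (mfderiv I I' f ((extChartAt I x₀).symm y)
          (mfderiv 𝓘(ℝ, V) I (extChartAt I x₀).symm y v)) := by
    rw [← mfderiv_eq_fderiv, mfderiv_comp (I' := I') y he (hf.comp y hσ),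
      mfderiv_comp (I' := I) y hf hσ]
    rfl
  have h2 := mfderivWithin_extChartAt_symm_comp_mfderiv_extChartAt' (I := I') hfy
  rw [h1]
  have h3 := DFunLike.congr_fun h2 (mfderiv I I' f ((extChartAt I x₀).symm y)
          (mfderiv 𝓘(ℝ, V) I (extChartAt I x₀).symm y v))
  rw [I.range_eq_univ, mfderivWithin_univ]
  exact h3.symm

/-- The target chart is arbitrary. Inserting it and its inverse at the image point factors the
differential of `f` through the coordinate expression of `f`. -/
theorem FormField.inChart_pullback [IsManifold I 1 X] [IsManifold I' 1 X']
    {f : X → X'} {k : ℕ} (Ω : FormField I' X' k) {x₀ : X} {x₀' : X'} {y : V}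
    (hf : MDifferentiableAt I I' f ((extChartAt I x₀).symm y))
    (hy : y ∈ (extChartAt I x₀).target)
    (hfy : f ((extChartAt I x₀).symm y) ∈ (extChartAt I' x₀').source) :
    (FormField.pullback (I := I) f Ω).inChart x₀ y =
      (Ω.inChart x₀' (extChartAt I' x₀' (f ((extChartAt I x₀).symm y)))).compContinuousLinearMap
        (fderiv ℝ (extChartAt I' x₀' ∘ f ∘ (extChartAt I x₀).symm) y) := by
  ext v
  rw [FormField.inChart_apply, FormField.pullback_apply,
    ContinuousAlternatingMap.compContinuousLinearMap_apply]
  have h : ∀ p, p = f ((extChartAt I x₀).symm y) → ∀ a b : Fin k → V', (∀ i, a i = b i) →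
      (Ω (f ((extChartAt I x₀).symm y)) : V' [⋀^Fin k]→L[ℝ] ℝ) a =
        (Ω p : V' [⋀^Fin k]→L[ℝ] ℝ) b := by
    rintro p rfl a b hab
    rw [funext hab]
  exact h _ ((extChartAt I' x₀').left_inv hfy) _ _
    fun i => mfderiv_comp_mfderivWithin_extChartAt_symm hf hy hfy (v i)

theorem FormField.pullback_id {k : ℕ} (Ω : FormField I X k) :
    FormField.pullback (I := I) id Ω = Ω := by
  refine FormField.ext fun x w => ?_
  rw [FormField.pullback_apply, mfderiv_id]
  rfl

/-- Change of charts for the coordinate expressions of a form. -/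
theorem FormField.inChart_eq [IsManifold I 1 X] {k : ℕ} (Ω : FormField I X k) {x₀ x₁ : X} {y : V}
    (hy : y ∈ (extChartAt I x₀).target)
    (hy' : (extChartAt I x₀).symm y ∈ (extChartAt I x₁).source) :
    Ω.inChart x₀ y = (Ω.inChart x₁
      (extChartAt I x₁ ((extChartAt I x₀).symm y))).compContinuousLinearMap
        (fderiv ℝ (extChartAt I x₁ ∘ (extChartAt I x₀).symm) y) := by
  conv_lhs => rw [← FormField.pullback_id Ω]
  exact FormField.inChart_pullback Ω mdifferentiableAt_id hy hy'

theorem FormField.IsSmooth.contDiffAt {k : ℕ} {Ω : FormField I X k}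
    (h : Ω.IsSmooth) {x₀ : X} {y : V} (hy : y ∈ (extChartAt I x₀).target) :
    ContDiffAt ℝ ∞ (Ω.inChart x₀) y :=
  (h x₀ y hy).contDiffAt (extChartAt_target_mem_nhds_of_mem hy)

theorem FormField.IsSmooth.differentiableAt {k : ℕ} {Ω : FormField I X k}
    (h : Ω.IsSmooth) {x₀ : X} {y : V} (hy : y ∈ (extChartAt I x₀).target) :
    DifferentiableAt ℝ (Ω.inChart x₀) y := (h.contDiffAt hy).differentiableAt (by simp)

theorem eventually_mem_extChartAt_target {x₀ : X} {y : V} (hy : y ∈ (extChartAt I x₀).target) :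
    ∀ᶠ z in nhds y, z ∈ (extChartAt I x₀).target := extChartAt_target_mem_nhds_of_mem hy

omit [I'.Boundaryless] in
theorem eventually_mem_extChartAt_source {f : X → X'} (hf : Continuous f) {x₀ : X} {x₀' : X'}
    {y : V} (hy : y ∈ (extChartAt I x₀).target)
    (hfy : f ((extChartAt I x₀).symm y) ∈ (extChartAt I' x₀').source) :
    ∀ᶠ z in nhds y, f ((extChartAt I x₀).symm z) ∈ (extChartAt I' x₀').source := by
  have hc : ContinuousAt (f ∘ (extChartAt I x₀).symm) y :=
    hf.continuousAt.comp (continuousAt_extChartAt_symm'' hy)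
  exact hc ((isOpen_extChartAt_source x₀').mem_nhds hfy)

theorem FormField.inChart_pullback_eventuallyEq [IsManifold I ∞ X] [IsManifold I' ∞ X']
    {f : X → X'} {k : ℕ} (Ω : FormField I' X' k) {x₀ : X} {x₀' : X'} {y : V}
    (hf : ContMDiff I I' ∞ f)
    (hy : y ∈ (extChartAt I x₀).target)
    (hfy : f ((extChartAt I x₀).symm y) ∈ (extChartAt I' x₀').source) :
    (FormField.pullback (I := I) f Ω).inChart x₀ =ᶠ[nhds y] fun z =>
      (Ω.inChart x₀' ((extChartAt I' x₀' ∘ f ∘ (extChartAt I x₀).symm) z)).compContinuousLinearMap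
        (fderiv ℝ (extChartAt I' x₀' ∘ f ∘ (extChartAt I x₀).symm) z) := by
  have : IsManifold I 1 X := .of_le (n := ∞) (by simp)
  have : IsManifold I' 1 X' := .of_le (n := ∞) (by simp)
  filter_upwards [eventually_mem_extChartAt_target hy,
    eventually_mem_extChartAt_source hf.continuous hy hfy] with z hz hfz
  exact FormField.inChart_pullback Ω ((hf _).mdifferentiableAt (by simp)) hz hfz

theorem FormField.IsSmooth.pullback [IsManifold I ∞ X] [IsManifold I' ∞ X']
    [FiniteDimensional ℝ V] {f : X → X'} (hf : ContMDiff I I' ∞ f) {k : ℕ}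
    {Ω : FormField I' X' k} (hΩ : Ω.IsSmooth) :
    (FormField.pullback (I := I) f Ω).IsSmooth := by
  intro x₀ y hy
  refine ContDiffAt.contDiffWithinAt ?_
  have hfy := mem_extChartAt_source (I := I') (f ((extChartAt I x₀).symm y))
  refine ContDiffAt.congr_of_eventuallyEq ?_
    (FormField.inChart_pullback_eventuallyEq Ω hf hy hfy)
  have hc := contDiffAt_writtenInCharts hf hy hfy
  refine ContDiffAt.alternating_comp ?_ (hc.fderiv_right (m := ∞) (by simp))
  exact ContDiffAt.comp y (hΩ.contDiffAt ((extChartAt I' _).map_source hfy)) hc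

/-- The definition of `d` uses a different chart at every point. Chart independence holds because
the coordinate exterior derivative commutes with pullback along the transition map between the chart
at `x₀` and the chart at the point. -/
theorem FormField.inChart_d [IsManifold I ∞ X] {k : ℕ} {Ω : FormField I X k} (hΩ : Ω.IsSmooth)
    {x₀ : X} {y : V} (hy : y ∈ (extChartAt I x₀).target) :
    Ω.d.inChart x₀ y = extDeriv (Ω.inChart x₀) y := by
  have : IsManifold I 1 X := .of_le (n := ∞) (by simp)
  set p := (extChartAt I x₀).symm y with hp
  have hfy := mem_extChartAt_source (I := I) p
  have h1 := FormField.inChart_pullback_eventuallyEq (f := id) Ω contMDiff_id hy hfy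
  rw [FormField.pullback_id] at h1
  have hc := contDiffAt_writtenInCharts (I := I) (I' := I) (f := id) contMDiff_id hy hfy
  have h3 := extDeriv_pullback (r := ∞) (f := extChartAt I p ∘ id ∘ (extChartAt I x₀).symm)
    (hΩ.differentiableAt ((extChartAt I _).map_source hfy)) hc minSmoothness_two_le_infty
  rw [h1.extDeriv_eq, h3, FormField.inChart_eq Ω.d hy hfy, ← hp, FormField.inChart_self,
    FormField.d_eq]
  rfl

theorem FormField.IsSmooth.d [IsManifold I ∞ X] {k : ℕ} {Ω : FormField I X k}
    (hΩ : Ω.IsSmooth) : Ω.d.IsSmooth := by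
  intro x₀ y hy
  refine ContDiffAt.contDiffWithinAt ?_
  refine ContDiffAt.congr_of_eventuallyEq (hΩ.contDiffAt hy).extDeriv ?_
  filter_upwards [eventually_mem_extChartAt_target hy] with z hz
  exact FormField.inChart_d hΩ hz

/-- The exterior derivative commutes with pullbacks. -/
theorem FormField.d_pullback [IsManifold I ∞ X] [IsManifold I' ∞ X']
    {f : X → X'} (hf : ContMDiff I I' ∞ f) {k : ℕ}
    {Ω : FormField I' X' k} (hΩ : Ω.IsSmooth) :
    (FormField.pullback (I := I) f Ω).d = FormField.pullback f Ω.d := by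
  have : IsManifold I 1 X := .of_le (n := ∞) (by simp)
  have : IsManifold I' 1 X' := .of_le (n := ∞) (by simp)
  refine FormField.ext fun x w => ?_
  have hy := mem_extChartAt_target (I := I) x
  have hx := extChartAt_to_inv (I := I) x
  have hfy : f ((extChartAt I x).symm (extChartAt I x x)) ∈ (extChartAt I' (f x)).source := by
    rw [hx]; exact mem_extChartAt_source _
  have hfy' := (extChartAt I' (f x)).map_source hfy
  have h1 : (FormField.pullback (I := I) f Ω).d.inChart x (extChartAt I x x) =
      (FormField.pullback (I := I) f Ω.d).inChart x (extChartAt I x x) := by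
    rw [FormField.inChart_self, FormField.d_eq,
      (FormField.inChart_pullback_eventuallyEq Ω hf hy hfy).extDeriv_eq,
      (FormField.inChart_pullback_eventuallyEq Ω.d hf hy hfy).eq_of_nhds]
    refine (extDeriv_pullback (r := ∞) (f := extChartAt I' (f x) ∘ f ∘ (extChartAt I x).symm)
      (hΩ.differentiableAt hfy')
      (contDiffAt_writtenInCharts hf hy hfy) minSmoothness_two_le_infty).trans ?_
    simp only [Function.comp_apply]
    rw [FormField.inChart_d hΩ hfy']
  rw [FormField.inChart_self, FormField.inChart_self] at h1
  exact DFunLike.congr_fun h1 w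

/-- In a single fixed chart `d` is the coordinate exterior derivative on a whole neighbourhood, so
the flat identity applies. -/
theorem FormField.d_d [IsManifold I ∞ X] {k : ℕ} {Ω : FormField I X k} (hΩ : Ω.IsSmooth) :
    Ω.d.d = 0 := by
  have : IsManifold I 1 X := .of_le (n := ∞) (by simp)
  funext x
  have hy := mem_extChartAt_target (I := I) x
  have h : Ω.d.inChart x =ᶠ[nhds (extChartAt I x x)] extDeriv (Ω.inChart x) := by
    filter_upwards [eventually_mem_extChartAt_target hy] with z hz
    exact FormField.inChart_d hΩ hz
  rw [FormField.d_eq, h.extDeriv_eq]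
  refine (extDeriv_extDeriv_apply (r := ∞) (hΩ.contDiffAt hy)
    minSmoothness_two_le_infty).trans rfl


theorem FormField.IsSmooth.add {k : ℕ} {Ω Ω' : FormField I X k} (h : Ω.IsSmooth)
    (h' : Ω'.IsSmooth) : (Ω + Ω').IsSmooth := by
  intro x₀
  have : (Ω + Ω').inChart x₀ = fun y => Ω.inChart x₀ y + Ω'.inChart x₀ y := by
    funext y; ext v; rfl
  rw [this]
  exact (h x₀).add (h' x₀)

theorem FormField.IsSmooth.const_smul {k : ℕ} {Ω : FormField I X k} (c : ℝ) (h : Ω.IsSmooth) :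
    (c • Ω).IsSmooth := by
  intro x₀
  have : (c • Ω).inChart x₀ = fun y => c • Ω.inChart x₀ y := by
    funext y; ext v; rfl
  rw [this]
  exact (h x₀).const_smul c

theorem FormField.d_add [IsManifold I ∞ X] {k : ℕ} {Ω Ω' : FormField I X k} (h : Ω.IsSmooth)
    (h' : Ω'.IsSmooth) : (Ω + Ω').d = Ω.d + Ω'.d := by
  have : IsManifold I 1 X := .of_le (n := ∞) (by simp)
  funext x
  have hy := mem_extChartAt_target (I := I) x
  have e : (Ω + Ω').inChart x = fun y => Ω.inChart x y + Ω'.inChart x y := by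
    funext y; ext v; rfl
  change (Ω + Ω').d x = Ω.d x + Ω'.d x
  rw [FormField.d_eq, FormField.d_eq, FormField.d_eq, e]
  exact extDeriv_fun_add (h.differentiableAt hy) (h'.differentiableAt hy)

theorem FormField.d_const_smul [IsManifold I ∞ X] {k : ℕ} (c : ℝ) (Ω : FormField I X k) :
    (c • Ω).d = c • Ω.d := by
  have : IsManifold I 1 X := .of_le (n := ∞) (by simp)
  funext x
  have e : (c • Ω).inChart x = c • Ω.inChart x := by
    funext y; ext v; rfl
  change (c • Ω).d x = c • Ω.d x
  rw [FormField.d_eq, FormField.d_eq, e]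
  exact extDeriv_smul c _

theorem FormField.d_sub [IsManifold I ∞ X] {k : ℕ} {Ω Ω' : FormField I X k} (h : Ω.IsSmooth)
    (h' : Ω'.IsSmooth) : (Ω - Ω').d = Ω.d - Ω'.d := by
  have e : ∀ (m : ℕ) (α β : FormField I X m), α - β = α + (-1 : ℝ) • β := by
    intro m α β
    refine FormField.ext fun x w => ?_
    change α x w - β x w = α x w + (-1 : ℝ) • β x w
    simp [sub_eq_add_neg]
  rw [e, e, FormField.d_add h (h'.const_smul _), FormField.d_const_smul]

/-- A vector field is smooth. -/
def IsSmoothField [IsManifold I ∞ X] (v : ∀ x : X, TangentSpace I x) : Prop :=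
  ContMDiff I I.tangent ∞ (fun x => (⟨x, v x⟩ : TangentBundle I X))

/-- The coordinate expression of a vector field in the chart at `x₀`. -/
def fieldInChart (v : ∀ x : X, TangentSpace I x) (x₀ : X) (y : V) : V :=
  mfderiv I 𝓘(ℝ, V) (extChartAt I x₀) ((extChartAt I x₀).symm y) (v ((extChartAt I x₀).symm y))

theorem mfderivWithin_fieldInChart [IsManifold I 1 X] (v : ∀ x : X, TangentSpace I x) {x₀ : X}
    {y : V} (hy : y ∈ (extChartAt I x₀).target) :
    mfderivWithin 𝓘(ℝ, V) I (extChartAt I x₀).symm (Set.range I) y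
        (fieldInChart (V := V) (I := I) v x₀ y) = v ((extChartAt I x₀).symm y) :=
  DFunLike.congr_fun (mfderivWithin_extChartAt_symm_comp_mfderiv_extChartAt (I := I) hy)
    (v ((extChartAt I x₀).symm y))

theorem fieldInChart_self [IsManifold I 1 X] (v : ∀ x : X, TangentSpace I x) (x : X) :
    fieldInChart v x (extChartAt I x x) = v x := by
  have h : ∀ y, y = x → (mfderiv I 𝓘(ℝ, V) (extChartAt I x) y (v y) : V) = v x := by
    rintro y rfl
    rw [mfderiv_extChartAt_self]
    rfl
  exact h _ (extChartAt_to_inv x)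

theorem trivializationAt_tangent_snd [IsManifold I 1 X] {x₀ x : X}
    (hx : x ∈ (extChartAt I x₀).source) (v : TangentSpace I x) :
    (trivializationAt V (TangentSpace I) x₀ (⟨x, v⟩ : TangentBundle I X)).2 =
      mfderiv I 𝓘(ℝ, V) (extChartAt I x₀) x v := by
  have hx' : x ∈ (chartAt H x₀).source := by rwa [extChartAt_source] at hx
  have h := DFunLike.congr_fun (TangentBundle.continuousLinearMapAt_trivializationAt (I := I) hx') v
  refine Eq.trans ?_ h
  rw [Bundle.Trivialization.continuousLinearMapAt_apply, Bundle.Trivialization.linearMapAt_apply,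
    if_pos (by simpa using hx')]

theorem IsSmoothField.contDiffAt [IsManifold I ∞ X] {v : ∀ x : X, TangentSpace I x}
    (hv : IsSmoothField v) {x₀ : X} {y : V} (hy : y ∈ (extChartAt I x₀).target) :
    ContDiffAt ℝ ∞ (fieldInChart v x₀) y := by
  have : IsManifold I 1 X := .of_le (n := ∞) (by simp)
  have hb : (extChartAt I x₀).symm y ∈ (trivializationAt V (TangentSpace I) x₀ :
      Trivialization V (π V (TangentSpace I : X → Type _))).baseSet := by
    have := (extChartAt I x₀).map_target hy
    rw [extChartAt_source] at this
    simpa using this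
  have h1 := (Bundle.Trivialization.contMDiffAt_section_iff (IB := I) (n := ∞)
    (e := trivializationAt V (TangentSpace I) x₀) (s := v) hb).mp (hv _)
  rw [← contMDiffAt_iff_contDiffAt]
  refine (ContMDiffAt.comp y h1 (contMDiffAt_extChartAt_symm hy)).congr_of_eventuallyEq ?_
  filter_upwards [eventually_mem_extChartAt_target hy] with z hz
  exact (trivializationAt_tangent_snd ((extChartAt I x₀).map_target hz) _).symm

theorem FormField.inChart_interior [IsManifold I 1 X] {k : ℕ} (v : ∀ x : X, TangentSpace I x)
    (Ω : FormField I X (k + 1)) {x₀ : X} {y : V} (hy : y ∈ (extChartAt I x₀).target) :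
    (Ω.interior v).inChart x₀ y = (Ω.inChart x₀ y).curryLeft (fieldInChart v x₀ y) := by
  ext w
  rw [ContinuousAlternatingMap.curryLeft_apply_apply, FormField.inChart_apply,
    FormField.inChart_apply, FormField.interior_apply]
  congr 1
  funext i
  refine Fin.cases ?_ (fun j => rfl) i
  exact (mfderivWithin_fieldInChart v hy).symm

theorem FormField.IsSmooth.interior [IsManifold I ∞ X] [FiniteDimensional ℝ V] {k : ℕ}
    {v : ∀ x : X, TangentSpace I x} (hv : IsSmoothField v)
    {Ω : FormField I X (k + 1)} (hΩ : Ω.IsSmooth) : (Ω.interior v).IsSmooth := by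
  have : IsManifold I 1 X := .of_le (n := ∞) (by simp)
  intro x₀ y hy
  refine ContDiffAt.contDiffWithinAt ?_
  have h : ContDiffAt ℝ ∞ (fun z => (Ω.inChart x₀ z).curryLeft (fieldInChart v x₀ z)) y :=
    (((contDiff_curryLeft V k ∞).contDiffAt).comp y (hΩ.contDiffAt hy)).clm_apply
      (hv.contDiffAt hy)
  refine h.congr_of_eventuallyEq ?_
  filter_upwards [eventually_mem_extChartAt_target hy] with z hz
  exact FormField.inChart_interior v Ω hz

theorem FormField.IsSmooth.lieDeriv [IsManifold I ∞ X] [FiniteDimensional ℝ V] {k : ℕ}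
    {v : ∀ x : X, TangentSpace I x} (hv : IsSmoothField v)
    {Ω : FormField I X (k + 1)} (hΩ : Ω.IsSmooth) : (Ω.lieDeriv v).IsSmooth :=
  (hΩ.d.interior hv).add (hΩ.interior hv).d

/-- The Lie derivative in the chart at `x`. -/
theorem FormField.lieDeriv_apply [IsManifold I ∞ X] {k : ℕ}
    {v : ∀ x : X, TangentSpace I x} (hv : IsSmoothField v) {Ω : FormField I X (k + 1)}
    (hΩ : Ω.IsSmooth) (x : X) (w : Fin (k + 1) → V) :
    (Ω.lieDeriv v x : V [⋀^Fin (k + 1)]→L[ℝ] ℝ) w =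
      fderiv ℝ (Ω.inChart x) (extChartAt I x x) (v x) w +
        ∑ i, (Ω x : V [⋀^Fin (k + 1)]→L[ℝ] ℝ) (Function.update w i
          (fderiv ℝ (fieldInChart v x) (extChartAt I x x) (w i))) := by
  have : IsManifold I 1 X := .of_le (n := ∞) (by simp)
  have hy := mem_extChartAt_target (I := I) x
  have h := extDeriv_curryLeft_add (X := fieldInChart v x) (hΩ.differentiableAt hy)
    ((hv.contDiffAt hy).differentiableAt (by simp)) w
  rw [fieldInChart_self, FormField.inChart_self, ← FormField.d_eq] at h
  have e : (Ω.interior v).inChart x =ᶠ[nhds (extChartAt I x x)]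
      fun y => (Ω.inChart x y).curryLeft (fieldInChart v x y) := by
    filter_upwards [eventually_mem_extChartAt_target hy] with z hz
    exact FormField.inChart_interior v Ω hz
  rw [← e.extDeriv_eq, ← FormField.d_eq] at h
  exact h

end FormCharts

/-! ### Submersions and basic forms -/

section SubmersionCoordinates

variable {V V' : Type*} [NormedAddCommGroup V] [NormedSpace ℝ V] [FiniteDimensional ℝ V]
  [NormedAddCommGroup V'] [NormedSpace ℝ V'] [FiniteDimensional ℝ V']

/-- Submersion coordinates: a map `f` with surjective derivative at `x` has a local smooth inverse
`Θ` on the product with the kernel. -/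
theorem exists_submersion_coordinates {f : V → V'} {x : V} (hf : ContDiffAt ℝ ∞ f x)
    (hs : Function.Surjective (fderiv ℝ f x)) :
    ∃ (K : Submodule ℝ V) (Θ : V' × K → V) (κ : V → K),
      ContDiffAt ℝ ∞ Θ (f x, 0) ∧ Θ (f x, 0) = x ∧ ContinuousAt κ x ∧ κ x = 0 ∧
      (∀ᶠ p in nhds (f x, 0), f (Θ p) = p.1) ∧ (∀ᶠ z in nhds x, Θ (f z, κ z) = z) ∧
      ((∀ᶠ z in nhds x, ContDiffAt ℝ ∞ f z) → ∀ᶠ p in nhds (f x, 0), ContDiffAt ℝ ∞ Θ p) := by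
  obtain ⟨pr, hpr⟩ : (fderiv ℝ f x).ker.ClosedComplemented :=
    (fderiv ℝ f x).ker_closedComplemented_of_finiteDimensional_range
  -- A projection onto the kernel of the derivative completes `f` to a map with bijective derivative
  -- at `x`; Θ is its local inverse.
  set G : V → V' × (fderiv ℝ f x).ker := fun z => (f z, pr (z - x)) with hG
  have hGc : ContDiffAt ℝ ∞ G x :=
    hf.prodMk (pr.contDiff.contDiffAt.comp x (contDiffAt_id.sub contDiffAt_const))
  set D : V →L[ℝ] V' × (fderiv ℝ f x).ker := (fderiv ℝ f x).prod pr with hD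
  have hGd : HasFDerivAt G D x := by
    refine HasFDerivAt.prodMk (hf.differentiableAt (by simp)).hasFDerivAt ?_
    exact pr.hasFDerivAt.comp x ((hasFDerivAt_id x).sub_const x)
  have hbij : Function.Bijective D := by
    constructor
    · rw [injective_iff_map_eq_zero]
      intro v hv
      have h1 : fderiv ℝ f x v = 0 := congrArg Prod.fst hv
      have h2 : pr v = 0 := congrArg Prod.snd hv
      have h3 := hpr ⟨v, h1⟩
      rw [h2] at h3
      exact (congrArg Subtype.val h3).symm
    · rintro ⟨a, b⟩
      obtain ⟨v, hv⟩ := hs a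
      refine ⟨v + (b - pr v : (fderiv ℝ f x).ker), Prod.ext ?_ ?_⟩
      · change fderiv ℝ f x (v + ((b - pr v : (fderiv ℝ f x).ker) : V)) = a
        have : fderiv ℝ f x ((b - pr v : (fderiv ℝ f x).ker) : V) = 0 := (b - pr v).2
        rw [map_add, this, hv, add_zero]
      · change pr (v + ((b - pr v : (fderiv ℝ f x).ker) : V)) = b
        rw [map_add, hpr]; abel
  let e : V ≃L[ℝ] V' × (fderiv ℝ f x).ker :=
    (LinearEquiv.ofBijective D.toLinearMap hbij).toContinuousLinearEquiv
  have hGe : HasFDerivAt G (e : V →L[ℝ] V' × (fderiv ℝ f x).ker) x := by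
    have : (e : V →L[ℝ] V' × (fderiv ℝ f x).ker) = D := by ext <;> rfl
    rw [this]; exact hGd
  have hGx : G x = (f x, 0) := by simp [hG]
  have hst := hGc.hasStrictFDerivAt' hGe (by simp : (∞ : WithTop ℕ∞) ≠ 0)
  have h1 := hGc.to_localInverse hGe (by simp)
  have h2 := hst.eventually_right_inverse
  have h3 := hst.eventually_left_inverse
  rw [hGx] at h1 h2
  refine ⟨_, hGc.localInverse hGe (by simp), fun z => pr (z - x), h1, ?_, ?_, by simp, ?_, h3, ?_⟩
  · rw [← hGx]; exact hGc.localInverse_apply_image hGe (by simp)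
  · fun_prop
  · filter_upwards [h2] with p hp
    exact congrArg Prod.fst hp
  -- Smoothness of order ∞ at the single point does not supply one neighbourhood on which Θ is
  -- smooth to all orders. It is obtained by applying the inverse function theorem at each nearby
  -- point, where `G` is smooth and its derivative is still invertible, invertibility being an open
  -- condition.
  · intro hev
    have h4 : hGc.localInverse hGe (by simp) (f x, 0) = x := by
      rw [← hGx]; exact hGc.localInverse_apply_image hGe (by simp)
    have hsm : ∀ᶠ z in nhds x, ContDiffAt ℝ ∞ G z := hev.mono fun z hz =>
      hz.prodMk (pr.contDiff.contDiffAt.comp z (contDiffAt_id.sub contDiffAt_const))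
    have hinv : ∀ᶠ z in nhds x, fderiv ℝ G z ∈
        Set.range ((↑) : (V ≃L[ℝ] V' × (fderiv ℝ f x).ker) → V →L[ℝ] V' × (fderiv ℝ f x).ker) := by
      refine (hGc.fderiv_right (m := 0) (by simp)).continuousAt.eventually_mem ?_
      rw [hGe.fderiv]
      exact e.nhds
    have ht : Filter.Tendsto (hGc.localInverse hGe (by simp)) (nhds (f x, 0)) (nhds x) := by
      have := h1.continuousAt.tendsto
      rwa [h4] at this
    have htgt : (f x, 0) ∈ (hst.toOpenPartialHomeomorph G).target := by
      rw [← hGx]; exact hst.image_mem_toOpenPartialHomeomorph_target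
    filter_upwards [ht.eventually hsm, ht.eventually hinv,
      (hst.toOpenPartialHomeomorph G).open_target.mem_nhds htgt] with p hp1 ⟨e', he'⟩ hp3
    refine (hst.toOpenPartialHomeomorph G).contDiffAt_symm (f₀' := e') hp3 ?_ hp1
    rw [he']
    exact (hp1.differentiableAt (by simp)).hasFDerivAt

/-- An alternating map that vanishes as soon as one argument is in the kernel of `L` depends only
on the images of the arguments under `L`. -/
theorem ContinuousAlternatingMap.eq_of_map_eq {k : ℕ} (α : V [⋀^Fin k]→L[ℝ] ℝ) (L : V →L[ℝ] V')
    (hα : ∀ w : Fin k → V, (∃ i, L (w i) = 0) → α w = 0) {w w' : Fin k → V}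
    (h : ∀ i, L (w i) = L (w' i)) : α w = α w' := by
  have key : ∀ s : Finset (Fin k), α (s.piecewise w w') = α w' := by
    intro s
    induction s using Finset.induction_on with
    | empty => simp
    | insert j s hj ih =>
      rw [Finset.piecewise_insert, ← ih, ← sub_eq_zero]
      have e : s.piecewise w w' = Function.update (s.piecewise w w') j (w' j) := by
        rw [eq_comm, Function.update_eq_self_iff, Finset.piecewise_eq_of_notMem _ _ _ hj]
      conv_lhs => rw [e]
      rw [Function.update_idem, ← α.map_update_sub]
      exact hα _ ⟨j, by simp [h j]⟩
  simpa using key Finset.univ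

/-- Let β be the pullback of Ω to the product coordinates `V' × K`, where `f` is the first
projection. Insert one vertical vector (0, a) into dβ. Every term but the derivative of β along (0,
a) differentiates a function that vanishes identically nearby, since it still contains the entry (0,
a). As dβ is horizontal too, the coefficients of β are locally constant in the `K` direction, and Ω
is recovered from these coefficients. -/
theorem eventually_apply_eq_of_horizontal {f : V → V'} {x : V} (hf : ContDiffAt ℝ ∞ f x)
    (hs : Function.Surjective (fderiv ℝ f x)) {k : ℕ} {Ω : V → V [⋀^Fin k]→L[ℝ] ℝ}
    (hΩ : ContDiffAt ℝ ∞ Ω x)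
    (h0 : ∀ᶠ z in nhds x, ∀ w : Fin k → V, (∃ i, fderiv ℝ f z (w i) = 0) → Ω z w = 0)
    (h1 : ∀ᶠ z in nhds x, ∀ w : Fin (k + 1) → V, (∃ i, fderiv ℝ f z (w i) = 0) →
      extDeriv Ω z w = 0) :
    ∀ᶠ z in nhds x, f z = f x → ∀ w w' : Fin k → V,
      (∀ i, fderiv ℝ f x (w i) = fderiv ℝ f z (w' i)) → Ω x w = Ω z w' := by
  obtain ⟨K, Θ, κ, hΘ, hΘx, hκ, hκx, hfΘ, hΘκ, -⟩ := exists_submersion_coordinates hf hs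
  set β : V' × K → (V' × K) [⋀^Fin k]→L[ℝ] ℝ := fun p =>
    (Ω (Θ p)).compContinuousLinearMap (fderiv ℝ Θ p) with hβ
  have hΘc : Filter.Tendsto Θ (nhds (f x, 0)) (nhds x) := by
    have := hΘ.continuousAt.tendsto; rwa [hΘx] at this
  have hΘ2 : ∀ᶠ p in nhds (f x, (0 : K)), ContDiffAt ℝ 2 Θ p :=
    (hΘ.of_le (m := 2) ENat.LEInfty.out).eventually (by simp)
  have hf2 : ∀ᶠ z in nhds x, ContDiffAt ℝ 2 f z :=
    (hf.of_le (m := 2) ENat.LEInfty.out).eventually (by simp)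
  have hΩ2 : ∀ᶠ z in nhds x, ContDiffAt ℝ 2 Ω z :=
    (hΩ.of_le (m := 2) ENat.LEInfty.out).eventually (by simp)
  -- the derivative of the first coordinate
  have hD : ∀ᶠ p in nhds (f x, (0 : K)), ∀ u, fderiv ℝ f (Θ p) (fderiv ℝ Θ p u) = u.1 := by
    filter_upwards [hfΘ.eventually_nhds, hΘ2, hΘc.eventually hf2] with p hp hp2 hpf u
    have e : (fun q => f (Θ q)) =ᶠ[nhds p] fun q => q.1 := hp
    have h2 := e.fderiv_eq (𝕜 := ℝ)
    rw [fderiv_fst] at h2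
    have h3 := fderiv_comp (𝕜 := ℝ) p (hpf.differentiableAt (by simp))
      (hp2.differentiableAt (by simp))
    have h4 : fderiv ℝ (f ∘ Θ) p u = u.1 := DFunLike.congr_fun h2 u
    rw [h3] at h4
    exact h4
  have hβ0 : ∀ᶠ p in nhds (f x, (0 : K)), ∀ w : Fin k → V' × K, (∃ i, (w i).1 = 0) →
      β p w = 0 := by
    filter_upwards [hD, hΘc.eventually h0] with p hp hp0 w ⟨i, hi⟩
    exact hp0 _ ⟨i, (hp (w i)).trans hi⟩
  have hβd : ∀ᶠ p in nhds (f x, (0 : K)), DifferentiableAt ℝ β p := by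
    filter_upwards [hΘ2, hΘc.eventually hΩ2] with p hp hpΩ
    exact DifferentiableAt.continuousAlternatingMapCompContinuousLinearMap
      ((hpΩ.differentiableAt (by simp)).comp p (hp.differentiableAt (by simp)))
      ((hp.fderiv_right (m := 1) le_rfl).differentiableAt (by simp))
  have hβ1 : ∀ᶠ p in nhds (f x, (0 : K)), ∀ w : Fin (k + 1) → V' × K, (∃ i, (w i).1 = 0) →
      extDeriv β p w = 0 := by
    filter_upwards [hD, hΘc.eventually h1, hΘ2, hΘc.eventually hΩ2] with p hp hp1 hp2 hpΩ w ⟨i, hi⟩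
    rw [hβ, extDeriv_pullback (r := 2) (hpΩ.differentiableAt (by simp)) hp2 (by simp)]
    exact hp1 _ ⟨i, (hp (w i)).trans hi⟩
  have hconst : ∀ᶠ p in nhds (f x, (0 : K)), ∀ (v : Fin k → V') (a : K),
      fderiv ℝ (fun q => β q (fun i => (v i, 0))) p (0, a) = 0 := by
    filter_upwards [hβ0.eventually_nhds, hβ1, hβd] with p hp0 hp1 hpd v a
    have h := hp1 (Matrix.vecCons (0, a) (fun i => (v i, 0))) ⟨0, rfl⟩
    rw [extDeriv_apply hpd, Fin.sum_univ_succ, Finset.sum_eq_zero, add_zero] at h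
    · simpa using h
    · intro i _
      have e : (fun q => β q (i.succ.removeNth (Matrix.vecCons ((0 : V'), a)
          (fun i => (v i, (0 : K)))))) =ᶠ[nhds p] fun _ => (0 : ℝ) := by
        -- An index of `Fin k` is at hand, so the degree is positive and slot 0 of the remaining
        -- arguments is the vertical vector.
        have : k ≠ 0 := fun hk => by subst hk; exact i.elim0
        obtain ⟨m, rfl⟩ := Nat.exists_eq_succ_of_ne_zero this
        filter_upwards [hp0] with q hq
        exact hq _ ⟨0, by simp [Fin.removeNth]⟩
      rw [e.fderiv_eq]; simp
  -- constancy along the fibre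
  obtain ⟨ε, hε, hball⟩ := Metric.eventually_nhds_iff_ball.mp (hconst.and hβd)
  have hc : ∀ b ∈ Metric.ball (0 : K) ε, ∀ v : Fin k → V',
      β (f x, b) (fun i => (v i, 0)) = β (f x, 0) (fun i => (v i, 0)) := by
    intro b hb v
    have hmem : ∀ c ∈ Metric.ball (0 : K) ε, (f x, c) ∈ Metric.ball (f x, (0 : K)) ε := by
      intro c hc
      rw [Metric.mem_ball, Prod.dist_eq, dist_self]
      exact max_lt hε hc
    have hd : ∀ c ∈ Metric.ball (0 : K) ε,
        HasFDerivAt (fun c : K => β (f x, c) (fun i => (v i, (0 : K)))) (0 : K →L[ℝ] ℝ) c := by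
      intro c hc
      obtain ⟨hz, hdiff⟩ := hball _ (hmem c hc)
      have h1 : DifferentiableAt ℝ (fun q => β q (fun i => (v i, (0 : K)))) (f x, c) :=
        hdiff.continuousAlternatingMap_apply fun i => differentiableAt_const _
      have h2 := h1.hasFDerivAt.comp c (hasFDerivAt_prodMk_right (f x) c)
      have h3 : (0 : K →L[ℝ] ℝ) = (fderiv ℝ (fun q => β q (fun i => (v i, (0 : K)))) (f x, c)).comp
          (ContinuousLinearMap.inr ℝ V' K) := ContinuousLinearMap.ext fun a => (hz v a).symm
      rw [h3]
      exact h2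
    refine (convex_ball (0 : K) ε).is_const_of_fderivWithin_eq_zero (𝕜 := ℝ)
      (f := fun c : K => β (f x, c) (fun i => (v i, (0 : K))))
      (fun c hc => (hd c hc).differentiableAt.differentiableWithinAt) (fun c hc => ?_) hb
      (Metric.mem_ball_self hε)
    rw [fderivWithin_of_isOpen Metric.isOpen_ball hc, (hd c hc).fderiv]
  have hκball : ∀ᶠ z in nhds x, κ z ∈ Metric.ball (0 : K) ε := by
    have := hκ.tendsto; rw [hκx] at this
    exact this (Metric.ball_mem_nhds _ hε)
  have hκD : ∀ᶠ z in nhds x, ∀ u, fderiv ℝ f (Θ (f z, κ z)) (fderiv ℝ Θ (f z, κ z) u) = u.1 := by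
    have : Filter.Tendsto (fun z => (f z, κ z)) (nhds x) (nhds (f x, 0)) := by
      have := hf.continuousAt.prodMk hκ
      rw [ContinuousAt, hκx] at this; exact this
    exact this.eventually hD
  -- The vectors `w i` and DΘ(df(w i), 0) have the same image under df, and a horizontal form sees
  -- only these images.
  have hrep : ∀ z, Θ (f z, κ z) = z →
      (∀ w : Fin k → V, (∃ i, fderiv ℝ f z (w i) = 0) → Ω z w = 0) →
      (∀ u, fderiv ℝ f (Θ (f z, κ z)) (fderiv ℝ Θ (f z, κ z) u) = u.1) → ∀ w : Fin k → V,
      Ω z w = β (f z, κ z) (fun i => (fderiv ℝ f z (w i), 0)) := by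
    intro z hz hz0 hzD w
    have : β (f z, κ z) (fun i => (fderiv ℝ f z (w i), 0)) =
        Ω z (fun i => fderiv ℝ Θ (f z, κ z) (fderiv ℝ f z (w i), 0)) := by
      simp only [hβ, hz]; rfl
    rw [this]
    refine ContinuousAlternatingMap.eq_of_map_eq _ (fderiv ℝ f z) hz0 fun i => ?_
    have h := hzD (fderiv ℝ f z (w i), 0)
    rw [hz] at h
    exact h.symm
  filter_upwards [hκball, hκD, hΘκ, h0] with z hzb hzD hzΘ hz0 hfz w w' hww
  rw [hrep z hzΘ hz0 hzD, hrep x hΘκ.self_of_nhds h0.self_of_nhds hκD.self_of_nhds, hκx, hfz]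
  simp only [hww]
  rw [hc (κ z) hzb]

end SubmersionCoordinates

theorem exists_rightInverse_clm {V V' : Type*} [NormedAddCommGroup V] [NormedSpace ℝ V]
    [NormedAddCommGroup V'] [NormedSpace ℝ V'] [FiniteDimensional ℝ V'] (L : V →L[ℝ] V')
    (hL : Function.Surjective L) : ∃ R : V' →L[ℝ] V, ∀ v, L (R v) = v := by
  obtain ⟨R, hR⟩ := LinearMap.exists_rightInverse_of_surjective L.toLinearMap
    (LinearMap.range_eq_top.mpr hL)
  exact ⟨LinearMap.toContinuousLinearMap R, fun v => LinearMap.congr_fun hR v⟩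

/-! ### Descent of forms along submersions with connected fibres -/

section BasicForms

variable {V H X : Type*} [NormedAddCommGroup V] [NormedSpace ℝ V] [TopologicalSpace H]
  {I : ModelWithCorners ℝ V H} [TopologicalSpace X] [ChartedSpace H X] [I.Boundaryless]
  {V' H' X' : Type*} [NormedAddCommGroup V'] [NormedSpace ℝ V']
  [TopologicalSpace H'] {I' : ModelWithCorners ℝ V' H'} [I'.Boundaryless] [TopologicalSpace X']
  [ChartedSpace H' X']

/-- A form is horizontal for `f` if it vanishes as soon as one argument is tangent to the fibres
of `f`. -/
def FormField.IsHorizontal (I' : ModelWithCorners ℝ V' H') {k : ℕ} (f : X → X')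
    (Ω : FormField I X k) : Prop :=
  ∀ (x : X) (w : Fin k → TangentSpace I x), (∃ i, mfderiv I I' f x (w i) = 0) → Ω x w = 0

/-- The values of `Ω` at `x` and at `x'` agree on tuples of tangent vectors with the same image
under the derivative of `f`. -/
def FormField.AgreeAt (I' : ModelWithCorners ℝ V' H') {k : ℕ} (f : X → X')
    (Ω : FormField I X k) (x x' : X) : Prop :=
  ∀ w w' : Fin k → V, (∀ i, (mfderiv I I' f x (w i) : V') = mfderiv I I' f x' (w' i)) →
    (Ω x : V [⋀^Fin k]→L[ℝ] ℝ) w = (Ω x' : V [⋀^Fin k]→L[ℝ] ℝ) w'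

section Descent
variable [IsManifold I ∞ X] [IsManifold I' ∞ X'] {f : X → X'} (hf : ContMDiff I I' ∞ f)
include hf

theorem fderiv_writtenInCharts_apply {x₀ : X} {x₀' : X'} {y : V}
    (hy : y ∈ (extChartAt I x₀).target)
    (hfy : f ((extChartAt I x₀).symm y) ∈ (extChartAt I' x₀').source) (v : V) :
    fderiv ℝ (extChartAt I' x₀' ∘ f ∘ (extChartAt I x₀).symm) y v =
      mfderiv I' 𝓘(ℝ, V') (extChartAt I' x₀') (f ((extChartAt I x₀).symm y))
        (mfderiv I I' f ((extChartAt I x₀).symm y)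
          (mfderivWithin 𝓘(ℝ, V) I (extChartAt I x₀).symm (Set.range I) y v)) := by
  have : IsManifold I 1 X := .of_le (n := ∞) (by simp)
  have : IsManifold I' 1 X' := .of_le (n := ∞) (by simp)
  have hσ := mdifferentiableAt_extChartAt_symm (I := I) hy
  have he : MDifferentiableAt I' 𝓘(ℝ, V') (extChartAt I' x₀')
      (f ((extChartAt I x₀).symm y)) :=
    mdifferentiableAt_extChartAt (by rwa [extChartAt_source] at hfy)
  have hf' := (hf ((extChartAt I x₀).symm y)).mdifferentiableAt (by simp : (∞ : WithTop ℕ∞) ≠ 0)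
  rw [I.range_eq_univ, mfderivWithin_univ, ← mfderiv_eq_fderiv,
    mfderiv_comp (I' := I') y he (hf'.comp y hσ), mfderiv_comp (I' := I) y hf' hσ]
  rfl

theorem fderiv_writtenInCharts_self (x : X) (v : V) :
    fderiv ℝ (extChartAt I' (f x) ∘ f ∘ (extChartAt I x).symm) (extChartAt I x x) v =
      (mfderiv I I' f x v : V') := by
  have hd := (hf x).mdifferentiableAt (by simp : (∞ : WithTop ℕ∞) ≠ 0)
  have h : mfderiv I I' f x = fderivWithin ℝ (writtenInExtChartAt I I' x f) (Set.range I)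
      (extChartAt I x x) := if_pos hd
  have e : ∀ s : Set V, s = Set.univ → fderivWithin ℝ (writtenInExtChartAt I I' x f) s
      (extChartAt I x x) = fderiv ℝ (writtenInExtChartAt I I' x f) (extChartAt I x x) := by
    rintro s rfl; rw [fderivWithin_univ]
  exact (DFunLike.congr_fun (h.trans (e _ I.range_eq_univ)) v).symm

/-- This is the flat statement `eventually_apply_eq_of_horizontal` read in the charts at `x` and at
`f x`. Vertical vectors in these charts are vertical on the manifold, so both horizontality
hypotheses carry over. -/
theorem FormField.eventually_agreeAt [FiniteDimensional ℝ V] [FiniteDimensional ℝ V']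
    (hs : ∀ x, Function.Surjective (mfderiv I I' f x)) {k : ℕ} {Ω : FormField I X k}
    (hΩ : Ω.IsSmooth) (h0 : Ω.IsHorizontal I' f) (h1 : Ω.d.IsHorizontal I' f) (x : X) :
    ∀ᶠ z in nhds x, f z = f x → Ω.AgreeAt I' f x z := by
  have : IsManifold I 1 X := .of_le (n := ∞) (by simp)
  have : IsManifold I' 1 X' := .of_le (n := ∞) (by simp)
  have hy := mem_extChartAt_target (I := I) x
  have hx := extChartAt_to_inv (I := I) x
  have hfy : f ((extChartAt I x).symm (extChartAt I x x)) ∈ (extChartAt I' (f x)).source := by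
    rw [hx]; exact mem_extChartAt_source _
  have hnear := (eventually_mem_extChartAt_target hy).and
    (eventually_mem_extChartAt_source hf.continuous hy hfy)
  -- the derivative of `f` in charts detects vertical vectors
  have hvert : ∀ z, z ∈ (extChartAt I x).target →
      f ((extChartAt I x).symm z) ∈ (extChartAt I' (f x)).source → ∀ v : V,
      fderiv ℝ (extChartAt I' (f x) ∘ f ∘ (extChartAt I x).symm) z v = 0 →
      mfderiv I I' f ((extChartAt I x).symm z)
        (mfderivWithin 𝓘(ℝ, V) I (extChartAt I x).symm (Set.range I) z v) = 0 := by
    intro z hz hfz v hv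
    have h := mfderiv_comp_mfderivWithin_extChartAt_symm
      ((hf _).mdifferentiableAt (by simp : (∞ : WithTop ℕ∞) ≠ 0)) hz hfz v
    rw [hv] at h
    exact h.trans (map_zero _)
  have key := eventually_apply_eq_of_horizontal
    (f := extChartAt I' (f x) ∘ f ∘ (extChartAt I x).symm) (x := extChartAt I x x)
    (Ω := Ω.inChart x) (contDiffAt_writtenInCharts hf hy hfy)
    (by
      intro u
      obtain ⟨v, hv⟩ := hs x u
      exact ⟨v, (fderiv_writtenInCharts_self hf x v).trans hv⟩)
    (hΩ.contDiffAt hy)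
    (by
      filter_upwards [hnear] with z hz w ⟨i, hi⟩
      exact h0 _ _ ⟨i, hvert z hz.1 hz.2 _ hi⟩)
    (by
      filter_upwards [hnear] with z hz w ⟨i, hi⟩
      rw [← FormField.inChart_d hΩ hz.1]
      exact h1 _ _ ⟨i, hvert z hz.1 hz.2 _ hi⟩)
  have hcont : Filter.Tendsto (extChartAt I x) (nhds x) (nhds (extChartAt I x x)) :=
    continuousAt_extChartAt x
  filter_upwards [hcont.eventually key, hcont.eventually hnear,
    (isOpen_extChartAt_source (I := I) x).mem_nhds (mem_extChartAt_source x)]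
    with z hz hzn hzs hfz w w' hww
  have hzz := (extChartAt I x).left_inv hzs
  have hrep := FormField.inChart_apply Ω x (extChartAt I x z)
  -- The chart at `x` is not the preferred chart at `z`, so a vector at `z` has to be carried into
  -- the chart at `x` and back.
  have hTT : ∀ v : V, mfderivWithin 𝓘(ℝ, V) I (extChartAt I x).symm (Set.range I)
      (extChartAt I x z) (mfderiv I 𝓘(ℝ, V) (extChartAt I x) z v) = v := fun v =>
    DFunLike.congr_fun (mfderivWithin_extChartAt_symm_comp_mfderiv_extChartAt' (I := I) hzs) v
  have hd := fun v => fderiv_writtenInCharts_apply hf hzn.1 hzn.2 v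
  rw [hzz] at hrep
  have hz' := hz (by simp only [Function.comp_apply, hzz, hx, hfz]) w
    (fun i => mfderiv I 𝓘(ℝ, V) (extChartAt I x) z (w' i)) (fun i => by
      refine (fderiv_writtenInCharts_self hf x (w i)).trans ((hww i).trans ?_)
      refine Eq.trans ?_ (hd _).symm
      have e : ∀ p, p = z → ∀ q, q = f x → ∀ a : V, a = w' i →
          (mfderiv I I' f z (w' i) : V') =
          mfderiv I' 𝓘(ℝ, V') (extChartAt I' (f x)) q (mfderiv I I' f p a) := by
        rintro p rfl q rfl a rfl
        rw [mfderiv_extChartAt_self]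
        rfl
      exact e _ hzz _ (by rw [hzz, hfz]) _ (hTT (w' i)))
  rw [FormField.inChart_self] at hz'
  refine hz'.trans ((hrep _).trans ?_)
  exact congrArg (Ω z : V [⋀^Fin k]→L[ℝ] ℝ) (funext fun i => hTT (w' i))

/-- Agreement is a symmetric and transitive relation on a fibre, and it holds between nearby points;
on a preconnected set it therefore holds between any two points. -/
theorem FormField.agreeAt_of_connected_fibers [FiniteDimensional ℝ V] [FiniteDimensional ℝ V']
    (hs : ∀ x, Function.Surjective (mfderiv I I' f x)) (hc : ∀ y, IsPreconnected (f ⁻¹' {y}))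
    {k : ℕ} {Ω : FormField I X k}
    (hΩ : Ω.IsSmooth) (h0 : Ω.IsHorizontal I' f) (h1 : Ω.d.IsHorizontal I' f) {x x' : X}
    (hxx : f x = f x') : Ω.AgreeAt I' f x x' := by
  refine (hc (f x')).induction₂ (Ω.AgreeAt I' f) ?_ ?_ ?_ hxx rfl
  · intro z hz
    filter_upwards [(FormField.eventually_agreeAt hf hs hΩ h0 h1 z).filter_mono nhdsWithin_le_nhds,
      self_mem_nhdsWithin] with u hu hu'
    exact hu ((hu' : f u = f x').trans (hz : f z = f x').symm)
  · intro a b c _ _ _ hab hbc w w' hww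
    -- Transitivity uses the submersion property: the tuple of images has to be lifted to tangent
    -- vectors at the intermediate point.
    choose u hu using fun i => hs b (mfderiv I I' f a (w i))
    exact (hab w u fun i => (hu i).symm).trans (hbc u w' fun i => (hu i).trans (hww i))
  · intro a b _ _ hab w w' hww
    exact (hab w' w fun i => (hww i).symm).symm

/-- Pullback along a surjective submersion is injective. -/
theorem FormField.pullback_injective (hsurj : Function.Surjective f)
    (hs : ∀ x, Function.Surjective (mfderiv I I' f x)) {k : ℕ} {α β : FormField I' X' k}
    (h : FormField.pullback (I := I) f α = FormField.pullback f β) : α = β := by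
  refine FormField.ext fun y w => ?_
  obtain ⟨x, rfl⟩ := hsurj y
  choose u hu using fun i => hs x (w i)
  have h1 := DFunLike.congr_fun (congrFun h x) u
  rw [FormField.pullback_apply, FormField.pullback_apply] at h1
  simpa only [hu] using h1

/-- Smoothness descends along surjective submersions. -/
theorem FormField.IsSmooth.of_pullback [FiniteDimensional ℝ V] [FiniteDimensional ℝ V']
    (hsurj : Function.Surjective f)
    (hs : ∀ x, Function.Surjective (mfderiv I I' f x)) {k : ℕ} {α : FormField I' X' k}
    (h : (FormField.pullback (I := I) f α).IsSmooth) : α.IsSmooth := by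
  have : IsManifold I 1 X := .of_le (n := ∞) (by simp)
  have : IsManifold I' 1 X' := .of_le (n := ∞) (by simp)
  intro y₀ y hy
  refine ContDiffAt.contDiffWithinAt ?_
  obtain ⟨x, hx⟩ := hsurj ((extChartAt I' y₀).symm y)
  have hxy := mem_extChartAt_target (I := I) x
  have hxx := extChartAt_to_inv (I := I) x
  have hfy : f ((extChartAt I x).symm (extChartAt I x x)) ∈ (extChartAt I' y₀).source := by
    rw [hxx, hx]; exact (extChartAt I' y₀).map_target hy
  set g := extChartAt I' y₀ ∘ f ∘ (extChartAt I x).symm with hg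
  have hgc : ContDiffAt ℝ ∞ g (extChartAt I x x) := contDiffAt_writtenInCharts hf hxy hfy
  have hgx : g (extChartAt I x x) = y := by
    rw [hg]; simp only [Function.comp_apply]
    rw [hxx, hx, (extChartAt I' y₀).right_inv hy]
  have hgs : Function.Surjective (fderiv ℝ g (extChartAt I x x)) := by
    intro u
    have hinv := isInvertible_mfderiv_extChartAt (I := I') hfy
    obtain ⟨e, he⟩ := hinv
    obtain ⟨v, hv⟩ := hs ((extChartAt I x).symm (extChartAt I x x)) (e.symm u)
    obtain ⟨v', hv'⟩ := (isInvertible_mfderivWithin_extChartAt_symm (I := I) hxy).bijective.2 v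
    refine ⟨v', ?_⟩
    refine (fderiv_writtenInCharts_apply hf hxy hfy v').trans ?_
    refine (congrArg (fun z => mfderiv I' 𝓘(ℝ, V') (extChartAt I' y₀)
      (f ((extChartAt I x).symm (extChartAt I x x))) (mfderiv I I' f
        ((extChartAt I x).symm (extChartAt I x x)) z)) hv').trans ?_
    refine (congrArg (mfderiv I' 𝓘(ℝ, V') (extChartAt I' y₀)
      (f ((extChartAt I x).symm (extChartAt I x x)))) hv).trans ?_
    exact (DFunLike.congr_fun he _).symm.trans (e.apply_symm_apply u)
  obtain ⟨K, Θ, -, hΘ, hΘx, -, -, hΘg, -, -⟩ := exists_submersion_coordinates hgc hgs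
  rw [hgx] at hΘ hΘg hΘx
  -- A smooth local section of `f` in coordinates. Near `y` the expression of α is the pullback by
  -- `s` of the expression of f^*α, which is smooth by hypothesis.
  set s : V' → V := fun z => Θ (z, 0) with hsdef
  have hι : ContDiffAt ℝ ∞ (fun z : V' => (z, (0 : K))) y := contDiffAt_id.prodMk contDiffAt_const
  have hsc : ContDiffAt ℝ ∞ s y := ContDiffAt.comp y hΘ hι
  have hsy : s y = extChartAt I x x := hΘx
  have hst : Filter.Tendsto s (nhds y) (nhds (extChartAt I x x)) := by
    rw [← hsy]; exact hsc.continuousAt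
  have hgs' : ∀ᶠ z in nhds y, g (s z) = z := hι.continuousAt.tendsto.eventually hΘg
  have hnear := (eventually_mem_extChartAt_target hxy).and
    (eventually_mem_extChartAt_source hf.continuous hxy hfy)
  have hgd : ∀ᶠ z in nhds (extChartAt I x x), DifferentiableAt ℝ g z := by
    filter_upwards [hnear] with z hz
    exact (contDiffAt_writtenInCharts hf hz.1 hz.2).differentiableAt (by simp)
  have hsd : ∀ᶠ z in nhds y, DifferentiableAt ℝ s z := by
    filter_upwards [(hsc.of_le (m := 1) ENat.LEInfty.out).eventually (by simp)] with z hz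
    exact hz.differentiableAt (by simp)
  have hcd : ContDiffAt ℝ ∞ (fun z => ((FormField.pullback (I := I) f α).inChart x
      (s z)).compContinuousLinearMap (fderiv ℝ s z)) y := by
    refine ContDiffAt.alternating_comp ?_ (hsc.fderiv_right (m := ∞) (by simp))
    refine ContDiffAt.comp (g := (FormField.pullback (I := I) f α).inChart x) (f := s) y ?_ hsc
    rw [hsy]
    exact h.contDiffAt hxy
  refine hcd.congr_of_eventuallyEq ?_
  filter_upwards [hst.eventually hnear, hgs'.eventually_nhds, hst.eventually hgd, hsd]
    with z hz hgz hgd hsd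
  have h1 := FormField.inChart_pullback α (x₀' := y₀)
    ((hf _).mdifferentiableAt (by simp : (∞ : WithTop ℕ∞) ≠ 0)) hz.1 hz.2
  rw [h1]
  have h2 : (fderiv ℝ g (s z)).comp (fderiv ℝ s z) = ContinuousLinearMap.id ℝ V' := by
    rw [← fderiv_comp z hgd hsd]
    have e : (g ∘ s) =ᶠ[nhds z] id := hgz
    rw [e.fderiv_eq, fderiv_id]
  have h3 : extChartAt I' y₀ (f ((extChartAt I x).symm (s z))) = z := hgz.self_of_nhds
  rw [h3]
  ext v
  simp only [ContinuousAlternatingMap.compContinuousLinearMap_apply]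
  congr 1
  funext i
  exact (DFunLike.congr_fun h2 (v i)).symm

/-- A form which is horizontal together with its exterior derivative for a surjective submersion
with connected fibres is a pullback. -/
theorem FormField.exists_eq_pullback [FiniteDimensional ℝ V] [FiniteDimensional ℝ V']
    (hsurj : Function.Surjective f)
    (hs : ∀ x, Function.Surjective (mfderiv I I' f x)) (hc : ∀ y, IsPreconnected (f ⁻¹' {y}))
    {k : ℕ} {Ω : FormField I X k}
    (hΩ : Ω.IsSmooth) (h0 : Ω.IsHorizontal I' f) (h1 : Ω.d.IsHorizontal I' f) :
    ∃ Ω' : FormField I' X' k, Ω'.IsSmooth ∧ Ω = FormField.pullback f Ω' := by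
  choose s hs' using hsurj
  have hR : ∀ x, ∃ R : V' →L[ℝ] V, ∀ v, (mfderiv I I' f x : V →L[ℝ] V') (R v) = v := by
    exact fun x => exists_rightInverse_clm _ (hs x)
  choose R hR using hR
  -- A point in each fibre and a right inverse of the differential are chosen with no regularity.
  -- Agreement along fibres makes the value independent of both choices, and smoothness is then
  -- inherited from the pullback.
  let Ω' : FormField I' X' k := fun y =>
    (Ω (s y) : V [⋀^Fin k]→L[ℝ] ℝ).compContinuousLinearMap (R (s y))
  have hp : Ω = FormField.pullback f Ω' := by
    refine FormField.ext fun x w => ?_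
    exact FormField.agreeAt_of_connected_fibers hf hs hc hΩ h0 h1 (hs' (f x)).symm w _
      fun i => (hR (s (f x)) (mfderiv I I' f x (w i))).symm
  exact ⟨Ω', FormField.IsSmooth.of_pullback hf (fun y => ⟨s y, hs' y⟩) hs (hp ▸ hΩ), hp⟩

end Descent

end BasicForms

/-! ### Tangent vectors of a vector bundle in the preferred coordinates -/

section BundleCoordinates

variable {B H M : Type*} [NormedAddCommGroup B] [NormedSpace ℝ B] [TopologicalSpace H]
  {I : ModelWithCorners ℝ B H} [I.Boundaryless] [TopologicalSpace M] [ChartedSpace H M]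
  {F : Type*} [NormedAddCommGroup F] [NormedSpace ℝ F]
  {E : M → Type*} [TopologicalSpace (TotalSpace F E)] [∀ x, TopologicalSpace (E x)]
  [∀ x, AddCommGroup (E x)] [∀ x, Module ℝ (E x)] [FiberBundle F E] [VectorBundle ℝ F E]

variable (F) in
/-- The fibre coordinate in the preferred trivialization at `x₀`. -/
def fiberCoord (x₀ : M) (p : TotalSpace F E) : F := (trivializationAt F E x₀ p).2

theorem fiberCoord_add {x₀ x : M} (hx : x ∈ (trivializationAt F E x₀).baseSet) (e e' : E x) :
    fiberCoord F x₀ ⟨x, e + e'⟩ = fiberCoord F x₀ ⟨x, e⟩ + fiberCoord F x₀ ⟨x, e'⟩ :=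
  ((trivializationAt F E x₀).linear ℝ hx).map_add e e'

theorem fiberCoord_smul {x₀ x : M} (hx : x ∈ (trivializationAt F E x₀).baseSet) (c : ℝ) (e : E x) :
    fiberCoord F x₀ ⟨x, c • e⟩ = c • fiberCoord F x₀ ⟨x, e⟩ :=
  ((trivializationAt F E x₀).linear ℝ hx).map_smul c e

theorem fiberCoord_zero {x₀ x : M} (hx : x ∈ (trivializationAt F E x₀).baseSet) :
    fiberCoord F x₀ ⟨x, (0 : E x)⟩ = 0 := by
  have h := fiberCoord_smul (F := F) hx 0 (0 : E x)
  rwa [zero_smul, zero_smul] at h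

theorem extChartAt_totalSpace_apply {p₀ p : TotalSpace F E}
    (hp : p.proj ∈ (trivializationAt F E p₀.proj).baseSet) :
    extChartAt (I.prod 𝓘(ℝ, F)) p₀ p =
      (extChartAt I p₀.proj p.proj, fiberCoord F p₀.proj p) := by
  rw [FiberBundle.extChartAt]
  exact Prod.ext (congrArg (extChartAt I p₀.proj)
    ((trivializationAt F E p₀.proj).coe_fst' hp)) rfl

theorem mem_extChartAt_totalSpace_target {p₀ : TotalSpace F E} {z : B × F} :
    z ∈ (extChartAt (I.prod 𝓘(ℝ, F)) p₀).target ↔ z.1 ∈ (extChartAt I p₀.proj).target ∧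
      (extChartAt I p₀.proj).symm z.1 ∈ (trivializationAt F E p₀.proj).baseSet := by
  rw [FiberBundle.extChartAt_target]
  simp

theorem mem_extChartAt_totalSpace_source {p₀ p : TotalSpace F E} :
    p ∈ (extChartAt (I.prod 𝓘(ℝ, F)) p₀).source ↔ p.proj ∈ (extChartAt I p₀.proj).source ∧
      p.proj ∈ (trivializationAt F E p₀.proj).baseSet := by
  rw [FiberBundle.extChartAt, PartialEquiv.trans_source, Set.mem_inter_iff]
  have h : p ∈ (trivializationAt F E p₀.proj).toPartialEquiv.source ↔
    p.proj ∈ (trivializationAt F E p₀.proj).baseSet := (trivializationAt F E p₀.proj).mem_source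
  rw [h, and_comm]
  refine and_congr_left fun hp => ?_
  have h1 : (trivializationAt F E p₀.proj p).1 = p.proj :=
    (trivializationAt F E p₀.proj).coe_fst' hp
  change ((trivializationAt F E p₀.proj p).1 ∈ _ ∧ True) ↔ _
  rw [h1, and_true]

/-- The preferred chart at a point of the bundle is built from the chart and the trivialization at
its base point alone. One coordinate system thus serves all points of a fibre, which is what permits
tangent vectors at different `e` in one fibre to be added componentwise. -/
theorem extChartAt_totalSpace_congr {p p' : TotalSpace F E} (h : p.proj = p'.proj) :
    extChartAt (I.prod 𝓘(ℝ, F)) p = extChartAt (I.prod 𝓘(ℝ, F)) p' := by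
  rw [FiberBundle.extChartAt, FiberBundle.extChartAt, h]

variable [IsManifold I ∞ M] [ContMDiffVectorBundle ∞ F E I]

instance : IsManifold (I.prod 𝓘(ℝ, F)) 1 (TotalSpace F E) := .of_le (n := ∞) (by simp)

/-- Composing with the preferred chart at the image point does not change the derivative, because
that chart has identity derivative there. -/
theorem mfderiv_extChartAt_comp_apply {V' H' X V'' H'' Y : Type*} [NormedAddCommGroup V']
    [NormedSpace ℝ V'] [TopologicalSpace H'] {J : ModelWithCorners ℝ V' H'} [TopologicalSpace X]
    [ChartedSpace H' X] [NormedAddCommGroup V'']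
    [NormedSpace ℝ V''] [TopologicalSpace H''] {J' : ModelWithCorners ℝ V'' H''} [J'.Boundaryless]
    [TopologicalSpace Y] [ChartedSpace H'' Y] [IsManifold J' 1 Y] {f : X → Y} {z : X}
    (hf : MDifferentiableAt J J' f z) (v : TangentSpace J z) :
    (mfderiv J 𝓘(ℝ, V'') (fun x => extChartAt J' (f z) (f x)) z v : V'') =
      (mfderiv J J' f z v : V'') := by
  have hc : MDifferentiableAt J' 𝓘(ℝ, V'') (extChartAt J' (f z)) (f z) :=
    mdifferentiableAt_extChartAt (mem_chart_source _ _)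
  have h1 := mfderiv_comp (I' := J') z hc hf
  rw [mfderiv_extChartAt_self] at h1
  exact DFunLike.congr_fun h1 v

theorem mfderiv_clm_comp_apply {V' H' X V₁ V₂ : Type*} [NormedAddCommGroup V']
    [NormedSpace ℝ V'] [TopologicalSpace H'] {J : ModelWithCorners ℝ V' H'} [TopologicalSpace X]
    [ChartedSpace H' X] [NormedAddCommGroup V₁] [NormedSpace ℝ V₁] [NormedAddCommGroup V₂]
    [NormedSpace ℝ V₂] (L : V₁ →L[ℝ] V₂) {f : X → V₁} {z : X}
    (hf : MDifferentiableAt J 𝓘(ℝ, V₁) f z) (v : TangentSpace J z) :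
    (mfderiv J 𝓘(ℝ, V₂) (fun x => L (f x)) z v : V₂) = L (mfderiv J 𝓘(ℝ, V₁) f z v : V₁) := by
  have h1 := mfderiv_comp (I' := 𝓘(ℝ, V₁)) z (L.mdifferentiableAt (x := f z)) hf
  rw [L.mfderiv_eq] at h1
  exact DFunLike.congr_fun h1 v

/-- The derivative of a map into the total space of a vector bundle. -/
theorem mfderiv_totalSpace_apply {V' H' X : Type*} [NormedAddCommGroup V'] [NormedSpace ℝ V']
    [TopologicalSpace H'] {J : ModelWithCorners ℝ V' H'} [TopologicalSpace X] [ChartedSpace H' X]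
    {f : X → TotalSpace F E} {z : X} (hf : MDifferentiableAt J (I.prod 𝓘(ℝ, F)) f z)
    (v : TangentSpace J z) :
    (mfderiv J (I.prod 𝓘(ℝ, F)) f z v : B × F) =
      ((mfderiv J I (fun x => (f x).proj) z v : B),
        (mfderiv J 𝓘(ℝ, F) (fun x => fiberCoord F (f z).proj (f x)) z v : F)) := by
  have : IsManifold I 1 M := .of_le (n := ∞) (by simp)
  have hpr : MDifferentiableAt J I (fun x => (f x).proj) z :=
    ((Bundle.contMDiff_proj (n := ∞) E).mdifferentiable (by simp) (f z)).comp z hf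
  have hc : MDifferentiableAt J 𝓘(ℝ, B × F)
      (fun x => extChartAt (I.prod 𝓘(ℝ, F)) (f z) (f x)) z :=
    (mdifferentiableAt_extChartAt (mem_chart_source _ _)).comp z hf
  have hev : ∀ᶠ x in nhds z, (f x).proj ∈ (trivializationAt F E (f z).proj).baseSet :=
    hpr.continuousAt.eventually ((trivializationAt F E (f z).proj).open_baseSet.mem_nhds
      (FiberBundle.mem_baseSet_trivializationAt' _))
  have h0 := mfderiv_extChartAt_comp_apply (J := J) (J' := I.prod 𝓘(ℝ, F)) (f := f) hf v
  refine h0.symm.trans (Prod.ext ?_ ?_)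
  · refine (mfderiv_clm_comp_apply (ContinuousLinearMap.fst ℝ B F) hc v).symm.trans ?_
    have h2 := mfderiv_extChartAt_comp_apply (J := J) (J' := I) (f := fun x => (f x).proj) hpr v
    refine Eq.trans ?_ h2
    have e : (fun x => ContinuousLinearMap.fst ℝ B F
        (extChartAt (I.prod 𝓘(ℝ, F)) (f z) (f x))) =ᶠ[nhds z]
        fun x => extChartAt I (f z).proj (f x).proj := by
      filter_upwards [hev] with x hx
      exact congrArg Prod.fst (extChartAt_totalSpace_apply (I := I) hx)
    exact DFunLike.congr_fun e.mfderiv_eq v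
  · refine (mfderiv_clm_comp_apply (ContinuousLinearMap.snd ℝ B F) hc v).symm.trans ?_
    have e : (fun x => ContinuousLinearMap.snd ℝ B F
        (extChartAt (I.prod 𝓘(ℝ, F)) (f z) (f x))) =ᶠ[nhds z]
        fun x => fiberCoord F (f z).proj (f x) := by
      filter_upwards [hev] with x hx
      exact congrArg Prod.snd (extChartAt_totalSpace_apply (I := I) hx)
    exact DFunLike.congr_fun e.mfderiv_eq v

/-- The formula for maps into the total space is applied to the identity map and its first component
is read off. -/
theorem mfderiv_totalSpace_proj_apply (p : TotalSpace F E) (W : B × F) :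
    (mfderiv (I.prod 𝓘(ℝ, F)) I (fun p : TotalSpace F E => p.proj) p W : B) = W.1 := by
  have h := mfderiv_totalSpace_apply (I := I) (f := (id : TotalSpace F E → TotalSpace F E))
    (z := p) mdifferentiableAt_id W
  rw [mfderiv_id] at h
  exact (congrArg Prod.fst h).symm

theorem mfderiv_fiberCoord_apply (p : TotalSpace F E) (W : B × F) :
    (mfderiv (I.prod 𝓘(ℝ, F)) 𝓘(ℝ, F) (fiberCoord F p.proj) p W : F) = W.2 := by
  have h := mfderiv_totalSpace_apply (I := I) (f := (id : TotalSpace F E → TotalSpace F E))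
    (z := p) mdifferentiableAt_id W
  rw [mfderiv_id] at h
  exact (congrArg Prod.snd h).symm

theorem contMDiffAt_fiberCoord (p : TotalSpace F E) :
    ContMDiffAt (I.prod 𝓘(ℝ, F)) 𝓘(ℝ, F) ∞ (fiberCoord F p.proj) p :=
  (Bundle.contMDiffAt_totalSpace.mp (contMDiffAt_id (n := ∞) (x := p))).2

/-- The derivative of fibrewise scalar multiplication. -/
theorem contMDiff_smul_totalSpace (c : ℝ) : ContMDiff (I.prod 𝓘(ℝ, F)) (I.prod 𝓘(ℝ, F)) ∞
    (fun p : TotalSpace F E => (⟨p.proj, c • p.2⟩ : TotalSpace F E)) := by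
  intro p
  refine Bundle.contMDiffAt_totalSpace.mpr ⟨Bundle.contMDiffAt_proj E, ?_⟩
  refine ContMDiffAt.congr_of_eventuallyEq (f := fun q => c • fiberCoord F p.proj q)
    ((c • ContinuousLinearMap.id ℝ F).contDiff.contMDiff.contMDiffAt.comp p
      (contMDiffAt_fiberCoord p)) ?_
  filter_upwards [(FiberBundle.continuous_proj F E).continuousAt.eventually
    ((trivializationAt F E p.proj).open_baseSet.mem_nhds
      (FiberBundle.mem_baseSet_trivializationAt' _))] with q hq
  exact fiberCoord_smul hq c q.2

theorem mfderiv_smul_totalSpace_apply (c : ℝ) (p : TotalSpace F E) (W : B × F) :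
    (mfderiv (I.prod 𝓘(ℝ, F)) (I.prod 𝓘(ℝ, F))
      (fun p : TotalSpace F E => (⟨p.proj, c • p.2⟩ : TotalSpace F E)) p W : B × F) =
      (W.1, c • W.2) := by
  refine (mfderiv_totalSpace_apply
    ((contMDiff_smul_totalSpace c p).mdifferentiableAt (by simp)) W).trans ?_
  refine Prod.ext (mfderiv_totalSpace_proj_apply p W) ?_
  have e : (fun x : TotalSpace F E => fiberCoord F p.proj (⟨x.proj, c • x.2⟩ : TotalSpace F E))
      =ᶠ[nhds p] fun x => (c • ContinuousLinearMap.id ℝ F) (fiberCoord F p.proj x) := by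
    filter_upwards [(FiberBundle.continuous_proj F E).continuousAt.eventually
      ((trivializationAt F E p.proj).open_baseSet.mem_nhds
      (FiberBundle.mem_baseSet_trivializationAt' _))] with q hq
    exact fiberCoord_smul hq c q.2
  refine (DFunLike.congr_fun e.mfderiv_eq W).trans ?_
  refine (mfderiv_clm_comp_apply _ ((contMDiffAt_fiberCoord p).mdifferentiableAt (by simp))
    W).trans ?_
  exact congrArg (c • ·) (mfderiv_fiberCoord_apply p W)

theorem contMDiff_zero_totalSpace : ContMDiff I (I.prod 𝓘(ℝ, F)) ∞
    (fun y : M => (⟨y, (0 : E y)⟩ : TotalSpace F E)) :=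
  Bundle.contMDiff_zeroSection ℝ E

theorem tangentZero_apply (x : M) (v : B) :
    (tangentZero I F E x v : B × F) = (v, 0) := by
  refine (mfderiv_totalSpace_apply
    ((contMDiff_zero_totalSpace (I := I) (F := F) (E := E) x).mdifferentiableAt (by simp))
    v).trans ?_
  refine Prod.ext (by exact DFunLike.congr_fun (mfderiv_id (I := I) (x := x)) v) ?_
  have e : (fun y : M => fiberCoord F x (⟨y, (0 : E y)⟩ : TotalSpace F E))
      =ᶠ[nhds x] fun _ => 0 := by
    filter_upwards [(trivializationAt F E x).open_baseSet.mem_nhds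
      (FiberBundle.mem_baseSet_trivializationAt' _)] with y hy
    exact fiberCoord_zero hy
  refine (DFunLike.congr_fun e.mfderiv_eq v).trans ?_
  rw [mfderiv_const]
  rfl

theorem contMDiff_smul_vector {x : M} (e : E x) : ContMDiff 𝓘(ℝ, ℝ) (I.prod 𝓘(ℝ, F)) ∞
    (fun t : ℝ => (⟨x, t • e⟩ : TotalSpace F E)) := by
  intro t
  refine Bundle.contMDiffAt_totalSpace.mpr ⟨contMDiffAt_const, ?_⟩
  refine ContMDiffAt.congr_of_eventuallyEq (f := fun t : ℝ => t • fiberCoord F x ⟨x, e⟩)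
    (contMDiffAt_id.smul contMDiffAt_const) (.of_forall fun s => ?_)
  exact fiberCoord_smul (FiberBundle.mem_baseSet_trivializationAt' _) s e

theorem vert_apply {x : M} (e : E x) :
    (vert I F e : B × F) = (0, fiberCoord F x ⟨x, e⟩) := by
  have hz : (0 : ℝ) • e = 0 := zero_smul _ _
  refine (mfderiv_totalSpace_apply
    ((contMDiff_smul_vector (I := I) (F := F) e (0 : ℝ)).mdifferentiableAt (by simp))
    (1 : ℝ)).trans ?_
  refine Prod.ext ?_ ?_
  · refine (DFunLike.congr_fun (mfderiv_const (I := 𝓘(ℝ, ℝ)) (I' := I) (c := x)) (1 : ℝ)).trans ?_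
    rfl
  have e : (fun t : ℝ => fiberCoord F x (⟨x, t • e⟩ : TotalSpace F E))
      = fun t => (ContinuousLinearMap.id ℝ ℝ).smulRight (fiberCoord F x ⟨x, e⟩) t := by
    funext t
    exact fiberCoord_smul (FiberBundle.mem_baseSet_trivializationAt' _) t e
  change mfderiv 𝓘(ℝ, ℝ) 𝓘(ℝ, F) (fun t : ℝ => fiberCoord F x (⟨x, t • _⟩ : TotalSpace F E)) 0
    (1 : ℝ) = _
  rw [e, ContinuousLinearMap.mfderiv_eq]
  exact one_smul _ _

end BundleCoordinates

/-! ### Linear forms in bundle coordinates -/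

section FormsAux

variable {V H X : Type*} [NormedAddCommGroup V] [NormedSpace ℝ V] [TopologicalSpace H]
  {I : ModelWithCorners ℝ V H} [TopologicalSpace X] [ChartedSpace H X] [I.Boundaryless]

theorem mfderiv_vector_apply {V' : Type*} [NormedAddCommGroup V'] [NormedSpace ℝ V'] {f : X → V'}
    {x : X} (hd : MDifferentiableAt I 𝓘(ℝ, V') f x) (v : V) :
    (mfderiv I 𝓘(ℝ, V') f x v : V') =
      fderiv ℝ (fun y => f ((extChartAt I x).symm y)) (extChartAt I x x) v := by
  have h : mfderiv I 𝓘(ℝ, V') f x = fderivWithin ℝ (writtenInExtChartAt I 𝓘(ℝ, V') x f)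
      (Set.range I) (extChartAt I x x) := if_pos hd
  have e : ∀ s : Set V, s = Set.univ → fderivWithin ℝ (writtenInExtChartAt I 𝓘(ℝ, V') x f) s
      (extChartAt I x x) = fderiv ℝ (writtenInExtChartAt I 𝓘(ℝ, V') x f) (extChartAt I x x) := by
    rintro s rfl; rw [fderivWithin_univ]
  exact DFunLike.congr_fun (h.trans (e _ I.range_eq_univ)) v

theorem FormField.isSmooth_of_contDiffAt [IsManifold I ∞ X] [FiniteDimensional ℝ V] {k : ℕ}
    {Ω : FormField I X k} (h : ∀ x, ContDiffAt ℝ ∞ (Ω.inChart x) (extChartAt I x x)) :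
    Ω.IsSmooth := by
  intro x₀ y hy
  have hfy := mem_extChartAt_source (I := I) ((extChartAt I x₀).symm y)
  have h1 := FormField.inChart_pullback_eventuallyEq (f := id) Ω contMDiff_id hy hfy
  rw [FormField.pullback_id] at h1
  have hc := contDiffAt_writtenInCharts (I := I) (I' := I) (f := id) contMDiff_id hy hfy
  refine (ContDiffAt.congr_of_eventuallyEq ?_ h1).contDiffWithinAt
  refine ContDiffAt.alternating_comp ?_ (hc.fderiv_right (m := ∞) (by simp))
  exact ContDiffAt.comp (g := Ω.inChart ((extChartAt I x₀).symm y)) y (h _) hc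

end FormsAux

section LinearForms

variable {B H M : Type*} [NormedAddCommGroup B] [NormedSpace ℝ B] [TopologicalSpace H]
  {I : ModelWithCorners ℝ B H} [I.Boundaryless] [TopologicalSpace M] [ChartedSpace H M]
  {F : Type*} [NormedAddCommGroup F] [NormedSpace ℝ F]
  {E : M → Type*} [TopologicalSpace (TotalSpace F E)] [∀ x, TopologicalSpace (E x)]
  [∀ x, AddCommGroup (E x)] [∀ x, Module ℝ (E x)] [FiberBundle F E] [VectorBundle ℝ F E]
  [IsManifold I ∞ M] [ContMDiffVectorBundle ∞ F E I]

variable (I F) in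
/-- The coordinate expression of a section at `x₀`. -/
def sectionInChart (e : ∀ x, E x) (x₀ : M) (y : B) : F :=
  fiberCoord F x₀ ⟨(extChartAt I x₀).symm y, e ((extChartAt I x₀).symm y)⟩

theorem sectionInChart_self (e : ∀ x, E x) (x : M) :
    sectionInChart I F e x (extChartAt I x x) = fiberCoord F x ⟨x, e x⟩ := by
  rw [sectionInChart, extChartAt_to_inv]

theorem contDiffAt_sectionInChart (e : Cₛ^∞⟮I; F, E⟯) (x : M) :
    ContDiffAt ℝ ∞ (sectionInChart I F e x) (extChartAt I x x) := by
  rw [← contMDiffAt_iff_contDiffAt]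
  have h := (Bundle.contMDiffAt_section (n := ∞) (IB := I) (s := e) x).mp (e.contMDiff x)
  refine ContMDiffAt.comp (g := fun x' => fiberCoord F x ⟨x', e x'⟩) (I' := I) (extChartAt I x x)
    ?_ (contMDiffAt_extChartAt_symm (mem_extChartAt_target (I := I) x))
  rw [extChartAt_to_inv]
  exact h

theorem mfderiv_section_apply (e : Cₛ^∞⟮I; F, E⟯) (x : M) (v : B) :
    (mfderiv I (I.prod 𝓘(ℝ, F)) (fun y : M => (⟨y, e y⟩ : TotalSpace F E)) x v : B × F) =
      (v, fderiv ℝ (sectionInChart I F e x) (extChartAt I x x) v) := by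
  have h := (Bundle.contMDiffAt_section (n := ∞) (IB := I) (s := e) x).mp (e.contMDiff x)
  refine (mfderiv_totalSpace_apply ((e.contMDiff x).mdifferentiableAt (by simp)) v).trans ?_
  refine Prod.ext (by exact DFunLike.congr_fun (mfderiv_id (I := I) (x := x)) v) ?_
  exact mfderiv_vector_apply (h.mdifferentiableAt (by simp)) v

theorem eventually_mem_baseSet (x : M) : ∀ᶠ y in nhds (extChartAt I x x),
    y ∈ (extChartAt I x).target ∧
      (extChartAt I x).symm y ∈ (trivializationAt F E x).baseSet := by
  have hy := mem_extChartAt_target (I := I) x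
  refine (eventually_mem_extChartAt_target hy).and ?_
  refine (continuousAt_extChartAt_symm'' hy).eventually
    ((trivializationAt F E x).open_baseSet.mem_nhds ?_)
  rw [extChartAt_to_inv]
  exact FiberBundle.mem_baseSet_trivializationAt' _

theorem extChartAt_totalSpace_self (x : M) (e : E x) :
    extChartAt (I.prod 𝓘(ℝ, F)) (⟨x, 0⟩ : TotalSpace F E) ⟨x, e⟩ =
      (extChartAt I x x, fiberCoord F x ⟨x, e⟩) :=
  extChartAt_totalSpace_apply (p₀ := (⟨x, 0⟩ : TotalSpace F E)) (p := ⟨x, e⟩)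
    (FiberBundle.mem_baseSet_trivializationAt' _)

/-- The chart at the zero vector is also the preferred chart at `e`, so the expression in it has the
actual value of the form along the whole fibre. -/
theorem FormField.inChart_totalSpace_self {k : ℕ}
    (Ω : FormField (I.prod 𝓘(ℝ, F)) (TotalSpace F E) k) (x : M) (e : E x) :
    Ω.inChart ⟨x, 0⟩ (extChartAt I x x, fiberCoord F x ⟨x, e⟩) = Ω ⟨x, e⟩ := by
  rw [← extChartAt_totalSpace_self x e]
  have h : ∀ φ : PartialEquiv (TotalSpace F E) (B × F),
      φ = extChartAt (I.prod 𝓘(ℝ, F)) (⟨x, e⟩ : TotalSpace F E) →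
      ((Ω (φ.symm (φ ⟨x, e⟩))).compContinuousLinearMap (mfderivWithin 𝓘(ℝ, B × F)
        (I.prod 𝓘(ℝ, F)) φ.symm (Set.range (I.prod 𝓘(ℝ, F))) (φ ⟨x, e⟩)) :
        (B × F) [⋀^Fin k]→L[ℝ] ℝ) = Ω ⟨x, e⟩ := by
    rintro _ rfl
    exact FormField.inChart_self Ω ⟨x, e⟩
  exact h _ (extChartAt_totalSpace_congr rfl)

theorem FormField.inChart_totalSpace_zero {k : ℕ}
    (Ω : FormField (I.prod 𝓘(ℝ, F)) (TotalSpace F E) k) (x : M) :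
    Ω.inChart ⟨x, 0⟩ (extChartAt I x x, 0) = Ω ⟨x, 0⟩ := by
  have h := Ω.inChart_totalSpace_self x 0
  rwa [fiberCoord_zero (FiberBundle.mem_baseSet_trivializationAt' _)] at h

theorem mfderivWithin_extChartAt_totalSpace_symm {x : M} {y : B}
    (hy : y ∈ (extChartAt I x).target)
    (hb : (extChartAt I x).symm y ∈ (trivializationAt F E x).baseSet)
    (W V : B × F)
    (hW : (mfderiv (I.prod 𝓘(ℝ, F)) 𝓘(ℝ, B × F)
      (extChartAt (I.prod 𝓘(ℝ, F)) (⟨x, 0⟩ : TotalSpace F E))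
      ⟨(extChartAt I x).symm y, 0⟩ V : B × F) = W) :
    (mfderivWithin 𝓘(ℝ, B × F) (I.prod 𝓘(ℝ, F))
      (extChartAt (I.prod 𝓘(ℝ, F)) (⟨x, 0⟩ : TotalSpace F E)).symm (Set.range (I.prod 𝓘(ℝ, F)))
      (y, 0) W : B × F) = V := by
  have hs : (⟨(extChartAt I x).symm y, 0⟩ : TotalSpace F E) ∈
      (extChartAt (I.prod 𝓘(ℝ, F)) (⟨x, 0⟩ : TotalSpace F E)).source :=
    mem_extChartAt_totalSpace_source.mpr ⟨(extChartAt I x).map_target hy, hb⟩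
  have h := DFunLike.congr_fun (mfderivWithin_extChartAt_symm_comp_mfderiv_extChartAt'
    (I := I.prod 𝓘(ℝ, F)) hs) V
  have e : extChartAt (I.prod 𝓘(ℝ, F)) (⟨x, 0⟩ : TotalSpace F E)
      ⟨(extChartAt I x).symm y, 0⟩ = (y, 0) := by
    refine (extChartAt_totalSpace_apply (p₀ := (⟨x, 0⟩ : TotalSpace F E))
      (p := ⟨(extChartAt I x).symm y, 0⟩) hb).trans (Prod.ext ((extChartAt I x).right_inv hy) ?_)
    exact fiberCoord_zero hb
  rw [e] at h
  rw [← hW]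
  exact h

theorem mfderiv_extChartAt_tangentZero {x : M} {y : B}
    (hy : y ∈ (extChartAt I x).target)
    (hb : (extChartAt I x).symm y ∈ (trivializationAt F E x).baseSet) (b : B) :
    (mfderiv (I.prod 𝓘(ℝ, F)) 𝓘(ℝ, B × F)
      (extChartAt (I.prod 𝓘(ℝ, F)) (⟨x, 0⟩ : TotalSpace F E))
      ⟨(extChartAt I x).symm y, 0⟩ (tangentZero I F E ((extChartAt I x).symm y)
        (mfderivWithin 𝓘(ℝ, B) I (extChartAt I x).symm (Set.range I) y b)) : B × F) = (b, 0) := by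
  have : IsManifold I 1 M := .of_le (n := ∞) (by simp)
  have hs : (⟨(extChartAt I x).symm y, 0⟩ : TotalSpace F E) ∈
      (extChartAt (I.prod 𝓘(ℝ, F)) (⟨x, 0⟩ : TotalSpace F E)).source :=
    mem_extChartAt_totalSpace_source.mpr ⟨(extChartAt I x).map_target hy, hb⟩
  have h1 := fderiv_writtenInCharts_apply (contMDiff_zero_totalSpace (I := I) (F := F) (E := E))
    hy hs b
  refine h1.symm.trans ?_
  have e : (extChartAt (I.prod 𝓘(ℝ, F)) (⟨x, 0⟩ : TotalSpace F E) ∘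
      (fun y : M => (⟨y, (0 : E y)⟩ : TotalSpace F E)) ∘ (extChartAt I x).symm) =ᶠ[nhds y]
      fun z => ContinuousLinearMap.inl ℝ B F z := by
    filter_upwards [eventually_mem_extChartAt_target hy, (continuousAt_extChartAt_symm''
      hy).eventually ((trivializationAt F E x).open_baseSet.mem_nhds hb)] with z hz hzb
    refine (extChartAt_totalSpace_apply (p₀ := (⟨x, 0⟩ : TotalSpace F E))
      (p := ⟨(extChartAt I x).symm z, 0⟩) hzb).trans (Prod.ext ((extChartAt I x).right_inv hz) ?_)
    exact fiberCoord_zero hzb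
  rw [e.fderiv_eq, ContinuousLinearMap.fderiv]
  rfl

theorem mfderiv_extChartAt_vert {x : M} {y : B}
    (hy : y ∈ (extChartAt I x).target)
    (hb : (extChartAt I x).symm y ∈ (trivializationAt F E x).baseSet)
    (e : E ((extChartAt I x).symm y)) :
    (mfderiv (I.prod 𝓘(ℝ, F)) 𝓘(ℝ, B × F)
      (extChartAt (I.prod 𝓘(ℝ, F)) (⟨x, 0⟩ : TotalSpace F E))
      ⟨(extChartAt I x).symm y, 0⟩ (vert I F e) : B × F) = (0, fiberCoord F x ⟨_, e⟩) := by
  have hs : (⟨(extChartAt I x).symm y, 0⟩ : TotalSpace F E) ∈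
      (extChartAt (I.prod 𝓘(ℝ, F)) (⟨x, 0⟩ : TotalSpace F E)).source :=
    mem_extChartAt_totalSpace_source.mpr ⟨(extChartAt I x).map_target hy, hb⟩
  have h0 : (⟨(extChartAt I x).symm y, (0 : ℝ) • e⟩ : TotalSpace F E) =
      ⟨(extChartAt I x).symm y, 0⟩ := by rw [zero_smul]
  have hc : MDifferentiableAt (I.prod 𝓘(ℝ, F)) 𝓘(ℝ, B × F)
      (extChartAt (I.prod 𝓘(ℝ, F)) (⟨x, 0⟩ : TotalSpace F E))
      (⟨(extChartAt I x).symm y, (0 : ℝ) • e⟩ : TotalSpace F E) := by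
    rw [h0]
    exact mdifferentiableAt_extChartAt (by rwa [extChartAt_source] at hs)
  have h1 := mfderiv_comp (I := 𝓘(ℝ, ℝ)) (I' := I.prod 𝓘(ℝ, F)) (0 : ℝ) hc
    ((contMDiff_smul_vector (I := I) (F := F) e (0 : ℝ)).mdifferentiableAt (by simp))
  have h2 := DFunLike.congr_fun h1 (1 : ℝ)
  have e1 : (extChartAt (I.prod 𝓘(ℝ, F)) (⟨x, 0⟩ : TotalSpace F E) ∘
      (fun t : ℝ => (⟨_, t • e⟩ : TotalSpace F E))) = fun t =>
      (y, (0 : F)) + (ContinuousLinearMap.id ℝ ℝ).smulRight ((0 : B), fiberCoord F x ⟨_, e⟩) t := by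
    funext t
    refine (extChartAt_totalSpace_apply (p₀ := (⟨x, 0⟩ : TotalSpace F E))
      (p := ⟨(extChartAt I x).symm y, t • e⟩) hb).trans (Prod.ext ?_ ?_)
    · simpa using (extChartAt I x).right_inv hy
    · simpa using fiberCoord_smul hb t e
  have e2 : ∀ p, p = (⟨(extChartAt I x).symm y, 0⟩ : TotalSpace F E) → ∀ v : B × F,
      (mfderiv (I.prod 𝓘(ℝ, F)) 𝓘(ℝ, B × F)
        (extChartAt (I.prod 𝓘(ℝ, F)) (⟨x, 0⟩ : TotalSpace F E)) p v : B × F) =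
      mfderiv (I.prod 𝓘(ℝ, F)) 𝓘(ℝ, B × F)
        (extChartAt (I.prod 𝓘(ℝ, F)) (⟨x, 0⟩ : TotalSpace F E))
        ⟨(extChartAt I x).symm y, 0⟩ v := by rintro _ rfl v; rfl
  refine (e2 _ h0 _).symm.trans (h2.symm.trans ?_)
  rw [e1, mfderiv_eq_fderiv]
  change fderiv ℝ (fun t : ℝ => (y, (0 : F)) +
    (ContinuousLinearMap.id ℝ ℝ).smulRight ((0 : B), fiberCoord F x ⟨_, e⟩) t) 0 (1 : ℝ) = _
  rw [fderiv_const_add, ContinuousLinearMap.fderiv]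
  exact one_smul ℝ ((0 : B), fiberCoord F x ⟨_, e⟩)

/-- The chart is fixed at `x` while the base point moves with `y`. The differential of the chart of
the total space sends the vertical vector of `e` to (0, its fibre coordinate) and T0 of a base
vector to (b, 0), and the inverse chart undoes this. -/
theorem inChart_coreContraction {k : ℕ}
    (Ω : FormField (I.prod 𝓘(ℝ, F)) (TotalSpace F E) (k + 1)) (e : ∀ x, E x) {x : M} {y : B}
    (hy : y ∈ (extChartAt I x).target)
    (hb : (extChartAt I x).symm y ∈ (trivializationAt F E x).baseSet) (b : Fin k → B) :
    FormField.inChart (I := I) (fun x' => coreContraction Ω x' (e x')) x y b =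
      Ω.inChart ⟨x, 0⟩ (y, 0)
        (Matrix.vecCons ((0 : B), sectionInChart I F e x y) (fun i => (b i, (0 : F)))) := by
  have hs : (⟨(extChartAt I x).symm y, 0⟩ : TotalSpace F E) ∈
      (extChartAt (I.prod 𝓘(ℝ, F)) (⟨x, 0⟩ : TotalSpace F E)).source :=
    mem_extChartAt_totalSpace_source.mpr ⟨(extChartAt I x).map_target hy, hb⟩
  have e1 : extChartAt (I.prod 𝓘(ℝ, F)) (⟨x, 0⟩ : TotalSpace F E)
      ⟨(extChartAt I x).symm y, 0⟩ = (y, 0) := by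
    refine (extChartAt_totalSpace_apply (p₀ := (⟨x, 0⟩ : TotalSpace F E))
      (p := ⟨(extChartAt I x).symm y, 0⟩) hb).trans (Prod.ext ((extChartAt I x).right_inv hy) ?_)
    exact fiberCoord_zero hb
  have h : ∀ p, p = (⟨(extChartAt I x).symm y, 0⟩ : TotalSpace F E) →
      ∀ a a' : Fin (k + 1) → B × F, (∀ i, a i = a' i) →
      (Ω ⟨(extChartAt I x).symm y, 0⟩ : (B × F) [⋀^Fin (k + 1)]→L[ℝ] ℝ) a =
        (Ω p : (B × F) [⋀^Fin (k + 1)]→L[ℝ] ℝ) a' := by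
    rintro _ rfl a a' haa
    rw [funext haa]
  refine h _ ?_ _ _ fun i => ?_
  · rw [← e1]; exact (extChartAt _ _).left_inv hs
  · refine Fin.cases ?_ (fun j => ?_) i
    · exact (mfderivWithin_extChartAt_totalSpace_symm hy hb _ _
        (mfderiv_extChartAt_vert hy hb _)).symm
    · exact (mfderivWithin_extChartAt_totalSpace_symm hy hb _ _
        (mfderiv_extChartAt_tangentZero hy hb _)).symm

variable [FiniteDimensional ℝ B] [FiniteDimensional ℝ F]

/-- The coordinate expression of the contraction of a form on `E` along the zero section. -/
theorem inChart_coreContraction_eventuallyEq {k : ℕ}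
    (Ω : FormField (I.prod 𝓘(ℝ, F)) (TotalSpace F E) (k + 1)) (e : ∀ x, E x) (x : M)
    (b : Fin k → B) :
    (fun y => FormField.inChart (I := I) (fun x' => coreContraction Ω x' (e x')) x y b)
      =ᶠ[nhds (extChartAt I x x)] fun y => Ω.inChart ⟨x, 0⟩ (y, 0)
        (Matrix.vecCons ((0 : B), sectionInChart I F e x y) (fun i => (b i, (0 : F)))) := by
  filter_upwards [eventually_mem_baseSet (I := I) (F := F) (E := E) x] with y hy
  exact inChart_coreContraction Ω e hy.1 hy.2 b

theorem FormField.IsSmooth.contDiffAt_inChart_zero {k : ℕ}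
    {Ω : FormField (I.prod 𝓘(ℝ, F)) (TotalSpace F E) k} (hΩ : Ω.IsSmooth) (x : M) (u : F) :
    ContDiffAt ℝ ∞ (Ω.inChart ⟨x, 0⟩) (extChartAt I x x, u) := by
  refine hΩ.contDiffAt ?_
  rw [mem_extChartAt_totalSpace_target]
  refine ⟨mem_extChartAt_target x, ?_⟩
  change (extChartAt I x).symm (extChartAt I x x) ∈ _
  rw [extChartAt_to_inv]
  exact FiberBundle.mem_baseSet_trivializationAt' _

theorem FormField.IsSmooth.coreContraction {k : ℕ}
    {Ω : FormField (I.prod 𝓘(ℝ, F)) (TotalSpace F E) (k + 1)} (hΩ : Ω.IsSmooth)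
    (e : Cₛ^∞⟮I; F, E⟯) :
    FormField.IsSmooth (I := I) (fun x => coreContraction Ω x (e x)) := by
  refine FormField.isSmooth_of_contDiffAt fun x => contDiffAt_alternating_iff.mpr fun b => ?_
  refine ContDiffAt.congr_of_eventuallyEq ?_ (inChart_coreContraction_eventuallyEq Ω e x b)
  have h1 : ContDiffAt ℝ ∞ (fun y : B => Ω.inChart ⟨x, 0⟩ (y, (0 : F))) (extChartAt I x x) :=
    ContDiffAt.comp (extChartAt I x x) (hΩ.contDiffAt_inChart_zero x 0)
      (contDiffAt_id.prodMk contDiffAt_const)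
  refine h1.alternating_apply (v := fun i y => Matrix.vecCons
    ((0 : B), sectionInChart I F e x y) (fun i => (b i, (0 : F))) i) fun i => ?_
  refine Fin.cases ?_ (fun j => ?_) i
  · exact contDiffAt_const.prodMk (contDiffAt_sectionInChart e x)
  · exact contDiffAt_const

/-- A linear form is determined by its first jet along the zero section. -/
theorem IsLinearForm.apply_eq {k : ℕ} {Ω : FormField (I.prod 𝓘(ℝ, F)) (TotalSpace F E) k}
    (hΩ : Ω.IsSmooth) (hl : IsLinearForm Ω) (x : M) (e : E x) (W : Fin k → B × F) :
    (Ω ⟨x, e⟩ : (B × F) [⋀^Fin k]→L[ℝ] ℝ) W =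
      fderiv ℝ (Ω.inChart ⟨x, 0⟩) (extChartAt I x x, 0) (0, fiberCoord F x ⟨x, e⟩)
        (fun i => ((W i).1, 0)) +
      ∑ i, (Ω ⟨x, 0⟩ : (B × F) [⋀^Fin k]→L[ℝ] ℝ)
        (Function.update (fun j => ((W j).1, 0)) i (0, (W i).2)) := by
  set u := fiberCoord F x ⟨x, e⟩ with hu
  set α : ℝ → (B × F) [⋀^Fin k]→L[ℝ] ℝ := fun c => Ω.inChart ⟨x, 0⟩ (extChartAt I x x, c • u)
    with hα
  have hv : ∀ c : ℝ, HasFDerivAt (fun (c : ℝ) (i : Fin k) => ((W i).1, c • (W i).2))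
      (ContinuousLinearMap.pi fun i => (ContinuousLinearMap.id ℝ ℝ).smulRight
        ((0 : B), (W i).2)) c := by
    intro c
    refine hasFDerivAt_pi.mpr fun i => ?_
    have h1 := ((ContinuousLinearMap.id ℝ ℝ).smulRight ((0 : B), (W i).2)).hasFDerivAt
      (x := c) |>.const_add ((W i).1, (0 : F))
    refine h1.congr_of_eventuallyEq (.of_forall fun t => ?_)
    exact Prod.ext (by simp) (by simp)
  have hg : HasFDerivAt (fun c : ℝ => (extChartAt I x x, c • u))
      ((ContinuousLinearMap.id ℝ ℝ).smulRight ((0 : B), u)) 0 := by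
    have h1 := ((ContinuousLinearMap.id ℝ ℝ).smulRight ((0 : B), u)).hasFDerivAt
      (x := (0 : ℝ)) |>.const_add (extChartAt I x x, (0 : F))
    refine h1.congr_of_eventuallyEq (.of_forall fun t => ?_)
    exact Prod.ext (by simp) (by simp)
  have hΩd : HasFDerivAt (Ω.inChart ⟨x, 0⟩) (fderiv ℝ (Ω.inChart ⟨x, 0⟩) (extChartAt I x x, 0))
      (extChartAt I x x, (0 : ℝ) • u) := by
    rw [zero_smul]
    exact ((hΩ.contDiffAt_inChart_zero x 0).differentiableAt (by simp)).hasFDerivAt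
  have hαd : HasFDerivAt α ((fderiv ℝ (Ω.inChart ⟨x, 0⟩) (extChartAt I x x, 0)).comp
      ((ContinuousLinearMap.id ℝ ℝ).smulRight ((0 : B), u))) 0 :=
    HasFDerivAt.comp (g := Ω.inChart ⟨x, 0⟩) (f := fun c : ℝ => (extChartAt I x x, c • u))
      (0 : ℝ) hΩd hg
  -- Linearity reads Ω_{ce}(v, c u) = c Ω_e(v, u), with v the base parts and u the fibre parts of
  -- `W`. Differentiating at c = 0 turns the right side into Ω_e(W), and the left side into the
  -- vertical derivative of Ω at zero plus the terms in which one fibre part is differentiated.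
  have key := fderiv_alternating_apply (u := (1 : ℝ)) hαd.differentiableAt (hv 0).differentiableAt
  have hlin : ∀ c : ℝ, α c (fun i => ((W i).1, c • (W i).2)) =
      c * (Ω ⟨x, e⟩ : (B × F) [⋀^Fin k]→L[ℝ] ℝ) W := by
    intro c
    have h1 := DFunLike.congr_fun (congrFun (hl c) ⟨x, e⟩) W
    have h2 : α c = Ω ⟨x, c • e⟩ := by
      rw [← Ω.inChart_totalSpace_self, fiberCoord_smul (FiberBundle.mem_baseSet_trivializationAt' _)]
    rw [h2]
    refine Eq.trans ?_ h1
    exact congrArg (Ω ⟨x, c • e⟩ : (B × F) [⋀^Fin k]→L[ℝ] ℝ)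
      (funext fun i => (mfderiv_smul_totalSpace_apply c ⟨x, e⟩ (W i)).symm)
  rw [funext hlin, hαd.fderiv, (hv 0).fderiv] at key
  have hm : fderiv ℝ (fun c : ℝ => c * (Ω ⟨x, e⟩ : (B × F) [⋀^Fin k]→L[ℝ] ℝ) W) 0 1 =
      (Ω ⟨x, e⟩ : (B × F) [⋀^Fin k]→L[ℝ] ℝ) W := by
    rw [fderiv_mul_const (differentiableAt_id)]; simp
  rw [hm] at key
  rw [key]
  have h0 : α 0 = Ω ⟨x, 0⟩ := by
    rw [hα]; simp only [zero_smul]; exact Ω.inChart_totalSpace_zero x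
  simp [h0]
  rfl

end LinearForms

section LinearForms

variable {B H M : Type*} [NormedAddCommGroup B] [NormedSpace ℝ B] [TopologicalSpace H]
  {I : ModelWithCorners ℝ B H} [I.Boundaryless] [TopologicalSpace M] [ChartedSpace H M]
  {F : Type*} [NormedAddCommGroup F] [NormedSpace ℝ F]
  {E : M → Type*} [TopologicalSpace (TotalSpace F E)] [∀ x, TopologicalSpace (E x)]
  [∀ x, AddCommGroup (E x)] [∀ x, Module ℝ (E x)] [FiberBundle F E] [VectorBundle ℝ F E]
  [IsManifold I ∞ M] [ContMDiffVectorBundle ∞ F E I]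
variable [FiniteDimensional ℝ B] [FiniteDimensional ℝ F]

theorem ContinuousAlternatingMap.map_update_eq_cons {V : Type*} [NormedAddCommGroup V]
    [NormedSpace ℝ V] {k : ℕ} (α : V [⋀^Fin (k + 1)]→L[ℝ] ℝ) (w : Fin (k + 1) → V)
    (i : Fin (k + 1)) (a : V) :
    α (Function.update w i a) = (-1 : ℝ) ^ (i : ℕ) * α (Matrix.vecCons a (i.removeNth w)) := by
  have h := α.map_insertNth i a (i.removeNth w)
  rw [Fin.insertNth_removeNth] at h
  simpa [zsmul_eq_mul] using h

/-- Isolates the derivative along the first argument, which for `etaComp` is the vertical one; the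
remaining terms keep that argument in front and acquire the opposite sign. -/
theorem extDeriv_apply_cons {V : Type*} [NormedAddCommGroup V] [NormedSpace ℝ V] {k : ℕ}
    {α : V → V [⋀^Fin (k + 1)]→L[ℝ] ℝ} {x : V} (hα : DifferentiableAt ℝ α x) (a : V)
    (w : Fin (k + 1) → V) :
    extDeriv α x (Matrix.vecCons a w) = fderiv ℝ α x a w -
      ∑ i : Fin (k + 1), (-1 : ℝ) ^ (i : ℕ) *
        fderiv ℝ α x (w i) (Matrix.vecCons a (i.removeNth w)) := by
  have hf : ∀ (w : Fin (k + 1) → V) (a : V), fderiv ℝ (fun y => α y w) x a =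
      fderiv ℝ α x a w := by
    intro w a
    refine (fderiv_alternating_apply (v := fun _ => w) hα (differentiableAt_const _)).trans ?_
    rw [Finset.sum_eq_zero, add_zero]
    intro i _
    exact ContinuousAlternatingMap.map_coord_zero _ i (by simp)
  rw [extDeriv_apply hα, Fin.sum_univ_succ, sub_eq_add_neg, ← Finset.sum_neg_distrib]
  simp only [hf]
  congr 1
  · simp only [Fin.val_zero, pow_zero, one_smul, Matrix.cons_val_zero]
    rfl
  · refine Finset.sum_congr rfl fun i _ => ?_
    have e1 : i.succ.removeNth (Matrix.vecCons a w) = Matrix.vecCons a (i.removeNth w) := by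
      funext j
      refine Fin.cases ?_ (fun l => ?_) j
      · simp [Fin.removeNth]
      · simp [Fin.removeNth]
    rw [e1]
    simp [pow_succ, zsmul_eq_mul]

/-- The contraction of a form along the zero section. -/
theorem coreContraction_apply {k : ℕ}
    (Ω : FormField (I.prod 𝓘(ℝ, F)) (TotalSpace F E) (k + 1)) (x : M) (e : E x) (b : Fin k → B) :
    (coreContraction Ω x e : B [⋀^Fin k]→L[ℝ] ℝ) b =
      (Ω ⟨x, 0⟩ : (B × F) [⋀^Fin (k + 1)]→L[ℝ] ℝ)
        (Matrix.vecCons ((0 : B), fiberCoord F x ⟨x, e⟩) (fun i => (b i, (0 : F)))) := by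
  refine congrArg (Ω ⟨x, 0⟩ : (B × F) [⋀^Fin (k + 1)]→L[ℝ] ℝ) (funext fun i => ?_)
  refine Fin.cases ?_ (fun j => ?_) i
  · exact vert_apply e
  · exact tangentZero_apply x (b j)

/-- Product rule along the zero section: either the coefficients of Ω are differentiated in a
horizontal direction, or the coordinate of the section is. -/
theorem fderiv_inChart_coreContraction {k : ℕ}
    {Ω : FormField (I.prod 𝓘(ℝ, F)) (TotalSpace F E) (k + 1)} (hΩ : Ω.IsSmooth)
    (e : Cₛ^∞⟮I; F, E⟯) (x : M) (b : Fin k → B) (v : B) :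
    fderiv ℝ (fun y => FormField.inChart (I := I) (fun x' => coreContraction Ω x' (e x')) x y b)
        (extChartAt I x x) v =
      fderiv ℝ (Ω.inChart ⟨x, 0⟩) (extChartAt I x x, 0) (v, 0)
        (Matrix.vecCons ((0 : B), fiberCoord F x ⟨x, e x⟩) (fun i => (b i, (0 : F)))) +
      (Ω ⟨x, 0⟩ : (B × F) [⋀^Fin (k + 1)]→L[ℝ] ℝ)
        (Matrix.vecCons ((0 : B), fderiv ℝ (sectionInChart I F e x) (extChartAt I x x) v)
          (fun i => (b i, (0 : F)))) := by
  rw [(inChart_coreContraction_eventuallyEq Ω e x b).fderiv_eq]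
  have h1 : HasFDerivAt (fun y : B => Ω.inChart ⟨x, 0⟩ (y, (0 : F)))
      ((fderiv ℝ (Ω.inChart ⟨x, 0⟩) (extChartAt I x x, 0)).comp (ContinuousLinearMap.inl ℝ B F))
      (extChartAt I x x) :=
    HasFDerivAt.comp (g := Ω.inChart ⟨x, 0⟩) (f := fun y : B => (y, (0 : F))) (extChartAt I x x)
      ((hΩ.contDiffAt_inChart_zero x 0).differentiableAt (by simp)).hasFDerivAt
      (hasFDerivAt_prodMk_left (extChartAt I x x) (0 : F))
  have he := ((contDiffAt_sectionInChart e x).differentiableAt (by simp)).hasFDerivAt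
  have h2 : HasFDerivAt (fun (y : B) (i : Fin (k + 1)) => (Matrix.vecCons
      ((0 : B), sectionInChart I F e x y) (fun i => (b i, (0 : F))) i : B × F))
      (ContinuousLinearMap.pi (Matrix.vecCons ((ContinuousLinearMap.inr ℝ B F).comp
        (fderiv ℝ (sectionInChart I F e x) (extChartAt I x x))) 0)) (extChartAt I x x) := by
    refine hasFDerivAt_pi.mpr fun i => ?_
    refine Fin.cases ?_ (fun j => ?_) i
    · exact (ContinuousLinearMap.inr ℝ B F).hasFDerivAt.comp _ he
    · exact hasFDerivAt_const _ _
  refine (fderiv_alternating_apply h1.differentiableAt h2.differentiableAt).trans ?_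
  rw [h1.fderiv, h2.fderiv, sectionInChart_self, Ω.inChart_totalSpace_zero]
  congr 1
  rw [Fin.sum_univ_succ, Finset.sum_eq_zero, add_zero]
  · congr 1
    funext i
    refine Fin.cases ?_ (fun j => ?_) i
    · simp
    · simp; rfl
  · intro i _
    exact ContinuousAlternatingMap.map_coord_zero _ i.succ (by simp; rfl)

/-- The exterior derivative of the component `μ` applied to a section, in coordinates. -/
theorem d_muComp_apply {k : ℕ}
    {Ω : FormField (I.prod 𝓘(ℝ, F)) (TotalSpace F E) (k + 1)} (hΩ : Ω.IsSmooth)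
    (e : Cₛ^∞⟮I; F, E⟯) (x : M) (v : Fin (k + 1) → B) :
    (FormField.d (I := I) (fun x => muComp Ω x (e x)) x : B [⋀^Fin (k + 1)]→L[ℝ] ℝ) v =
      ∑ i : Fin (k + 1), (-1 : ℝ) ^ (i : ℕ) *
        (fderiv ℝ (Ω.inChart ⟨x, 0⟩) (extChartAt I x x, 0) (v i, 0)
          (Matrix.vecCons ((0 : B), fiberCoord F x ⟨x, e x⟩)
            (fun j => (i.removeNth v j, (0 : F)))) +
        (Ω ⟨x, 0⟩ : (B × F) [⋀^Fin (k + 1)]→L[ℝ] ℝ)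
          (Matrix.vecCons ((0 : B), fderiv ℝ (sectionInChart I F e x) (extChartAt I x x) (v i))
            (fun j => (i.removeNth v j, (0 : F))))) := by
  have : IsManifold I 1 M := .of_le (n := ∞) (by simp)
  refine (DFunLike.congr_fun (FormField.d_eq (I := I) (fun x => muComp Ω x (e x)) x) v).trans ?_
  refine (extDeriv_apply ((hΩ.coreContraction e).differentiableAt
    (mem_extChartAt_target (I := I) x)) v).trans ?_
  refine Finset.sum_congr rfl fun i _ => ?_
  rw [← fderiv_inChart_coreContraction hΩ e]
  simp [zsmul_eq_mul]

theorem etaComp_apply {k : ℕ}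
    {Ω : FormField (I.prod 𝓘(ℝ, F)) (TotalSpace F E) (k + 1)} (hΩ : Ω.IsSmooth)
    (x : M) (e : E x) (v : Fin (k + 1) → B) :
    (etaComp Ω x e : B [⋀^Fin (k + 1)]→L[ℝ] ℝ) v =
      fderiv ℝ (Ω.inChart ⟨x, 0⟩) (extChartAt I x x, 0) (0, fiberCoord F x ⟨x, e⟩)
        (fun i => (v i, 0)) -
      ∑ i : Fin (k + 1), (-1 : ℝ) ^ (i : ℕ) *
        fderiv ℝ (Ω.inChart ⟨x, 0⟩) (extChartAt I x x, 0) (v i, 0)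
          (Matrix.vecCons ((0 : B), fiberCoord F x ⟨x, e⟩)
            (fun j => (i.removeNth v j, (0 : F)))) := by
  have hd := (hΩ.contDiffAt_inChart_zero x 0).differentiableAt (by simp)
  have h1 : Ω.d ⟨x, 0⟩ = extDeriv (Ω.inChart ⟨x, 0⟩) (extChartAt I x x, 0) := by
    rw [FormField.d_eq, extChartAt_totalSpace_self,
      fiberCoord_zero (FiberBundle.mem_baseSet_trivializationAt' _)]
  refine (coreContraction_apply Ω.d x e v).trans ?_
  exact (DFunLike.congr_fun h1 _).trans (extDeriv_apply_cons hd (0, fiberCoord F x ⟨x, e⟩)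
    (fun i => (v i, (0 : F))))

/-- The pullback of a linear form by a section is `dμ(e) + η(e)`. -/
theorem IsLinearForm.pullback_section {k : ℕ}
    {Ω : FormField (I.prod 𝓘(ℝ, F)) (TotalSpace F E) (k + 1)} (hΩ : Ω.IsSmooth)
    (hl : IsLinearForm Ω) (e : Cₛ^∞⟮I; F, E⟯) :
    FormField.pullback (I := I) (fun y : M => (⟨y, e y⟩ : TotalSpace F E)) Ω =
      FormField.d (fun x => muComp Ω x (e x)) + fun x => etaComp Ω x (e x) := by
  refine FormField.ext fun x v => ?_
  have h1 : (Ω ⟨x, e x⟩ : (B × F) [⋀^Fin (k + 1)]→L[ℝ] ℝ) (fun i =>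
      mfderiv I (I.prod 𝓘(ℝ, F)) (fun y : M => (⟨y, e y⟩ : TotalSpace F E)) x (v i)) = 
      (Ω ⟨x, e x⟩ : (B × F) [⋀^Fin (k + 1)]→L[ℝ] ℝ) (fun i =>
        (v i, fderiv ℝ (sectionInChart I F e x) (extChartAt I x x) (v i))) :=
    congrArg _ (funext fun i => mfderiv_section_apply e x (v i))
  refine h1.trans ?_
  refine Eq.trans ?_ (congrArg₂ (· + ·) (d_muComp_apply hΩ e x v) (etaComp_apply hΩ x (e x) v)).symm
  rw [hl.apply_eq hΩ]
  simp only [mul_add, Finset.sum_add_distrib]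
  have h2 : ∀ i : Fin (k + 1), (Ω ⟨x, 0⟩ : (B × F) [⋀^Fin (k + 1)]→L[ℝ] ℝ)
        (Function.update (fun j => (v j, 0)) i
          (0, fderiv ℝ (sectionInChart I F e x) (extChartAt I x x) (v i))) =
      (-1 : ℝ) ^ (i : ℕ) * (Ω ⟨x, 0⟩ : (B × F) [⋀^Fin (k + 1)]→L[ℝ] ℝ)
          (Matrix.vecCons ((0 : B), fderiv ℝ (sectionInChart I F e x) (extChartAt I x x) (v i))
            (fun j => (i.removeNth v j, (0 : F)))) := fun i =>
    ContinuousAlternatingMap.map_update_eq_cons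
      (V := B × F) (Ω ⟨x, 0⟩) (fun j => ((v j : B), (0 : F))) i _
  simp only [h2]
  -- Here a is the vertical derivative, b the alternating sum of horizontal derivatives and c the
  -- terms with the derivative of the section. The horizontal derivatives b occur in dμ(e) and in
  -- η(e) with opposite signs and cancel.
  exact (fun a b c => by ring : ∀ a b c : ℝ, a + c = b + c + (a - b)) _ _ _

end LinearForms

/-! ### The tangent prolongation in coordinates -/

section TangentSums

variable {B H M : Type*} [NormedAddCommGroup B] [NormedSpace ℝ B] [TopologicalSpace H]
  {I : ModelWithCorners ℝ B H} [I.Boundaryless] [TopologicalSpace M] [ChartedSpace H M]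
  [IsManifold I ∞ M]

/-- The first argument lives in a trivial bundle, so the trivialization of the Hom bundle acts only
on values, through that of the tangent bundle, which is the differential of the chart. -/
theorem TangentSum.fiberCoord_apply {k : ℕ} (x₀ : M) (w : TangentSum M I k)
    (hw : w.proj ∈ (extChartAt I x₀).source) (a : Fin k → ℝ) :
    (fiberCoord ((Fin k → ℝ) →L[ℝ] B) x₀ w : (Fin k → ℝ) →L[ℝ] B) a =
      (mfderiv I 𝓘(ℝ, B) (extChartAt I x₀) w.proj (w.2 a) : B) := by
  have : IsManifold I 1 M := .of_le (n := ∞) (by simp)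
  have hx : w.proj ∈ (chartAt H x₀).source := by rwa [extChartAt_source] at hw
  have h := DFunLike.congr_fun (TangentBundle.continuousLinearMapAt_trivializationAt (I := I) hx)
  have h2 : (trivializationAt (Fin k → ℝ) (Bundle.Trivial M (Fin k → ℝ)) x₀).symmL ℝ w.proj a =
      a := by simp
  have h1 : (fiberCoord ((Fin k → ℝ) →L[ℝ] B) x₀ w : (Fin k → ℝ) →L[ℝ] B) a =
    (trivializationAt B (TangentSpace I) x₀).continuousLinearMapAt ℝ w.proj (w.2
      ((trivializationAt (Fin k → ℝ) (Bundle.Trivial M (Fin k → ℝ)) x₀).symmL ℝ w.proj a)) := rfl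
  exact h1.trans ((h _).trans
    (congrArg (fun z => mfderiv I 𝓘(ℝ, B) (extChartAt I x₀) w.proj (w.2 z)) h2))

theorem TangentSum.fiberCoord_self {k : ℕ} (w : TangentSum M I k) (a : Fin k → ℝ) :
    (fiberCoord ((Fin k → ℝ) →L[ℝ] B) w.proj w : (Fin k → ℝ) →L[ℝ] B) a = w.2 a := by
  have : IsManifold I 1 M := .of_le (n := ∞) (by simp)
  refine (TangentSum.fiberCoord_apply _ w (mem_extChartAt_source _) a).trans ?_
  rw [mfderiv_extChartAt_self]
  rfl

/-- The function `(v₁, …, v_k) ↦ α(v_{τ 1}, …, v_{τ m})` in a chart of `T^{⊕k} M`. -/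
theorem TangentSum.form_apply_eventuallyEq {k m : ℕ} (α : FormField I M m) (τ : Fin m → Fin k)
    (w : TangentSum M I k) :
    (fun w' : TangentSum M I k => α w'.proj (fun i => w'.vec (τ i))) =ᶠ[nhds w]
      fun w' => (fun z : B × ((Fin k → ℝ) →L[ℝ] B) =>
        α.inChart w.proj z.1 (fun i => z.2 (Pi.single (τ i) 1)))
        (extChartAt (tangentSumModel I k) w w') := by
  have : IsManifold I 1 M := .of_le (n := ∞) (by simp)
  have hc := (FiberBundle.continuous_proj ((Fin k → ℝ) →L[ℝ] B)
    (fun x : M => Bundle.Trivial M (Fin k → ℝ) x →L[ℝ] TangentSpace I x)).continuousAt (x := w)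
  filter_upwards [hc.eventually_mem ((isOpen_extChartAt_source (I := I) w.proj).mem_nhds
    (mem_extChartAt_source w.proj)), hc.eventually_mem ((trivializationAt ((Fin k → ℝ) →L[ℝ] B)
      (fun x : M => Bundle.Trivial M (Fin k → ℝ) x →L[ℝ] TangentSpace I x)
      w.proj).open_baseSet.mem_nhds (FiberBundle.mem_baseSet_trivializationAt' _))] with w' hw hb
  rw [extChartAt_totalSpace_apply (I := I) (p₀ := w) (p := w') hb]
  have h : ∀ p, p = w'.proj → ∀ a a' : Fin m → B, (∀ i, a i = a' i) →
      (α w'.proj : B [⋀^Fin m]→L[ℝ] ℝ) a = (α p : B [⋀^Fin m]→L[ℝ] ℝ) a' := by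
    rintro _ rfl a a' haa; rw [funext haa]
  refine h _ ((extChartAt I w.proj).left_inv hw) _ _ fun i => ?_
  have h1 := DFunLike.congr_fun
    (mfderivWithin_extChartAt_symm_comp_mfderiv_extChartAt' (I := I) hw) (w'.vec (τ i))
  refine h1.symm.trans ?_
  exact congrArg (mfderivWithin 𝓘(ℝ, B) I (extChartAt I w.proj).symm (Set.range I)
    (extChartAt I w.proj w'.proj))
    (TangentSum.fiberCoord_apply w.proj w' hw (Pi.single (τ i) 1)).symm

/-- The function is a form evaluated on linear functions of `L`: the base component of a tangent
vector differentiates the coefficients, and the Hom component replaces one argument at a time. -/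
theorem hasFDerivAt_inChart_eval {k m : ℕ} {α : FormField I M m} (hα : α.IsSmooth)
    (τ : Fin m → Fin k) (x : M) (L : (Fin k → ℝ) →L[ℝ] B) :
    DifferentiableAt ℝ (fun z : B × ((Fin k → ℝ) →L[ℝ] B) =>
      α.inChart x z.1 (fun i => z.2 (Pi.single (τ i) 1))) (extChartAt I x x, L) ∧
    ∀ X : B × ((Fin k → ℝ) →L[ℝ] B), fderiv ℝ (fun z : B × ((Fin k → ℝ) →L[ℝ] B) =>
      α.inChart x z.1 (fun i => z.2 (Pi.single (τ i) 1))) (extChartAt I x x, L) X =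
      fderiv ℝ (α.inChart x) (extChartAt I x x) X.1 (fun i => L (Pi.single (τ i) 1)) +
      ∑ i, (α x : B [⋀^Fin m]→L[ℝ] ℝ) (Function.update (fun i => L (Pi.single (τ i) 1)) i
        (X.2 (Pi.single (τ i) 1))) := by
  have : IsManifold I 1 M := .of_le (n := ∞) (by simp)
  have h1 : HasFDerivAt (fun z : B × ((Fin k → ℝ) →L[ℝ] B) => α.inChart x z.1)
      ((fderiv ℝ (α.inChart x) (extChartAt I x x)).comp (ContinuousLinearMap.fst ℝ B _))
      (extChartAt I x x, L) :=
    HasFDerivAt.comp (g := α.inChart x) (f := Prod.fst) (extChartAt I x x, L)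
      (hα.differentiableAt (mem_extChartAt_target x)).hasFDerivAt hasFDerivAt_fst
  have h2 : HasFDerivAt (fun (z : B × ((Fin k → ℝ) →L[ℝ] B)) (i : Fin m) =>
      z.2 (Pi.single (τ i) 1)) (ContinuousLinearMap.pi fun i =>
        (ContinuousLinearMap.apply ℝ B (Pi.single (τ i) (1 : ℝ))).comp
          (ContinuousLinearMap.snd ℝ B _)) (extChartAt I x x, L) :=
    hasFDerivAt_pi.mpr fun i => ContinuousLinearMap.hasFDerivAt
      (f := (ContinuousLinearMap.apply ℝ B (Pi.single (τ i) (1 : ℝ) : Fin k → ℝ)).comp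
          (ContinuousLinearMap.snd ℝ B ((Fin k → ℝ) →L[ℝ] B)))
  refine ⟨h1.differentiableAt.continuousAlternatingMap_apply fun i => differentiableAt_pi.mp h2.differentiableAt i, fun X => ?_⟩
  refine (fderiv_alternating_apply h1.differentiableAt h2.differentiableAt).trans ?_
  rw [h1.fderiv, h2.fderiv, FormField.inChart_self]
  rfl

theorem TangentSum.mdifferentiableAt_form_apply {k m : ℕ} {α : FormField I M m}
    (hα : α.IsSmooth) (τ : Fin m → Fin k) (w : TangentSum M I k) :
    MDifferentiableAt (tangentSumModel I k) 𝓘(ℝ, ℝ)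
      (fun w' : TangentSum M I k => α w'.proj (fun i => w'.vec (τ i))) w := by
  refine MDifferentiableAt.congr_of_eventuallyEq ?_ (TangentSum.form_apply_eventuallyEq α τ w)
  refine MDifferentiableAt.comp (I := tangentSumModel I k)
    (I' := 𝓘(ℝ, B × ((Fin k → ℝ) →L[ℝ] B))) (g := fun z : B × ((Fin k → ℝ) →L[ℝ] B) =>
      α.inChart w.proj z.1 (fun i => z.2 (Pi.single (τ i) 1)))
    (f := extChartAt (tangentSumModel I k) w) w ?_
    (mdifferentiableAt_extChartAt (I := tangentSumModel I k) (mem_chart_source _ w))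
  rw [mdifferentiableAt_iff_differentiableAt, extChartAt_totalSpace_apply (I := I) (p₀ := w)
    (p := w) (FiberBundle.mem_baseSet_trivializationAt' _)]
  exact (hasFDerivAt_inChart_eval hα τ w.proj _).1

/-- The directional derivative of `(v₁, …, v_k) ↦ α(v_{τ 1}, …, v_{τ m})` on `T^{⊕k} M`. -/
theorem TangentSum.dirDeriv_form_apply {k m : ℕ} {α : FormField I M m}
    (hα : α.IsSmooth) (τ : Fin m → Fin k) (w : TangentSum M I k)
    (X : B × ((Fin k → ℝ) →L[ℝ] B)) :
    dirDeriv (I := tangentSumModel I k) (x := w) X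
      (fun w' : TangentSum M I k => α w'.proj (fun i => w'.vec (τ i))) =
      fderiv ℝ (α.inChart w.proj) (extChartAt I w.proj w.proj) X.1 (fun i => w.vec (τ i)) +
      ∑ i, (α w.proj : B [⋀^Fin m]→L[ℝ] ℝ) (Function.update (fun i => w.vec (τ i)) i
        (X.2 (Pi.single (τ i) 1))) := by
  have hd := hasFDerivAt_inChart_eval hα τ w.proj
    (fiberCoord ((Fin k → ℝ) →L[ℝ] B) w.proj w)
  have hx := extChartAt_totalSpace_apply (I := I) (p₀ := w) (p := w)
    (FiberBundle.mem_baseSet_trivializationAt' _)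
  have hd1 : MDifferentiableAt 𝓘(ℝ, B × ((Fin k → ℝ) →L[ℝ] B)) 𝓘(ℝ, ℝ)
      (fun z : B × ((Fin k → ℝ) →L[ℝ] B) =>
        α.inChart w.proj z.1 (fun i => z.2 (Pi.single (τ i) 1)))
      (extChartAt (tangentSumModel I k) w w) := by
    rw [mdifferentiableAt_iff_differentiableAt, hx]
    exact hd.1
  have h1 := mfderiv_comp (I := tangentSumModel I k) (I' := 𝓘(ℝ, B × ((Fin k → ℝ) →L[ℝ] B))) w hd1
    (mdifferentiableAt_extChartAt (mem_chart_source _ _))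
  have h2 := (TangentSum.form_apply_eventuallyEq α τ w).mfderiv_eq (I := tangentSumModel I k)
    (I' := 𝓘(ℝ, ℝ))
  rw [mfderiv_extChartAt_self, mfderiv_eq_fderiv, hx] at h1
  refine (DFunLike.congr_fun (h2.trans h1) X).trans ((hd.2 X).trans ?_)
  have e : (fun i => (fiberCoord ((Fin k → ℝ) →L[ℝ] B) w.proj w : (Fin k → ℝ) →L[ℝ] B)
      (Pi.single (τ i) 1)) = fun i => (w.vec (τ i) : B) :=
    funext fun i => TangentSum.fiberCoord_self w _
  rw [e]

end TangentSums

/-! ### Linearity of the anchor and of linear forms on the tangent prolongation -/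

section FibrewiseLinear

/-- The derivative of a fibrewise linear map is linear in the fibre coordinate and its variation. -/
theorem fderiv_fiberwise_add {B F G : Type*} [NormedAddCommGroup B] [NormedSpace ℝ B]
    [NormedAddCommGroup F] [NormedSpace ℝ F] [NormedAddCommGroup G] [NormedSpace ℝ G]
    {R : B × F → G} {y : B} (hR : ∀ u, DifferentiableAt ℝ R (y, u))
    (hadd : ∀ᶠ z in nhds y, ∀ u u', R (z, u + u') = R (z, u) + R (z, u'))
    (b : B) (u u' a a' : F) :
    fderiv ℝ R (y, u + u') (b, a + a') = fderiv ℝ R (y, u) (b, a) + fderiv ℝ R (y, u') (b, a') := by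
  -- The derivative is computed along the straight line through (y, u) in direction (b, a). For
  -- small t the function is additive in the fibre variable at y + t b, so the derivatives of the
  -- three curves add although the base points in the fibre differ.
  have hl : ∀ u a : F, HasDerivAt (fun t : ℝ => R (y + t • b, u + t • a))
      (fderiv ℝ R (y, u) (b, a)) 0 := by
    intro u a
    have h1 : HasDerivAt (fun t : ℝ => (y + t • b, u + t • a)) (b, a) 0 := by
      have hb := ((hasDerivAt_id (0 : ℝ)).smul_const b).const_add y
      have ha := ((hasDerivAt_id (0 : ℝ)).smul_const a).const_add u
      simpa using hb.prodMk ha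
    have h2 : HasFDerivAt R (fderiv ℝ R (y, u)) (y + (0 : ℝ) • b, u + (0 : ℝ) • a) := by
      simpa using (hR u).hasFDerivAt
    exact h2.comp_hasDerivAt (0 : ℝ) h1
  have hc : Filter.Tendsto (fun t : ℝ => y + t • b) (nhds 0) (nhds y) := by
    have : ContinuousAt (fun t : ℝ => y + t • b) 0 := by fun_prop
    simpa [ContinuousAt] using this
  refine (hl (u + u') (a + a')).unique (((hl u a).add (hl u' a')).congr_of_eventuallyEq ?_)
  filter_upwards [hc.eventually hadd] with t ht
  rw [smul_add, add_add_add_comm]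
  exact ht _ _

theorem fderiv_fiberwise_smul {B F G : Type*} [NormedAddCommGroup B] [NormedSpace ℝ B]
    [NormedAddCommGroup F] [NormedSpace ℝ F] [NormedAddCommGroup G] [NormedSpace ℝ G]
    {R : B × F → G} {y : B} (hR : ∀ u, DifferentiableAt ℝ R (y, u))
    (hsmul : ∀ᶠ z in nhds y, ∀ (c : ℝ) u, R (z, c • u) = c • R (z, u))
    (b : B) (c : ℝ) (u a : F) :
    fderiv ℝ R (y, c • u) (b, c • a) = c • fderiv ℝ R (y, u) (b, a) := by
  have hl : ∀ u a : F, HasDerivAt (fun t : ℝ => R (y + t • b, u + t • a))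
      (fderiv ℝ R (y, u) (b, a)) 0 := by
    intro u a
    have h1 : HasDerivAt (fun t : ℝ => (y + t • b, u + t • a)) (b, a) 0 := by
      have hb := ((hasDerivAt_id (0 : ℝ)).smul_const b).const_add y
      have ha := ((hasDerivAt_id (0 : ℝ)).smul_const a).const_add u
      simpa using hb.prodMk ha
    have h2 : HasFDerivAt R (fderiv ℝ R (y, u)) (y + (0 : ℝ) • b, u + (0 : ℝ) • a) := by
      simpa using (hR u).hasFDerivAt
    exact h2.comp_hasDerivAt (0 : ℝ) h1
  have hc : Filter.Tendsto (fun t : ℝ => y + t • b) (nhds 0) (nhds y) := by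
    have : ContinuousAt (fun t : ℝ => y + t • b) 0 := by fun_prop
    simpa [ContinuousAt] using this
  refine (hl (c • u) (c • a)).unique (((hl u a).const_smul c).congr_of_eventuallyEq ?_)
  filter_upwards [hc.eventually hsmul] with t ht
  rw [smul_comm t c a, ← smul_add]
  exact ht _ _

end FibrewiseLinear

section TangentLifts

variable {B H M : Type*} [NormedAddCommGroup B] [NormedSpace ℝ B] [TopologicalSpace H]
  {I : ModelWithCorners ℝ B H} [I.Boundaryless] [TopologicalSpace M] [ChartedSpace H M]
  {F : Type*} [NormedAddCommGroup F] [NormedSpace ℝ F]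
  {E : M → Type*} [TopologicalSpace (TotalSpace F E)] [∀ x, TopologicalSpace (E x)]
  [∀ x, AddCommGroup (E x)] [∀ x, Module ℝ (E x)] [FiberBundle F E] [VectorBundle ℝ F E]
  [IsManifold I ∞ M] [ContMDiffVectorBundle ∞ F E I]

/-- The anchor as a map of total spaces. -/
def LieAlgebroid.anchorMap (A : LieAlgebroid I F E) (p : TotalSpace F E) : TangentBundle I M :=
  ⟨p.proj, A.anchor p.proj p.2⟩

/-- The fibre component of the derivative of the anchor. -/
def LieAlgebroid.anchorDeriv (A : LieAlgebroid I F E) {x : M} (e : E x) (W : B × F) : B :=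
  (mfderiv (I.prod 𝓘(ℝ, F)) I.tangent
    (fun p : TotalSpace F E => (⟨p.proj, A.anchor p.proj p.2⟩ : TangentBundle I M)) ⟨x, e⟩ W :
    B × B).2

/-- The coordinate expression of the anchor. -/
def LieAlgebroid.anchorInChart (A : LieAlgebroid I F E) (x : M) (z : B × F) : B :=
  fiberCoord (E := fun x : M => TangentSpace I x) B x
    (A.anchorMap ((extChartAt (I.prod 𝓘(ℝ, F)) (⟨x, 0⟩ : TotalSpace F E)).symm z))

/-- Since the chart of the total space is the same along a fibre, the one function `anchorInChart x`
computes the derivative of the anchor at every `e` over `x`. -/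
theorem LieAlgebroid.anchorDeriv_eq (A : LieAlgebroid I F E) {x : M} (e : E x) (W : B × F) :
    DifferentiableAt ℝ (A.anchorInChart x) (extChartAt I x x, fiberCoord F x ⟨x, e⟩) ∧
    A.anchorDeriv e W = fderiv ℝ (A.anchorInChart x) (extChartAt I x x, fiberCoord F x ⟨x, e⟩) W
     := by
  have hρ : ContMDiffAt (I.prod 𝓘(ℝ, F)) (I.prod 𝓘(ℝ, B)) ∞ A.anchorMap ⟨x, e⟩ :=
    A.contMDiff_anchor _
  have h1 : ContMDiffAt (I.prod 𝓘(ℝ, F)) 𝓘(ℝ, B) ∞ (fun p : TotalSpace F E => fiberCoord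
      (E := fun x : M => TangentSpace I x) B x (A.anchorMap p)) ⟨x, e⟩ :=
    (Bundle.contMDiffAt_totalSpace.mp hρ).2
  have h2 := mfderiv_totalSpace_apply (E := fun x : M => TangentSpace I x)
    (hρ.mdifferentiableAt (by simp)) W
  have h3 := mfderiv_vector_apply (h1.mdifferentiableAt (by simp)) W
  have hφ : extChartAt (I.prod 𝓘(ℝ, F)) (⟨x, e⟩ : TotalSpace F E) =
      extChartAt (I.prod 𝓘(ℝ, F)) (⟨x, 0⟩ : TotalSpace F E) := extChartAt_totalSpace_congr rfl
  have hy : extChartAt (I.prod 𝓘(ℝ, F)) (⟨x, e⟩ : TotalSpace F E) ⟨x, e⟩ =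
      (extChartAt I x x, fiberCoord F x ⟨x, e⟩) := by
    rw [← extChartAt_totalSpace_self x e]
    rw [hφ]
  have h4 : ContDiffAt ℝ ∞ (A.anchorInChart x) (extChartAt I x x, fiberCoord F x ⟨x, e⟩) := by
    rw [← contMDiffAt_iff_contDiffAt, ← hy]
    unfold LieAlgebroid.anchorInChart
    rw [← hφ]
    refine ContMDiffAt.comp (g := fun p : TotalSpace F E => fiberCoord
      (E := fun x : M => TangentSpace I x) B x (A.anchorMap p)) (I' := I.prod 𝓘(ℝ, F)) _ ?_
      (contMDiffAt_extChartAt_symm (mem_extChartAt_target (I := I.prod 𝓘(ℝ, F)) _))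
    rw [extChartAt_to_inv]
    exact h1
  refine ⟨h4.differentiableAt (by simp), ?_⟩
  refine (congrArg Prod.snd h2).trans (h3.trans ?_)
  rw [hy, hφ]
  rfl

/-- In trivializations near `x` the anchor is the composite of three linear maps: inverse
trivialization of E, anchor, trivialization of TM. This is the input for additivity and homogeneity
of `anchorDeriv`. -/
theorem LieAlgebroid.anchorInChart_linear (A : LieAlgebroid I F E) (x : M) :
    ∀ᶠ y in nhds (extChartAt I x x), ∃ L : F →ₗ[ℝ] B, ∀ u, A.anchorInChart x (y, u) = L u := by
  have : IsManifold I 1 M := .of_le (n := ∞) (by simp)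
  filter_upwards [eventually_mem_baseSet (I := I) (F := F) (E := E) x] with y ⟨hy, hb⟩
  have hb' : (extChartAt I x).symm y ∈ (trivializationAt B (TangentSpace I) x).baseSet := by
    have := (extChartAt I x).map_target hy
    rw [extChartAt_source] at this
    simpa using this
  refine ⟨((trivializationAt B (TangentSpace I) x).linearMapAt ℝ ((extChartAt I x).symm y)).comp
    ((A.anchor ((extChartAt I x).symm y)).comp
      ((trivializationAt F E x).symmₗ ℝ ((extChartAt I x).symm y))), fun u => ?_⟩
  have h1 : (extChartAt (I.prod 𝓘(ℝ, F)) (⟨x, 0⟩ : TotalSpace F E)).symm (y, u) =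
      ⟨(extChartAt I x).symm y, (trivializationAt F E x).symm ((extChartAt I x).symm y) u⟩ := by
    rw [FiberBundle.extChartAt]
    exact ((trivializationAt F E x).mk_symm hb u).symm
  rw [LieAlgebroid.anchorInChart, h1]
  rw [LinearMap.comp_apply, LinearMap.comp_apply, Bundle.Trivialization.linearMapAt_apply,
    if_pos hb', Bundle.Trivialization.coe_symmₗ _ hb]
  rfl

theorem LieAlgebroid.anchorDeriv_add (A : LieAlgebroid I F E) {x : M} (e e' : E x) (b : B)
    (a a' : F) :
    A.anchorDeriv (e + e') (b, a + a') = A.anchorDeriv e (b, a) + A.anchorDeriv e' (b, a') := by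
  rw [(A.anchorDeriv_eq _ _).2, (A.anchorDeriv_eq _ _).2, (A.anchorDeriv_eq _ _).2,
    fiberCoord_add (FiberBundle.mem_baseSet_trivializationAt' _)]
  refine fderiv_fiberwise_add (fun u => ?_) ?_ b _ _ a a'
  · have h := (A.anchorDeriv_eq ((trivializationAt F E x).symm x u) 0).1
    have hu : fiberCoord F x ⟨x, (trivializationAt F E x).symm x u⟩ = u := by
      rw [fiberCoord, (trivializationAt F E x).apply_mk_symm
        (FiberBundle.mem_baseSet_trivializationAt' _)]
    rwa [hu] at h
  · filter_upwards [A.anchorInChart_linear x] with y ⟨L, hL⟩ u u'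
    simp [hL]

theorem LieAlgebroid.anchorDeriv_smul (A : LieAlgebroid I F E) {x : M} (c : ℝ) (e : E x) (b : B)
    (a : F) : A.anchorDeriv (c • e) (b, c • a) = c • A.anchorDeriv e (b, a) := by
  rw [(A.anchorDeriv_eq _ _).2, (A.anchorDeriv_eq _ _).2,
    fiberCoord_smul (FiberBundle.mem_baseSet_trivializationAt' _)]
  refine fderiv_fiberwise_smul (fun u => ?_) ?_ b c _ a
  · have h := (A.anchorDeriv_eq ((trivializationAt F E x).symm x u) 0).1
    have hu : fiberCoord F x ⟨x, (trivializationAt F E x).symm x u⟩ = u := by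
      rw [fiberCoord, (trivializationAt F E x).apply_mk_symm
        (FiberBundle.mem_baseSet_trivializationAt' _)]
    rwa [hu] at h
  · filter_upwards [A.anchorInChart_linear x] with y ⟨L, hL⟩ c u
    simp [hL]

theorem LieAlgebroid.isSmoothField_anchorField (A : LieAlgebroid I F E) (e : Cₛ^∞⟮I; F, E⟯) :
    IsSmoothField (A.anchorField e) := A.contMDiff_anchor.comp e.contMDiff

/-- The derivative of the anchor along a section. -/
theorem LieAlgebroid.anchorDeriv_section (A : LieAlgebroid I F E) (e : Cₛ^∞⟮I; F, E⟯) (x : M)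
    (v : B) :
    A.anchorDeriv (e x) (v, fderiv ℝ (sectionInChart I F e x) (extChartAt I x x) v) =
      fderiv ℝ (fieldInChart (A.anchorField e) x) (extChartAt I x x) v := by
  have : IsManifold I 1 M := .of_le (n := ∞) (by simp)
  have h1 := mfderiv_comp (I := I) (I' := I.prod 𝓘(ℝ, F)) (I'' := I.tangent)
    (g := A.anchorMap) (f := fun y : M => (⟨y, e y⟩ : TotalSpace F E)) x
    ((A.contMDiff_anchor _).mdifferentiableAt (by simp))
    ((e.contMDiff x).mdifferentiableAt (by simp))
  have hX := A.isSmoothField_anchorField e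
  have h2 := mfderiv_totalSpace_apply (E := fun x : M => TangentSpace I x)
    ((hX x).mdifferentiableAt (by simp)) v
  have h3 := mfderiv_vector_apply (I := I) (V' := B)
    (f := fun y => fiberCoord (E := fun x : M => TangentSpace I x) B x ⟨y, A.anchorField e y⟩)
    (((Bundle.contMDiffAt_totalSpace.mp (hX x)).2).mdifferentiableAt (by simp)) v
  have h4 : (mfderiv I I.tangent (A.anchorMap ∘ fun y : M => (⟨y, e y⟩ : TotalSpace F E)) x v :
      B × B).2 = A.anchorDeriv (e x)
        (v, fderiv ℝ (sectionInChart I F e x) (extChartAt I x x) v) := by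
    rw [LieAlgebroid.anchorDeriv, ← mfderiv_section_apply e x v]
    exact congrArg Prod.snd (DFunLike.congr_fun h1 v)
  have e : (fun y => fiberCoord (E := fun x : M => TangentSpace I x) B x
      ⟨(extChartAt I x).symm y, A.anchorField e ((extChartAt I x).symm y)⟩)
      =ᶠ[nhds (extChartAt I x x)] fieldInChart (A.anchorField e) x := by
    filter_upwards [eventually_mem_extChartAt_target (mem_extChartAt_target (I := I) x)] with y hy
    exact trivializationAt_tangent_snd ((extChartAt I x).map_target hy) _
  exact h4.symm.trans ((congrArg Prod.snd h2).trans
    (h3.trans (DFunLike.congr_fun (e.fderiv_eq (𝕜 := ℝ)) v)))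

theorem fiberCoord_tangent_self (x : M) (v : TangentSpace I x) :
    fiberCoord (E := fun x : M => TangentSpace I x) B x ⟨x, v⟩ = v := by
  have : IsManifold I 1 M := .of_le (n := ∞) (by simp)
  refine (trivializationAt_tangent_snd (mem_extChartAt_source x) v).trans ?_
  rw [mfderiv_extChartAt_self]
  rfl

/-- The derivative of the anchor along the zero section and in vertical directions. -/
theorem LieAlgebroid.anchorDeriv_zero (A : LieAlgebroid I F E) {x : M} (e : E x) (v : B) :
    A.anchorDeriv (0 : E x) (v, fiberCoord F x ⟨x, e⟩) = A.anchor x e := by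
  have h0 : A.anchorDeriv (0 : E x) (v, 0) = 0 := by
    have := A.anchorDeriv_smul (0 : ℝ) (0 : E x) v 0
    simpa using this
  have hz : (0 : ℝ) • e = 0 := zero_smul _ _
  -- The anchor maps the curve t ↦ t e to t ↦ t ρ(e), so its derivative takes the vertical vector of
  -- `e` to that of ρ(e).
  have hv : A.anchorDeriv (0 : E x) (0, fiberCoord F x ⟨x, e⟩) = A.anchor x e := by
    have hA : ∀ p, p = (⟨x, 0⟩ : TotalSpace F E) → MDifferentiableAt (I.prod 𝓘(ℝ, F)) I.tangent
        A.anchorMap p := fun p _ => (A.contMDiff_anchor p).mdifferentiableAt (by simp)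
    have h1 := mfderiv_comp (I := 𝓘(ℝ, ℝ)) (I' := I.prod 𝓘(ℝ, F)) (I'' := I.tangent)
      (g := A.anchorMap) (f := fun t : ℝ => (⟨x, t • e⟩ : TotalSpace F E)) 0
      (hA _ (by rw [hz]))
      ((contMDiff_smul_vector (I := I) (F := F) e (0 : ℝ)).mdifferentiableAt (by simp))
    have e1 : (A.anchorMap ∘ fun t : ℝ => (⟨x, t • e⟩ : TotalSpace F E)) =
        fun t : ℝ => (⟨x, t • A.anchor x e⟩ : TangentBundle I M) := by
      funext t
      simp [LieAlgebroid.anchorMap]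
    rw [e1] at h1
    have h2 := vert_apply (I := I) (F := B) (E := fun x : M => TangentSpace I x) (A.anchor x e)
    have h3 : ∀ p, p = (⟨x, 0⟩ : TotalSpace F E) → ∀ V : B × F,
        (mfderiv (I.prod 𝓘(ℝ, F)) I.tangent A.anchorMap p V : B × B).2 =
        A.anchorDeriv (0 : E x) V := by rintro _ rfl V; rfl
    rw [fiberCoord_tangent_self] at h2
    rw [← vert_apply (I := I) e]
    refine (h3 ⟨x, (0 : ℝ) • e⟩ (by rw [hz]) _).symm.trans ?_
    refine (congrArg Prod.snd (DFunLike.congr_fun h1 (1 : ℝ))).symm.trans ?_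
    exact congrArg Prod.snd h2
  have h := A.anchorDeriv_eq (0 : E x) (v, fiberCoord F x ⟨x, e⟩)
  have h' : ((v, fiberCoord F x ⟨x, e⟩) : B × F) = (v, 0) + (0, fiberCoord F x ⟨x, e⟩) := by simp
  rw [h.2, h', map_add, ← (A.anchorDeriv_eq (0 : E x) _).2, ← (A.anchorDeriv_eq (0 : E x) _).2, h0,
    zero_add, hv]

end TangentLifts

/-! ### Leibniz rule for directional derivatives -/

section DirDeriv

variable {V H X : Type*} [NormedAddCommGroup V] [NormedSpace ℝ V] [TopologicalSpace H]
  {I : ModelWithCorners ℝ V H} [TopologicalSpace X] [ChartedSpace H X] [I.Boundaryless]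
  [IsManifold I 1 X]

theorem dirDeriv_eq {f : X → ℝ} {x : X} (hf : MDifferentiableAt I 𝓘(ℝ, ℝ) f x) (v : V) :
    DifferentiableAt ℝ (fun y => f ((extChartAt I x).symm y)) (extChartAt I x x) ∧
    dirDeriv (I := I) (x := x) v f =
      fderiv ℝ (fun y => f ((extChartAt I x).symm y)) (extChartAt I x x) v := by
  refine ⟨?_, mfderiv_vector_apply hf v⟩
  rw [← mdifferentiableAt_iff_differentiableAt]
  refine MDifferentiableAt.comp (I' := I) (g := f) (f := (extChartAt I x).symm) _ ?_
    (mdifferentiableAt_extChartAt_symm (mem_extChartAt_target (I := I) x))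
  rw [extChartAt_to_inv]
  exact hf

/-- Product rule in the chart at `x`; it later produces the coefficient derivatives in the cocycle
condition. -/
theorem dirDeriv_sum_mul {ι : Type*} (s : Finset ι) {g G : ι → X → ℝ} {x : X}
    (hg : ∀ c, MDifferentiableAt I 𝓘(ℝ, ℝ) (g c) x)
    (hG : ∀ c, MDifferentiableAt I 𝓘(ℝ, ℝ) (G c) x) (v : V) :
    dirDeriv (I := I) (x := x) v (fun y => ∑ c ∈ s, g c y * G c y) =
      ∑ c ∈ s, (dirDeriv (I := I) (x := x) v (g c) * G c x +
        g c x * dirDeriv (I := I) (x := x) v (G c)) := by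
  have hd := fun c => (dirDeriv_eq (hg c) v).1
  have hD := fun c => (dirDeriv_eq (hG c) v).1
  have h1 : HasFDerivAt (fun y => ∑ c ∈ s, g c ((extChartAt I x).symm y) *
      G c ((extChartAt I x).symm y)) (∑ c ∈ s, (g c ((extChartAt I x).symm (extChartAt I x x)) •
        fderiv ℝ (fun y => G c ((extChartAt I x).symm y)) (extChartAt I x x) +
        G c ((extChartAt I x).symm (extChartAt I x x)) •
        fderiv ℝ (fun y => g c ((extChartAt I x).symm y)) (extChartAt I x x)))
      (extChartAt I x x) :=
    HasFDerivAt.fun_sum fun c _ => (hd c).hasFDerivAt.mul (hD c).hasFDerivAt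
  have hm : MDifferentiableAt I 𝓘(ℝ, ℝ) (fun y => ∑ c ∈ s, g c y * G c y) x := by
    have h2 : MDifferentiableAt I 𝓘(ℝ, ℝ) (fun y => (fun y => ∑ c ∈ s,
        g c ((extChartAt I x).symm y) * G c ((extChartAt I x).symm y)) (extChartAt I x y)) x :=
      MDifferentiableAt.comp (I' := 𝓘(ℝ, V)) (g := fun y => ∑ c ∈ s,
        g c ((extChartAt I x).symm y) * G c ((extChartAt I x).symm y)) x
        (mdifferentiableAt_iff_differentiableAt.mpr h1.differentiableAt)
        (mdifferentiableAt_extChartAt (mem_chart_source H x))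
    refine h2.congr_of_eventuallyEq ?_
    filter_upwards [(isOpen_extChartAt_source (I := I) x).mem_nhds (mem_extChartAt_source x)]
      with y hy
    simp only [(extChartAt I x).left_inv hy]
  rw [(dirDeriv_eq hm v).2, h1.fderiv]
  simp only [sum_apply, add_apply, smul_apply, extChartAt_to_inv]
  refine Finset.sum_congr rfl fun c _ => ?_
  rw [(dirDeriv_eq (hg c) v).2, (dirDeriv_eq (hG c) v).2, smul_eq_mul, smul_eq_mul]
  ring

theorem dirDeriv_const_mul (c : ℝ) {G : X → ℝ} {x : X}
    (hG : MDifferentiableAt I 𝓘(ℝ, ℝ) G x) (v : V) :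
    dirDeriv (I := I) (x := x) v (fun y => c * G y) = c * dirDeriv (I := I) (x := x) v G := by
  have h := dirDeriv_sum_mul (I := I) (Finset.univ : Finset Unit) (g := fun _ _ => c)
    (G := fun _ => G) (x := x) (fun _ => mdifferentiableAt_const) (fun _ => hG) v
  have h0 : dirDeriv (I := I) (x := x) v (fun _ : X => c) = 0 := by
    exact DFunLike.congr_fun (mfderiv_const (I := I) (I' := 𝓘(ℝ, ℝ)) (c := c) (x := x)) v
  simpa [h0] using h

end DirDeriv

/-! ### Fibrewise linear structure and values on lifts -/

section TangentLifts

variable {B H M : Type*} [NormedAddCommGroup B] [NormedSpace ℝ B] [TopologicalSpace H]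
  {I : ModelWithCorners ℝ B H} [I.Boundaryless] [TopologicalSpace M] [ChartedSpace H M]
  {F : Type*} [NormedAddCommGroup F] [NormedSpace ℝ F]
  {E : M → Type*} [TopologicalSpace (TotalSpace F E)] [∀ x, TopologicalSpace (E x)]
  [∀ x, AddCommGroup (E x)] [∀ x, Module ℝ (E x)] [FiberBundle F E] [VectorBundle ℝ F E]
  [IsManifold I ∞ M] [ContMDiffVectorBundle ∞ F E I]

variable (B) in
/-- The linear map `ℝ^k → B` with prescribed values on the standard basis. -/
def homOfTuple (k : ℕ) : (Fin k → B) →ₗ[ℝ] ((Fin k → ℝ) →L[ℝ] B) where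
  toFun a := ∑ i, (ContinuousLinearMap.proj i : (Fin k → ℝ) →L[ℝ] ℝ).smulRight (a i)
  map_add' a a' := by
    rw [← Finset.sum_add_distrib]
    exact Finset.sum_congr rfl fun i _ => by ext b; simp
  map_smul' c a := by
    rw [RingHom.id_apply, Finset.smul_sum]
    exact Finset.sum_congr rfl fun i _ => by ext b; exact smul_comm (b i) c (a i)

theorem homOfTuple_single {k : ℕ} (a : Fin k → B) (i : Fin k) :
    homOfTuple B k a (Pi.single i 1) = a i := by
  simp [homOfTuple, Pi.single_apply]

/-- The value of a linear form with given first jet along the zero section. -/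
def linearJet {k : ℕ} (D : (B × F) →L[ℝ] (B × F) [⋀^Fin k]→L[ℝ] ℝ)
    (α : (B × F) [⋀^Fin k]→L[ℝ] ℝ) (v : Fin k → B) : F × (Fin k → F) →ₗ[ℝ] ℝ where
  toFun ξ := D (0, ξ.1) (fun i => (v i, 0)) +
    ∑ i, α (Function.update (fun j => (v j, 0)) i (0, ξ.2 i))
  map_add' ξ ξ' := by
    have h1 : ((0 : B), (ξ + ξ').1) = (0, ξ.1) + (0, ξ'.1) := by simp
    have h2 : ∀ i, ((0 : B), (ξ + ξ').2 i) = (0, ξ.2 i) + (0, ξ'.2 i) := fun i => by simp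
    simp only [h1, h2, map_add, ContinuousAlternatingMap.add_apply,
      ContinuousAlternatingMap.map_update_add, Finset.sum_add_distrib]
    ring
  map_smul' c ξ := by
    have h1 : ((0 : B), (c • ξ).1) = c • (0, ξ.1) := by simp
    have h2 : ∀ i, ((0 : B), (c • ξ).2 i) = c • (0, ξ.2 i) := fun i => by simp
    simp only [h1, h2, map_smul, ContinuousAlternatingMap.smul_apply,
      ContinuousAlternatingMap.map_update_smul, ← Finset.smul_sum, RingHom.id_apply, smul_add]

/-- The anchor of `T^{⊕k} A` as a linear map. -/
def LieAlgebroid.tangentSumAnchorₗ (A : LieAlgebroid I F E) {k : ℕ} (w : TangentSum M I k) :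
    TangentSumFiber F E w →ₗ[ℝ] B × ((Fin k → ℝ) →L[ℝ] B) where
  toFun ξ := A.tangentSumAnchor w ξ
  map_add' ξ ξ' := Prod.ext (map_add (A.anchor w.proj) ξ.1 ξ'.1)
    ((congrArg (homOfTuple B k) (funext fun i => A.anchorDeriv_add ξ.1 ξ'.1 (w.vec i) _ _)).trans
      (map_add (homOfTuple B k) _ _))
  map_smul' c ξ := Prod.ext (map_smul (A.anchor w.proj) c ξ.1)
    ((congrArg (homOfTuple B k) (funext fun i => A.anchorDeriv_smul c ξ.1 (w.vec i) _)).trans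
      (map_smul (homOfTuple B k) c _))

variable [FiniteDimensional ℝ B] [FiniteDimensional ℝ F]

/-- Linearity in ξ is not evident from `evalForm`, since the base point of the form moves with ξ.
Expressing Ω through its first jet at zero makes every term linear in ξ. -/
theorem evalForm_eq {k : ℕ} {Ω : FormField (I.prod 𝓘(ℝ, F)) (TotalSpace F E) k}
    (hΩ : Ω.IsSmooth) (hl : IsLinearForm Ω) (w : TangentSum M I k) (ξ : TangentSumFiber F E w) :
    evalForm Ω w ξ = linearJet
      (fderiv ℝ (Ω.inChart ⟨w.proj, 0⟩) (extChartAt I w.proj w.proj, 0)) (Ω ⟨w.proj, 0⟩) w.vec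
      ((trivializationAt F E w.proj).linearMapAt ℝ w.proj ξ.1, ξ.2) := by
  refine (hl.apply_eq hΩ w.proj ξ.1 (fun i => ((w.vec i : B), ξ.2 i))).trans ?_
  rw [Bundle.Trivialization.linearMapAt_apply,
    if_pos (FiberBundle.mem_baseSet_trivializationAt' _)]
  rfl

/-- The function `Ω̲` of a linear form as a linear map on the fibres. -/
def evalFormₗ {k : ℕ} (Ω : FormField (I.prod 𝓘(ℝ, F)) (TotalSpace F E) k)
    (w : TangentSum M I k) : TangentSumFiber F E w →ₗ[ℝ] ℝ :=
  linearJet (fderiv ℝ (Ω.inChart ⟨w.proj, 0⟩) (extChartAt I w.proj w.proj, 0))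
    (Ω ⟨w.proj, 0⟩) w.vec ∘ₗ
    ((trivializationAt F E w.proj).linearMapAt ℝ w.proj).prodMap LinearMap.id

theorem evalForm_eq_evalFormₗ {k : ℕ} {Ω : FormField (I.prod 𝓘(ℝ, F)) (TotalSpace F E) k}
    (hΩ : Ω.IsSmooth) (hl : IsLinearForm Ω) (w : TangentSum M I k) (ξ : TangentSumFiber F E w) :
    evalForm Ω w ξ = evalFormₗ Ω w ξ := evalForm_eq hΩ hl w ξ

theorem evalForm_tangent {k : ℕ} (Ω : FormField (I.prod 𝓘(ℝ, F)) (TotalSpace F E) k)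
    (e : Cₛ^∞⟮I; F, E⟯) (w : TangentSum M I k) :
    evalForm Ω w ((LiftedSection.tangent e).toSection w) =
      FormField.pullback (I := I) (fun y : M => (⟨y, e y⟩ : TotalSpace F E)) Ω w.proj w.vec := by
  refine congrArg (Ω ⟨w.proj, e w.proj⟩ : (B × F) [⋀^Fin k]→L[ℝ] ℝ) (funext fun i => ?_)
  refine Prod.ext ?_ rfl
  exact (congrArg Prod.fst (mfderiv_section_apply e w.proj (w.vec i))).symm

theorem LiftedSection.core_toSection {k : ℕ} (j : Fin k) (e : Cₛ^∞⟮I; F, E⟯)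
    (w : TangentSum M I k) :
    (LiftedSection.core j e).toSection w =
      (0, fun i => if i = j then fiberCoord F w.proj ⟨w.proj, e w.proj⟩ else 0) := by
  have key : ∀ (a z z' : B × F) (u : F) (P : Prop) [Decidable P], a.2 = 0 → z.2 = u → z'.2 = 0 →
      (a + if P then z else z').2 = if P then u else 0 := by
    intro a z z' u P _ ha hz hz'
    split_ifs <;> simp [ha, hz, hz']
  refine Prod.ext rfl (funext fun i => ?_)
  exact key _ _ _ _ (i = j)
    (congrArg Prod.snd (tangentZero_apply (I := I) (F := F) (E := E) w.proj (w.vec i : B)))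
    (congrArg Prod.snd (vert_apply (I := I) (F := F) (e w.proj))) rfl

/-- A core lift lies over the zero vector, so the derivative term of the jet vanishes and only slot
`j` carries a vertical part. Moving that slot to the front costs (-1)^j. -/
theorem evalForm_core {k : ℕ} {Ω : FormField (I.prod 𝓘(ℝ, F)) (TotalSpace F E) (k + 1)}
    (hΩ : Ω.IsSmooth) (hl : IsLinearForm Ω) (j : Fin (k + 1))
    (e : Cₛ^∞⟮I; F, E⟯) (w : TangentSum M I (k + 1)) :
    evalForm Ω w ((LiftedSection.core j e).toSection w) =
      (-1 : ℝ) ^ (j : ℕ) * muComp Ω w.proj (e w.proj) (fun i => w.vec (j.succAbove i)) := by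
  rw [evalForm_eq hΩ hl]
  rw [LiftedSection.core_toSection, map_zero]
  have h3 : ∀ (D : (B × F) →L[ℝ] (B × F) [⋀^Fin (k + 1)]→L[ℝ] ℝ)
      (α : (B × F) [⋀^Fin (k + 1)]→L[ℝ] ℝ) (v : Fin (k + 1) → B) (u : F),
      linearJet D α v (0, fun i => if i = j then u else 0) =
        (-1 : ℝ) ^ (j : ℕ) * α (Matrix.vecCons (0, u) (j.removeNth fun i => (v i, 0))) := by
    intro D α v u
    rw [← ContinuousAlternatingMap.map_update_eq_cons]
    have h0 : ((0 : B), (0 : F)) = 0 := rfl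
    change D (0, 0) _ + ∑ i, α _ = _
    rw [h0, map_zero, Finset.sum_eq_single j]
    · simp
    · intro i _ hij
      exact ContinuousAlternatingMap.map_coord_zero _ i (by simp [hij])
    · simp
  refine (h3 _ _ _ _).trans ?_
  refine congrArg (fun z => (-1 : ℝ) ^ (j : ℕ) * z) ?_
  exact (coreContraction_apply Ω w.proj (e w.proj) (fun i => w.vec (j.succAbove i))).symm

end TangentLifts

/-! ### Action of the anchors of lifts on the functions defined by forms -/

section MorphicLifts

variable {B H M : Type*} [NormedAddCommGroup B] [NormedSpace ℝ B] [TopologicalSpace H]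
  {I : ModelWithCorners ℝ B H} [I.Boundaryless] [TopologicalSpace M] [ChartedSpace H M]
  {F : Type*} [NormedAddCommGroup F] [NormedSpace ℝ F]
  {E : M → Type*} [TopologicalSpace (TotalSpace F E)] [∀ x, TopologicalSpace (E x)]
  [∀ x, AddCommGroup (E x)] [∀ x, Module ℝ (E x)] [FiberBundle F E] [VectorBundle ℝ F E]
  [IsManifold I ∞ M] [ContMDiffVectorBundle ∞ F E I]
  [FiniteDimensional ℝ B] [FiniteDimensional ℝ F]

/-- The result is the complete lift of ρ(e): by the chain rule the derivative of the anchor along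
the section `e` is the derivative of ρ(e). -/
theorem LieAlgebroid.tangentSumAnchor_tangent (A : LieAlgebroid I F E) {k : ℕ}
    (e : Cₛ^∞⟮I; F, E⟯) (w : TangentSum M I k) :
    (A.tangentSumAnchor w ((LiftedSection.tangent e).toSection w) :
      B × ((Fin k → ℝ) →L[ℝ] B)) = ((A.anchorField e w.proj : B),
      homOfTuple B k (fun i => fderiv ℝ (fieldInChart (A.anchorField e) w.proj)
        (extChartAt I w.proj w.proj) (w.vec i))) := by
  refine Prod.ext rfl (congrArg (homOfTuple B k) (funext fun i => ?_))
  refine Eq.trans ?_ (A.anchorDeriv_section e w.proj (w.vec i))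
  exact congrArg (fun a => A.anchorDeriv (e w.proj) ((w.vec i : B), a))
    (congrArg Prod.snd (mfderiv_section_apply e w.proj (w.vec i)))

/-- A core lift has no base component, so its anchor is vertical in T^{⊕k}M and changes the j-th
vector alone, in the direction ρ(e). -/
theorem LieAlgebroid.tangentSumAnchor_core (A : LieAlgebroid I F E) {k : ℕ} (j : Fin k)
    (e : Cₛ^∞⟮I; F, E⟯) (w : TangentSum M I k) :
    (A.tangentSumAnchor w ((LiftedSection.core j e).toSection w) :
      B × ((Fin k → ℝ) →L[ℝ] B)) = (0,
      homOfTuple B k (fun i => if i = j then (A.anchorField e w.proj : B) else 0)) := by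
  have h : ∀ i, A.anchorDeriv (0 : E w.proj) ((w.vec i : B),
      if i = j then fiberCoord F w.proj ⟨w.proj, e w.proj⟩ else 0) =
      if i = j then (A.anchorField e w.proj : B) else 0 := by
    intro i
    split_ifs
    · exact A.anchorDeriv_zero (e w.proj) (w.vec i)
    · refine Eq.trans ?_ (map_zero (A.anchor w.proj))
      refine Eq.trans ?_ (A.anchorDeriv_zero (0 : E w.proj) (w.vec i))
      rw [fiberCoord_zero (FiberBundle.mem_baseSet_trivializationAt' _)]
  rw [LiftedSection.core_toSection]
  exact Prod.ext (map_zero (A.anchor w.proj)) (congrArg (homOfTuple B k) (funext h))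

/-- Along the complete lift of ρ(e) the coefficients are differentiated along ρ(e), and each
argument is replaced by the derivative of ρ(e) in its direction; this is the coordinate formula for
the Lie derivative. -/
theorem LieAlgebroid.dirDeriv_tangentSumAnchor_tangent (A : LieAlgebroid I F E) {k m : ℕ}
    {α : FormField I M (m + 1)} (hα : α.IsSmooth) (τ : Fin (m + 1) → Fin k)
    (e : Cₛ^∞⟮I; F, E⟯) (w : TangentSum M I k) :
    dirDeriv (A.tangentSumAnchor w ((LiftedSection.tangent e).toSection w))
      (fun w' : TangentSum M I k => α w'.proj (fun i => w'.vec (τ i))) =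
    α.lieDeriv (A.anchorField e) w.proj (fun i => w.vec (τ i)) := by
  refine (TangentSum.dirDeriv_form_apply hα τ w _).trans ?_
  refine Eq.trans ?_ (FormField.lieDeriv_apply (A.isSmoothField_anchorField e) hα w.proj
    (fun i => w.vec (τ i))).symm
  rw [A.tangentSumAnchor_tangent e w]
  simp only [homOfTuple_single]

/-- A vertical derivative of a multilinear function replaces arguments one at a time; only those
reading the j-th vector can contribute. -/
theorem LieAlgebroid.dirDeriv_tangentSumAnchor_core (A : LieAlgebroid I F E) {k m : ℕ}
    {α : FormField I M m} (hα : α.IsSmooth) (τ : Fin m → Fin k) (j : Fin k)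
    (e : Cₛ^∞⟮I; F, E⟯) (w : TangentSum M I k) :
    dirDeriv (A.tangentSumAnchor w ((LiftedSection.core j e).toSection w))
      (fun w' : TangentSum M I k => α w'.proj (fun i => w'.vec (τ i))) =
    ∑ i, (α w.proj : B [⋀^Fin m]→L[ℝ] ℝ) (Function.update (fun i => w.vec (τ i)) i
      (if τ i = j then (A.anchorField e w.proj : B) else 0)) := by
  refine (TangentSum.dirDeriv_form_apply hα τ w _).trans ?_
  rw [A.tangentSumAnchor_core j e w]
  simp only [homOfTuple_single, map_zero]
  exact zero_add _

theorem sum_update_ite_apply {V : Type*} [NormedAddCommGroup V] [NormedSpace ℝ V] {k m : ℕ}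
    (α : V [⋀^Fin m]→L[ℝ] ℝ) (τ : Fin m → Fin k) (hτ : Function.Injective τ) (v : Fin m → V)
    (i₀ : Fin m) (a : V) :
    ∑ i, α (Function.update v i (if τ i = τ i₀ then a else 0)) = α (Function.update v i₀ a) := by
  rw [Finset.sum_eq_single i₀ (fun i _ hi => ?_) (by simp), if_pos rfl]
  rw [if_neg fun h => hi (hτ h)]
  exact α.map_coord_zero i (Function.update_self _ _ _)

theorem sum_update_ite_apply_of_notMem {V : Type*} [NormedAddCommGroup V] [NormedSpace ℝ V]
    {k m : ℕ} (α : V [⋀^Fin m]→L[ℝ] ℝ) (τ : Fin m → Fin k) (v : Fin m → V)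
    (j : Fin k) (hj : ∀ i, τ i ≠ j) (a : V) :
    ∑ i, α (Function.update v i (if τ i = j then a else 0)) = 0 := by
  refine Finset.sum_eq_zero fun i _ => ?_
  rw [if_neg (hj i)]
  exact α.map_coord_zero i (Function.update_self _ _ _)

variable (B) in
/-- The point of `T^{⊕k} M` with given vectors. -/
def TangentSum.mk {k : ℕ} (x : M) (v : Fin k → B) : TangentSum M I k := ⟨x, homOfTuple B k v⟩

theorem TangentSum.vec_mk {k : ℕ} (x : M) (v : Fin k → B) :
    (TangentSum.mk B x v : TangentSum M I k).vec = v :=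
  funext fun i => homOfTuple_single v i

/-- The pullback of a form on `E` along a section. -/
def FormField.alongSection {k : ℕ} (Ω : FormField (I.prod 𝓘(ℝ, F)) (TotalSpace F E) k)
    (e : Cₛ^∞⟮I; F, E⟯) : FormField I M k :=
  FormField.pullback (I := I) (fun y : M => (⟨y, e y⟩ : TotalSpace F E)) Ω

/-- The component `μ(e)` of a linear form. -/
def FormField.muSection {k : ℕ} (Ω : FormField (I.prod 𝓘(ℝ, F)) (TotalSpace F E) (k + 1))
    (e : Cₛ^∞⟮I; F, E⟯) : FormField I M k := fun x => muComp Ω x (e x)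

/-- The component `η(e)` of a linear form. -/
def FormField.etaSection {k : ℕ} (Ω : FormField (I.prod 𝓘(ℝ, F)) (TotalSpace F E) k)
    (e : Cₛ^∞⟮I; F, E⟯) : FormField I M k := fun x => etaComp Ω x (e x)

theorem FormField.IsSmooth.alongSection {k : ℕ}
    {Ω : FormField (I.prod 𝓘(ℝ, F)) (TotalSpace F E) k} (hΩ : Ω.IsSmooth) (e : Cₛ^∞⟮I; F, E⟯) :
    (Ω.alongSection e).IsSmooth := FormField.IsSmooth.pullback e.contMDiff hΩ

theorem FormField.IsSmooth.muSection {k : ℕ}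
    {Ω : FormField (I.prod 𝓘(ℝ, F)) (TotalSpace F E) (k + 1)} (hΩ : Ω.IsSmooth)
    (e : Cₛ^∞⟮I; F, E⟯) : (Ω.muSection e).IsSmooth := hΩ.coreContraction e

theorem FormField.IsSmooth.etaSection {k : ℕ}
    {Ω : FormField (I.prod 𝓘(ℝ, F)) (TotalSpace F E) k} (hΩ : Ω.IsSmooth)
    (e : Cₛ^∞⟮I; F, E⟯) : (Ω.etaSection e).IsSmooth := hΩ.d.coreContraction e

theorem alternating_update_eq {V : Type*} [NormedAddCommGroup V]
    [NormedSpace ℝ V] {k : ℕ} (α : V [⋀^Fin (k + 1)]→L[ℝ] ℝ) (w : Fin (k + 1) → V)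
    (i : Fin (k + 1)) (a : V) :
    α (Function.update w i a) = (-1 : ℝ) ^ (i : ℕ) * α.curryLeft a (fun l => w (i.succAbove l)) :=
  α.map_update_eq_cons w i a

section Brackets

variable (A : LieAlgebroid I F E) {k : ℕ}
  {Ω : FormField (I.prod 𝓘(ℝ, F)) (TotalSpace F E) (k + 1)}

theorem dirDeriv_tangent_evalForm_tangent (hΩ : Ω.IsSmooth) (e₁ e₂ : Cₛ^∞⟮I; F, E⟯)
    (w : TangentSum M I (k + 1)) :
    dirDeriv (A.tangentSumAnchor w ((LiftedSection.tangent e₁).toSection w))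
      (fun w' => evalForm Ω w' ((LiftedSection.tangent e₂).toSection w')) =
    (Ω.alongSection e₂).lieDeriv (A.anchorField e₁) w.proj w.vec := by
  rw [funext (evalForm_tangent Ω e₂)]
  exact A.dirDeriv_tangentSumAnchor_tangent (hΩ.alongSection e₂) id e₁ w

theorem dirDeriv_core_evalForm_tangent (hΩ : Ω.IsSmooth) (j : Fin (k + 1)) (e₁ e₂ : Cₛ^∞⟮I; F, E⟯)
    (w : TangentSum M I (k + 1)) :
    dirDeriv (A.tangentSumAnchor w ((LiftedSection.core j e₁).toSection w))
      (fun w' => evalForm Ω w' ((LiftedSection.tangent e₂).toSection w')) =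
    (-1 : ℝ) ^ (j : ℕ) * (Ω.alongSection e₂).interior (A.anchorField e₁) w.proj
      (fun i => w.vec (j.succAbove i)) := by
  rw [funext (evalForm_tangent Ω e₂)]
  refine (A.dirDeriv_tangentSumAnchor_core (hΩ.alongSection e₂) id j e₁ w).trans ?_
  refine (sum_update_ite_apply (V := B) _ id Function.injective_id _ j _).trans ?_
  exact alternating_update_eq (V := B) _ _ j _

theorem mdifferentiableAt_evalForm (hΩ : Ω.IsSmooth) (hl : IsLinearForm Ω)
    (s : LiftedSection I F E (k + 1)) (w : TangentSum M I (k + 1)) :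
    MDifferentiableAt (tangentSumModel I (k + 1)) 𝓘(ℝ, ℝ)
      (fun w' => evalForm Ω w' (s.toSection w')) w := by
  cases s with
  | tangent e =>
    rw [funext (evalForm_tangent Ω e)]
    exact TangentSum.mdifferentiableAt_form_apply (hΩ.alongSection e) id w
  | core j e =>
    rw [funext (evalForm_core hΩ hl j e)]
    exact (TangentSum.mdifferentiableAt_form_apply (hΩ.muSection e) j.succAbove w).const_smul
      ((-1 : ℝ) ^ (j : ℕ))

theorem dirDeriv_evalForm_core (hΩ : Ω.IsSmooth) (hl : IsLinearForm Ω) (j : Fin (k + 1))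
    (e : Cₛ^∞⟮I; F, E⟯) (w : TangentSum M I (k + 1)) (X : B × ((Fin (k + 1) → ℝ) →L[ℝ] B)) :
    dirDeriv (I := tangentSumModel I (k + 1)) (x := w) X
      (fun w' => evalForm Ω w' ((LiftedSection.core j e).toSection w')) =
    (-1 : ℝ) ^ (j : ℕ) * dirDeriv (I := tangentSumModel I (k + 1)) (x := w) X
      (fun w' => Ω.muSection e w'.proj (fun i => w'.vec (j.succAbove i))) := by
  have : IsManifold I 1 M := .of_le (n := ∞) (by simp)
  rw [funext (evalForm_core hΩ hl j e)]
  exact dirDeriv_const_mul (I := tangentSumModel I (k + 1)) _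
    (TangentSum.mdifferentiableAt_form_apply (hΩ.muSection e) j.succAbove w) X

/-- The value on a core lift in slot `j` does not involve the j-th vector, which is the only one
moved by the anchor of such a lift. This settles the case of equal slots. -/
theorem dirDeriv_core_evalForm_core_self (hΩ : Ω.IsSmooth) (hl : IsLinearForm Ω)
    (j : Fin (k + 1)) (e₁ e₂ : Cₛ^∞⟮I; F, E⟯) (w : TangentSum M I (k + 1)) :
    dirDeriv (A.tangentSumAnchor w ((LiftedSection.core j e₁).toSection w))
      (fun w' => evalForm Ω w' ((LiftedSection.core j e₂).toSection w')) = 0 := by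
  refine (dirDeriv_evalForm_core hΩ hl j e₂ w _).trans ?_
  refine mul_eq_zero_of_right _ ?_
  refine (A.dirDeriv_tangentSumAnchor_core (hΩ.muSection e₂) j.succAbove j e₁ w).trans ?_
  exact sum_update_ite_apply_of_notMem (V := B) _ _ _ _ (fun i => j.succAbove_ne i) _

end Brackets

section Brackets

variable (A : LieAlgebroid I F E) {k : ℕ}
  {Ω : FormField (I.prod 𝓘(ℝ, F)) (TotalSpace F E) (k + 2)}

theorem dirDeriv_tangent_evalForm_core (hΩ : Ω.IsSmooth) (hl : IsLinearForm Ω) (j : Fin (k + 2))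
    (e₁ e₂ : Cₛ^∞⟮I; F, E⟯) (w : TangentSum M I (k + 2)) :
    dirDeriv (A.tangentSumAnchor w ((LiftedSection.tangent e₁).toSection w))
      (fun w' => evalForm Ω w' ((LiftedSection.core j e₂).toSection w')) =
    (-1 : ℝ) ^ (j : ℕ) * (Ω.muSection e₂).lieDeriv (A.anchorField e₁) w.proj
      (fun i => w.vec (j.succAbove i)) := by
  refine (dirDeriv_evalForm_core hΩ hl j e₂ w _).trans ?_
  exact congrArg ((-1 : ℝ) ^ (j : ℕ) * ·)
    (A.dirDeriv_tangentSumAnchor_tangent (hΩ.muSection e₂) j.succAbove e₁ w)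

/-- After slot `j` is removed, slot `j.succAbove i` is argument `i` of μ. The signs (-1)^j and
(-1)^i come from bringing the two slots to the front. -/
theorem dirDeriv_core_evalForm_core (hΩ : Ω.IsSmooth) (hl : IsLinearForm Ω)
    (j : Fin (k + 2)) (i : Fin (k + 1)) (e₁ e₂ : Cₛ^∞⟮I; F, E⟯) (w : TangentSum M I (k + 2)) :
    dirDeriv (A.tangentSumAnchor w ((LiftedSection.core (j.succAbove i) e₁).toSection w))
      (fun w' => evalForm Ω w' ((LiftedSection.core j e₂).toSection w')) =
    (-1 : ℝ) ^ ((j : ℕ) + (i : ℕ)) * (Ω.muSection e₂).interior (A.anchorField e₁) w.proj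
      (fun l => w.vec (j.succAbove (i.succAbove l))) := by
  refine (dirDeriv_evalForm_core hΩ hl j e₂ w _).trans ?_
  rw [pow_add, mul_assoc]
  refine congrArg ((-1 : ℝ) ^ (j : ℕ) * ·) ?_
  refine (A.dirDeriv_tangentSumAnchor_core (hΩ.muSection e₂) j.succAbove _ e₁ w).trans ?_
  refine (sum_update_ite_apply (V := B) _ _ Fin.succAbove_right_injective _ i _).trans ?_
  exact alternating_update_eq (V := B) _ _ i _

end Brackets

end MorphicLifts

/-! ### Identities for the Lie derivative -/

section Calculus

variable {V H X : Type*} [NormedAddCommGroup V] [NormedSpace ℝ V] [TopologicalSpace H]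
  {I : ModelWithCorners ℝ V H} [TopologicalSpace X] [ChartedSpace H X] [I.Boundaryless]
  [IsManifold I ∞ X] [FiniteDimensional ℝ V]

theorem FormField.interior_add {k : ℕ} (v : ∀ x : X, TangentSpace I x)
    (Ω Ω' : FormField I X (k + 1)) :
    (Ω + Ω').interior v = Ω.interior v + Ω'.interior v :=
  FormField.ext fun _ _ => rfl

theorem FormField.lieDeriv_add {k : ℕ} {v : ∀ x : X, TangentSpace I x} (hv : IsSmoothField v)
    {Ω Ω' : FormField I X (k + 1)} (h : Ω.IsSmooth) (h' : Ω'.IsSmooth) :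
    (Ω + Ω').lieDeriv v = Ω.lieDeriv v + Ω'.lieDeriv v := by
  unfold FormField.lieDeriv
  rw [FormField.d_add h h', FormField.interior_add, FormField.interior_add,
    FormField.d_add (h.interior hv) (h'.interior hv)]
  abel

theorem FormField.interior_zero {k : ℕ} (v : ∀ x : X, TangentSpace I x) :
    (0 : FormField I X (k + 1)).interior v = 0 :=
  FormField.ext fun _ _ => rfl

/-- With Cartan's formula as definition, both sides reduce to d i_v dΩ because d² = 0. -/
theorem FormField.d_lieDeriv {k : ℕ} {v : ∀ x : X, TangentSpace I x} (hv : IsSmoothField v)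
    {Ω : FormField I X (k + 1)} (h : Ω.IsSmooth) : (Ω.lieDeriv v).d = Ω.d.lieDeriv v := by
  unfold FormField.lieDeriv
  rw [FormField.d_add (h.d.interior hv) (h.interior hv).d, FormField.d_d (h.interior hv),
    FormField.d_d h, FormField.interior_zero, add_zero, zero_add]

end Calculus

/-! ### Morphic forms and the IM equations -/

section Cocycles

variable {B H M : Type*} [NormedAddCommGroup B] [NormedSpace ℝ B] [TopologicalSpace H]
  {I : ModelWithCorners ℝ B H} [I.Boundaryless] [TopologicalSpace M] [ChartedSpace H M]
  {F : Type*} [NormedAddCommGroup F] [NormedSpace ℝ F]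
  {E : M → Type*} [TopologicalSpace (TotalSpace F E)] [∀ x, TopologicalSpace (E x)]
  [∀ x, AddCommGroup (E x)] [∀ x, Module ℝ (E x)] [FiberBundle F E] [VectorBundle ℝ F E]
  [IsManifold I ∞ M] [ContMDiffVectorBundle ∞ F E I]
  [FiniteDimensional ℝ B] [FiniteDimensional ℝ F]

/-- Polarization of [e, e] = 0 at e₁ + e₂. -/
theorem LieAlgebroid.bracket_swap (A : LieAlgebroid I F E) (e₁ e₂ : Cₛ^∞⟮I; F, E⟯) :
    A.bracket e₁ e₂ = -A.bracket e₂ e₁ := by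
  have h := A.bracket_self (e₁ + e₂)
  rw [A.bracket.map_add₂, map_add, map_add, A.bracket_self, A.bracket_self, zero_add,
    add_zero] at h
  exact eq_neg_of_add_eq_zero_left h

/-- The cocycle condition of a linear form on the generating sections. -/
def IsMorphicOnLifts {k : ℕ} (A : LieAlgebroid I F E)
    (Ω : FormField (I.prod 𝓘(ℝ, F)) (TotalSpace F E) k) : Prop :=
  ∀ (s t : LiftedSection I F E k) (w : TangentSum M I k),
    evalForm Ω w (A.liftBracket s t w) =
      dirDeriv (A.tangentSumAnchor w (s.toSection w)) (fun w' => evalForm Ω w' (t.toSection w'))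
      - dirDeriv (A.tangentSumAnchor w (t.toSection w)) (fun w' => evalForm Ω w' (s.toSection w'))

variable {n : ℕ} {A : LieAlgebroid I F E}
  {Ω : FormField (I.prod 𝓘(ℝ, F)) (TotalSpace F E) (n + 2)}

theorem coreContraction_neg {k : ℕ}
    (Ω : FormField (I.prod 𝓘(ℝ, F)) (TotalSpace F E) (k + 1)) (x : M) (e : E x) (b : Fin k → B) :
    (coreContraction Ω x (-e) : B [⋀^Fin k]→L[ℝ] ℝ) b =
      -(coreContraction Ω x e : B [⋀^Fin k]→L[ℝ] ℝ) b := by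
  have h : fiberCoord F x ⟨x, -e⟩ = -fiberCoord F x ⟨x, e⟩ := by
    have := fiberCoord_smul (F := F) (FiberBundle.mem_baseSet_trivializationAt' (F := F) (E := E) x)
      (-1 : ℝ) e
    simpa using this
  have h2 : ((0 : B), -fiberCoord F x ⟨x, e⟩) = (-1 : ℝ) • ((0 : B), fiberCoord F x ⟨x, e⟩) := by
    simp
  rw [coreContraction_apply, coreContraction_apply, h, h2]
  refine ((Ω ⟨x, 0⟩ : (B × F) [⋀^Fin (k + 1)]→L[ℝ] ℝ).cons_smul _ _ _).trans ?_
  exact neg_one_mul _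

theorem alongSection_eq (hΩ : Ω.IsSmooth) (hl : IsLinearForm Ω) (e : Cₛ^∞⟮I; F, E⟯) :
    Ω.alongSection e = (Ω.muSection e).d + Ω.etaSection e := hl.pullback_section hΩ e

/-- Core lifts commute, so the left side is zero, and the condition compares inserting ρ(e₁) into
μ(e₂) with inserting ρ(e₂) into μ(e₁). -/
theorem cocycle_core_core_iff (hΩ : Ω.IsSmooth) (hl : IsLinearForm Ω) (j : Fin (n + 2))
    (i : Fin (n + 1)) (e₁ e₂ : Cₛ^∞⟮I; F, E⟯) (w : TangentSum M I (n + 2)) :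
    evalForm Ω w (A.liftBracket (.core (j.succAbove i) e₁) (.core j e₂) w) =
      dirDeriv (A.tangentSumAnchor w ((LiftedSection.core (j.succAbove i) e₁).toSection w))
        (fun w' => evalForm Ω w' ((LiftedSection.core j e₂).toSection w'))
      - dirDeriv (A.tangentSumAnchor w ((LiftedSection.core j e₂).toSection w))
        (fun w' => evalForm Ω w' ((LiftedSection.core (j.succAbove i) e₁).toSection w')) ↔
    (Ω.muSection e₂).interior (A.anchorField e₁) w.proj
        (fun l => w.vec (j.succAbove (i.succAbove l))) =
      -(Ω.muSection e₁).interior (A.anchorField e₂) w.proj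
        (fun l => w.vec (j.succAbove (i.succAbove l))) := by
  have h0 : evalForm Ω w (A.liftBracket (.core (j.succAbove i) e₁) (.core j e₂) w) = 0 := by
    refine (evalForm_eq_evalFormₗ hΩ hl w _).trans ?_
    exact map_zero _
  have h1 := dirDeriv_core_evalForm_core A hΩ hl j i e₁ e₂ w
  -- The ordered pair of slots (`j`, `j.succAbove i`) is the swap of the first pair, and relative to
  -- `j.succAbove i` the slot `j` has index `i.predAbove j`. The remaining arguments are the same,
  -- while the parity of the exponent changes, hence the sign in the symmetry condition.
  have h2 := dirDeriv_core_evalForm_core A hΩ hl (j.succAbove i) (i.predAbove j) e₂ e₁ w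
  rw [Fin.succAbove_succAbove_predAbove] at h2
  simp only [Fin.succAbove_succAbove_succAbove_predAbove] at h2
  rw [Fin.neg_one_pow_succAbove_add_predAbove] at h2
  rw [h0, h1, h2]
  have hs : (-1 : ℝ) ^ ((j : ℕ) + (i : ℕ)) ≠ 0 := by simp
  have key : ∀ s a b : ℝ, s ≠ 0 → (0 = s * a - -s * b ↔ a = -b) := by
    intro s a b hs
    constructor
    · intro h
      have : s * (a + b) = 0 := by linarith
      have := (mul_eq_zero.mp this).resolve_left hs
      linarith
    · rintro rfl
      ring
  exact key _ _ _ hs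

/-- All three terms carry the common factor (-1)^j. The second IM equation appears with dμ(e₁) +
η(e₁) still combined as the pullback of Ω by `e₁`. -/
theorem cocycle_tangent_core_iff (hΩ : Ω.IsSmooth) (hl : IsLinearForm Ω) (j : Fin (n + 2))
    (e₁ e₂ : Cₛ^∞⟮I; F, E⟯) (w : TangentSum M I (n + 2)) :
    evalForm Ω w (A.liftBracket (.tangent e₁) (.core j e₂) w) =
      dirDeriv (A.tangentSumAnchor w ((LiftedSection.tangent e₁).toSection w))
        (fun w' => evalForm Ω w' ((LiftedSection.core j e₂).toSection w'))
      - dirDeriv (A.tangentSumAnchor w ((LiftedSection.core j e₂).toSection w))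
        (fun w' => evalForm Ω w' ((LiftedSection.tangent e₁).toSection w')) ↔
    Ω.muSection (A.bracket e₁ e₂) w.proj (fun l => w.vec (j.succAbove l)) =
      (Ω.muSection e₂).lieDeriv (A.anchorField e₁) w.proj (fun l => w.vec (j.succAbove l)) -
      (Ω.alongSection e₁).interior (A.anchorField e₂) w.proj
        (fun l => w.vec (j.succAbove l)) := by
  have h0 := evalForm_core hΩ hl j (A.bracket e₁ e₂) w
  rw [dirDeriv_tangent_evalForm_core A hΩ hl j e₁ e₂ w, dirDeriv_core_evalForm_tangent A hΩ j e₂ e₁ w]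
  have hs : (-1 : ℝ) ^ (j : ℕ) ≠ 0 := by simp
  have key : ∀ s a b c y : ℝ, s ≠ 0 → y = s * a → (y = s * b - s * c ↔ a = b - c) := by
    intro s a b c y hs hy
    rw [hy, ← mul_sub]
    exact mul_right_inj' hs
  exact key _ _ _ _ _ hs h0

/-- Gives nothing beyond the opposite order of lifts: [e₁, e₂] = -[e₂, e₁] and the right side is
antisymmetric as well. -/
theorem cocycle_core_tangent_iff (hΩ : Ω.IsSmooth) (hl : IsLinearForm Ω) (j : Fin (n + 2))
    (e₁ e₂ : Cₛ^∞⟮I; F, E⟯) (w : TangentSum M I (n + 2)) :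
    evalForm Ω w (A.liftBracket (.core j e₁) (.tangent e₂) w) =
      dirDeriv (A.tangentSumAnchor w ((LiftedSection.core j e₁).toSection w))
        (fun w' => evalForm Ω w' ((LiftedSection.tangent e₂).toSection w'))
      - dirDeriv (A.tangentSumAnchor w ((LiftedSection.tangent e₂).toSection w))
        (fun w' => evalForm Ω w' ((LiftedSection.core j e₁).toSection w')) ↔
    Ω.muSection (A.bracket e₂ e₁) w.proj (fun l => w.vec (j.succAbove l)) =
      (Ω.muSection e₁).lieDeriv (A.anchorField e₂) w.proj (fun l => w.vec (j.succAbove l)) -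
      (Ω.alongSection e₂).interior (A.anchorField e₁) w.proj
        (fun l => w.vec (j.succAbove l)) := by
  have h0 := evalForm_core hΩ hl j (A.bracket e₁ e₂) w
  have h3 : (Ω.muSection (A.bracket e₁ e₂) w.proj (fun l => w.vec (j.succAbove l)) : ℝ) =
      -Ω.muSection (A.bracket e₂ e₁) w.proj (fun l => w.vec (j.succAbove l)) := by
    rw [A.bracket_swap e₁ e₂]
    exact coreContraction_neg Ω w.proj _ _
  rw [dirDeriv_tangent_evalForm_core A hΩ hl j e₂ e₁ w, dirDeriv_core_evalForm_tangent A hΩ j e₁ e₂ w]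
  have hs : (-1 : ℝ) ^ (j : ℕ) ≠ 0 := by simp
  have key : ∀ s a a' b c y : ℝ, s ≠ 0 → y = s * a' → a' = -a →
      (y = s * b - s * c ↔ a = c - b) := by
    intro s a a' b c y hs hy ha
    rw [hy, ← mul_sub, mul_right_inj' hs, ha]
    constructor <;> intro h <;> linarith
  exact key _ _ _ _ _ _ hs h0 h3

theorem cocycle_tangent_tangent_iff (hΩ : Ω.IsSmooth) 
    (e₁ e₂ : Cₛ^∞⟮I; F, E⟯) (w : TangentSum M I (n + 2)) :
    evalForm Ω w (A.liftBracket (.tangent e₁) (.tangent e₂) w) =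
      dirDeriv (A.tangentSumAnchor w ((LiftedSection.tangent e₁).toSection w))
        (fun w' => evalForm Ω w' ((LiftedSection.tangent e₂).toSection w'))
      - dirDeriv (A.tangentSumAnchor w ((LiftedSection.tangent e₂).toSection w))
        (fun w' => evalForm Ω w' ((LiftedSection.tangent e₁).toSection w')) ↔
    Ω.alongSection (A.bracket e₁ e₂) w.proj w.vec =
      (Ω.alongSection e₂).lieDeriv (A.anchorField e₁) w.proj w.vec -
      (Ω.alongSection e₁).lieDeriv (A.anchorField e₂) w.proj w.vec := by
  rw [dirDeriv_tangent_evalForm_tangent A hΩ e₁ e₂ w,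
    dirDeriv_tangent_evalForm_tangent A hΩ e₂ e₁ w]
  exact Iff.of_eq (congrArg (· = _) (evalForm_tangent Ω (A.bracket e₁ e₂) w))

/-- Write α(e) = dμ(e) + η(e) for the pullback by a section, so that dα(e) = dη(e). The differential
of the second IM equation accounts for the exact parts on both sides of the tangent-tangent
condition, and what remains is the third IM equation. -/
theorem etaSection_bracket_iff (hΩ : Ω.IsSmooth) (hl : IsLinearForm Ω) (e₁ e₂ : Cₛ^∞⟮I; F, E⟯)
    (h : Ω.muSection (A.bracket e₁ e₂) = (Ω.muSection e₂).lieDeriv (A.anchorField e₁) -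
      (Ω.alongSection e₁).interior (A.anchorField e₂)) :
    Ω.alongSection (A.bracket e₁ e₂) = (Ω.alongSection e₂).lieDeriv (A.anchorField e₁) -
      (Ω.alongSection e₁).lieDeriv (A.anchorField e₂) ↔
    Ω.etaSection (A.bracket e₁ e₂) = (Ω.etaSection e₂).lieDeriv (A.anchorField e₁) -
      (Ω.etaSection e₁).d.interior (A.anchorField e₂) := by
  have hv := A.isSmoothField_anchorField e₁
  have hv' := A.isSmoothField_anchorField e₂
  have h1 : (Ω.alongSection e₁).d = (Ω.etaSection e₁).d := by
    rw [alongSection_eq hΩ hl, FormField.d_add (hΩ.muSection e₁).d (hΩ.etaSection e₁),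
      FormField.d_d (hΩ.muSection e₁), zero_add]
  have h2 : (Ω.alongSection e₂).lieDeriv (A.anchorField e₁) =
      ((Ω.muSection e₂).lieDeriv (A.anchorField e₁)).d +
        (Ω.etaSection e₂).lieDeriv (A.anchorField e₁) := by
    rw [FormField.d_lieDeriv hv (hΩ.muSection e₂), alongSection_eq hΩ hl,
      FormField.lieDeriv_add hv (hΩ.muSection e₂).d (hΩ.etaSection e₂)]
  have h3 : (Ω.alongSection e₁).lieDeriv (A.anchorField e₂) =
      (Ω.etaSection e₁).d.interior (A.anchorField e₂) +
        ((Ω.alongSection e₁).interior (A.anchorField e₂)).d := by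
    rw [← h1]; rfl
  rw [alongSection_eq hΩ hl (A.bracket e₁ e₂), h,
    FormField.d_sub ((hΩ.muSection e₂).lieDeriv hv) ((hΩ.alongSection e₁).interior hv'), h2, h3]
  have key : ∀ {G : Type _} [AddCommGroup G] (a b c d f : G),
      (a - b + c = a + d - (f + b) ↔ c = d - f) := by
    intro G _ a b c d f
    have e1 : a - b + c = (a - b) + c := rfl
    have e2 : a + d - (f + b) = (a - b) + (d - f) := by abel
    rw [e2]
    exact add_right_inj _
  exact key _ _ _ _ _

/-- Any tuple of vectors occurs as the subtuple selected by an injective τ: fill the other slots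
with zero. -/
theorem FormField.ext_vec {k : ℕ} {α β : FormField I M k} (τ : Fin k → Fin (n + 2))
    (hτ : Function.Injective τ)
    (h : ∀ w : TangentSum M I (n + 2), (α w.proj (fun i => w.vec (τ i)) : ℝ) =
      β w.proj (fun i => w.vec (τ i))) : α = β := by
  refine FormField.ext fun x v => ?_
  have hw := h (TangentSum.mk B x (Function.extend τ (v : Fin k → B) 0))
  rw [TangentSum.vec_mk] at hw
  have e : (fun i => Function.extend τ (v : Fin k → B) 0 (τ i)) = v :=
    funext fun i => hτ.extend_apply _ _ i
  exact (congrArg (α x : B [⋀^Fin k]→L[ℝ] ℝ) e).symm.trans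
    (hw.trans (congrArg (β x : B [⋀^Fin k]→L[ℝ] ℝ) e))

/-- Each type of pair of lifts gives one IM equation. In the forward direction slot 0 suffices; in
the converse all slots are needed, and two core lifts in the same slot give 0 = 0. -/
theorem isMorphicOnLifts_iff (hΩ : Ω.IsSmooth) (hl : IsLinearForm Ω) :
    IsMorphicOnLifts A Ω ↔ SatisfiesIM A (muComp Ω) (etaComp Ω) := by
  have eq2 : ∀ e₁ e₂ : Cₛ^∞⟮I; F, E⟯, ((Ω.muSection e₂).lieDeriv (A.anchorField e₁) -
      (Ω.alongSection e₁).interior (A.anchorField e₂)) =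
      (Ω.muSection e₂).lieDeriv (A.anchorField e₁)
        - (Ω.muSection e₁).d.interior (A.anchorField e₂)
        - (Ω.etaSection e₁).interior (A.anchorField e₂) := by
    intro e₁ e₂
    rw [alongSection_eq hΩ hl, FormField.interior_add, sub_sub]
  constructor
  · intro h
    have h2 : ∀ e₁ e₂ : Cₛ^∞⟮I; F, E⟯, Ω.muSection (A.bracket e₁ e₂) =
        (Ω.muSection e₂).lieDeriv (A.anchorField e₁) -
        (Ω.alongSection e₁).interior (A.anchorField e₂) := fun e₁ e₂ =>
      FormField.ext_vec (n := n) (0 : Fin (n + 2)).succAbove Fin.succAbove_right_injective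
        fun w => (cocycle_tangent_core_iff hΩ hl 0 e₁ e₂ w).mp (h _ _ w)
    refine ⟨fun e₁ e₂ => ?_, fun e₁ e₂ => (h2 e₁ e₂).trans (eq2 e₁ e₂), fun e₁ e₂ => ?_⟩
    · exact FormField.ext_vec (n := n) (fun l => (0 : Fin (n + 2)).succAbove
        ((0 : Fin (n + 1)).succAbove l))
        (Fin.succAbove_right_injective.comp Fin.succAbove_right_injective)
        fun w => (cocycle_core_core_iff hΩ hl 0 0 e₁ e₂ w).mp (h _ _ w)
    · refine (etaSection_bracket_iff hΩ hl e₁ e₂ (h2 e₁ e₂)).mp ?_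
      exact FormField.ext_vec (n := n) id Function.injective_id
        fun w => (cocycle_tangent_tangent_iff hΩ e₁ e₂ w).mp (h _ _ w)
  · intro h s t w
    have h2 : ∀ e₁ e₂ : Cₛ^∞⟮I; F, E⟯, Ω.muSection (A.bracket e₁ e₂) =
        (Ω.muSection e₂).lieDeriv (A.anchorField e₁) -
        (Ω.alongSection e₁).interior (A.anchorField e₂) := fun e₁ e₂ =>
      (h.eq₂ e₁ e₂).trans (eq2 e₁ e₂).symm
    cases s with
    | tangent e₁ =>
      cases t with
      | tangent e₂ =>
        refine (cocycle_tangent_tangent_iff hΩ e₁ e₂ w).mpr ?_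
        rw [(etaSection_bracket_iff hΩ hl e₁ e₂ (h2 e₁ e₂)).mpr (h.eq₃ e₁ e₂)]
        rfl
      | core j e₂ =>
        refine (cocycle_tangent_core_iff hΩ hl j e₁ e₂ w).mpr ?_
        rw [h2]
        rfl
    | core i e₁ =>
      cases t with
      | tangent e₂ =>
        refine (cocycle_core_tangent_iff hΩ hl i e₁ e₂ w).mpr ?_
        rw [h2]
        rfl
      | core j e₂ =>
        rcases eq_or_ne i j with rfl | hij
        · rw [dirDeriv_core_evalForm_core_self A hΩ hl, dirDeriv_core_evalForm_core_self A hΩ hl,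
            sub_zero]
          exact (evalForm_eq_evalFormₗ hΩ hl w _).trans (map_zero _)
        · obtain ⟨l, rfl⟩ := Fin.exists_succAbove_eq hij
          refine (cocycle_core_core_iff hΩ hl j l e₁ e₂ w).mpr ?_
          exact DFunLike.congr_fun (congrFun (h.eq₁ e₁ e₂) w.proj) _

theorem evalForm_combine {k m : ℕ} {Ω : FormField (I.prod 𝓘(ℝ, F)) (TotalSpace F E) k}
    (hΩ : Ω.IsSmooth) (hl : IsLinearForm Ω) (f : Fin m → TangentSum M I k → ℝ)
    (s : Fin m → LiftedSection I F E k) (w : TangentSum M I k) :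
    evalForm Ω w (combine f s w) = ∑ a, f a w * evalForm Ω w ((s a).toSection w) := by
  refine (evalForm_eq_evalFormₗ hΩ hl w _).trans ?_
  refine (map_sum (evalFormₗ Ω w) _ _).trans (Finset.sum_congr rfl fun a _ => ?_)
  refine (map_smul (evalFormₗ Ω w) _ _).trans ?_
  exact congrArg (f a w * ·) (evalForm_eq_evalFormₗ hΩ hl w _).symm

theorem dirDeriv_tangentSumAnchor_combine (A : LieAlgebroid I F E) {k m : ℕ}
    (f : Fin m → TangentSum M I k → ℝ)
    (s : Fin m → LiftedSection I F E k) (w : TangentSum M I k) (G : TangentSum M I k → ℝ) :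
    dirDeriv (A.tangentSumAnchor w (combine f s w)) G =
      ∑ a, f a w * dirDeriv (A.tangentSumAnchor w ((s a).toSection w)) G := by
  let L : B × ((Fin k → ℝ) →L[ℝ] B) →L[ℝ] ℝ := mfderiv (tangentSumModel I k) 𝓘(ℝ, ℝ) G w
  have h1 : A.tangentSumAnchorₗ w (combine f s w) =
      ∑ a, f a w • A.tangentSumAnchorₗ w ((s a).toSection w) := by
    refine (map_sum (A.tangentSumAnchorₗ w) _ _).trans (Finset.sum_congr rfl fun a _ => ?_)
    exact map_smul (A.tangentSumAnchorₗ w) _ _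
  refine (congrArg L h1).trans ?_
  rw [map_sum]
  exact Finset.sum_congr rfl fun a _ => map_smul L _ _

theorem dirDeriv_const {V H X : Type*} [NormedAddCommGroup V] [NormedSpace ℝ V]
    [TopologicalSpace H] {I : ModelWithCorners ℝ V H} [TopologicalSpace X] [ChartedSpace H X]
    {x : X} (v : TangentSpace I x) (c : ℝ) : dirDeriv v (fun _ : X => c) = 0 :=
  DFunLike.congr_fun (mfderiv_const (I := I) (I' := 𝓘(ℝ, ℝ)) (c := c) (x := x)) v

theorem evalForm_tangentSumBracket {k m n : ℕ} (A : LieAlgebroid I F E)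
    {Ω : FormField (I.prod 𝓘(ℝ, F)) (TotalSpace F E) k}
    (hΩ : Ω.IsSmooth) (hl : IsLinearForm Ω)
    (f : Fin m → TangentSum M I k → ℝ) (s : Fin m → LiftedSection I F E k)
    (g : Fin n → TangentSum M I k → ℝ) (t : Fin n → LiftedSection I F E k)
    (w : TangentSum M I k) :
    evalForm Ω w (A.tangentSumBracket f s g t w) =
      ∑ a, ∑ c, (f a w * g c w) * evalForm Ω w (A.liftBracket (s a) (t c) w)
      + ∑ c, dirDeriv (A.tangentSumAnchor w (combine f s w)) (g c) *
          evalForm Ω w ((t c).toSection w)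
      - ∑ a, dirDeriv (A.tangentSumAnchor w (combine g t w)) (f a) *
          evalForm Ω w ((s a).toSection w) := by
  simp only [evalForm_eq_evalFormₗ hΩ hl]
  have h : ∀ {W : Type _} [AddCommGroup W] [Module ℝ W] (L : W →ₗ[ℝ] ℝ) (p : Fin m → Fin n → ℝ)
      (u : Fin m → Fin n → W) (b : Fin n → ℝ) (v : Fin n → W) (b' : Fin m → ℝ) (v' : Fin m → W),
      L (∑ a, ∑ c, p a c • u a c + ∑ c, b c • v c - ∑ a, b' a • v' a) =
        ∑ a, ∑ c, p a c * L (u a c) + ∑ c, b c * L (v c) - ∑ a, b' a * L (v' a) := by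
    intro W _ _ L p u b v b' v'
    simp only [map_sub, map_add, map_sum, map_smul, smul_eq_mul]
  exact h (evalFormₗ Ω w) _ _ _ _ _ _

/-- One summand with constant coefficient 1 on each side: the terms differentiating coefficients
drop out. -/
theorem isMorphicOnLifts_of_isMorphic {k : ℕ} {A : LieAlgebroid I F E}
    {Ω : FormField (I.prod 𝓘(ℝ, F)) (TotalSpace F E) k}
    (hΩ : Ω.IsSmooth) (h : IsMorphic A Ω) : IsMorphicOnLifts A Ω := by
  intro s t w
  have hc := h.cocycle 1 1 (fun _ _ => 1) (fun _ => s) (fun _ _ => 1) (fun _ => t)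
    (fun _ => contMDiff_const) (fun _ => contMDiff_const) w
  rw [evalForm_tangentSumBracket A hΩ h.linear] at hc
  simp only [evalForm_combine hΩ h.linear, dirDeriv_tangentSumAnchor_combine,
    Finset.univ_unique, Finset.sum_singleton, one_mul, dirDeriv_const, zero_mul, add_zero,
    sub_zero] at hc
  exact hc

/-- By the Leibniz rule, differentiating ∑ g_c Ω(t_c) yields the derivatives of the coefficients,
which match the anchor terms of the bracket, and the derivatives of the values on lifts, which
combine with weights f_a g_c into the condition for pairs of lifts. -/
theorem isMorphic_of_isMorphicOnLifts {k : ℕ} {A : LieAlgebroid I F E}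
    {Ω : FormField (I.prod 𝓘(ℝ, F)) (TotalSpace F E) (k + 1)}
    (hΩ : Ω.IsSmooth) (hl : IsLinearForm Ω) (h : IsMorphicOnLifts A Ω) : IsMorphic A Ω := by
  have : IsManifold I 1 M := .of_le (n := ∞) (by simp)
  refine ⟨hl, fun m n f s g t hf hg w => ?_⟩
  rw [evalForm_tangentSumBracket A hΩ hl, funext (evalForm_combine hΩ hl g t),
    funext (evalForm_combine hΩ hl f s)]
  have h1 := dirDeriv_sum_mul (I := tangentSumModel I (k + 1)) Finset.univ (g := g) (x := w)
    (G := fun c w' => evalForm Ω w' ((t c).toSection w'))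
    (fun c => (hg c w).mdifferentiableAt (by simp))
    (fun c => mdifferentiableAt_evalForm hΩ hl (t c) w)
    (A.tangentSumAnchor w (combine f s w))
  have h2 := dirDeriv_sum_mul (I := tangentSumModel I (k + 1)) Finset.univ (g := f) (x := w)
    (G := fun c w' => evalForm Ω w' ((s c).toSection w'))
    (fun c => (hf c w).mdifferentiableAt (by simp))
    (fun c => mdifferentiableAt_evalForm hΩ hl (s c) w)
    (A.tangentSumAnchor w (combine g t w))
  refine Eq.trans ?_ (congrArg₂ (· - ·) h1 h2).symm
  simp only [Finset.sum_add_distrib, h _ _ w]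
  have e1 : ∑ c, g c w * dirDeriv (A.tangentSumAnchor w (combine f s w))
      (fun w' => evalForm Ω w' ((t c).toSection w')) = ∑ a, ∑ c, (f a w * g c w) *
        dirDeriv (A.tangentSumAnchor w ((s a).toSection w))
          (fun w' => evalForm Ω w' ((t c).toSection w')) := by
    rw [Finset.sum_comm]
    refine Finset.sum_congr rfl fun c _ => ?_
    rw [dirDeriv_tangentSumAnchor_combine, Finset.mul_sum]
    exact Finset.sum_congr rfl fun a _ => by ring
  have e2 : ∑ a, f a w * dirDeriv (A.tangentSumAnchor w (combine g t w))
      (fun w' => evalForm Ω w' ((s a).toSection w')) = ∑ a, ∑ c, (f a w * g c w) *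
        dirDeriv (A.tangentSumAnchor w ((t c).toSection w))
          (fun w' => evalForm Ω w' ((s a).toSection w')) := by
    refine Finset.sum_congr rfl fun a _ => ?_
    rw [dirDeriv_tangentSumAnchor_combine, Finset.mul_sum]
    exact Finset.sum_congr rfl fun c _ => by ring
  simp only [mul_sub, Finset.sum_sub_distrib, ← e1, ← e2]
  exact (fun a b c d : ℝ => by ring : ∀ a b c d : ℝ, a - b + c - d = c + a - (d + b)) _ _ _ _

/-- A smooth linear form is morphic if and only if its components satisfy the IM equations. -/
theorem isMorphic_iff (hΩ : Ω.IsSmooth) (hl : IsLinearForm Ω) :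
    IsMorphic A Ω ↔ SatisfiesIM A (muComp Ω) (etaComp Ω) :=
  ⟨fun h => (isMorphicOnLifts_iff hΩ hl).mp (isMorphicOnLifts_of_isMorphic hΩ h),
    fun h => isMorphic_of_isMorphicOnLifts hΩ hl ((isMorphicOnLifts_iff hΩ hl).mpr h)⟩

end Cocycles

/-! ### Local sections of submersions and descent of smooth maps -/

section Submersions

variable {V H X : Type*} [NormedAddCommGroup V] [NormedSpace ℝ V] [TopologicalSpace H]
  {I : ModelWithCorners ℝ V H} [TopologicalSpace X] [ChartedSpace H X] [I.Boundaryless]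
  {V' H' X' : Type*} [NormedAddCommGroup V'] [NormedSpace ℝ V']
  [TopologicalSpace H'] {I' : ModelWithCorners ℝ V' H'} [I'.Boundaryless] [TopologicalSpace X']
  [ChartedSpace H' X'] [IsManifold I ∞ X] [IsManifold I' ∞ X']
  [FiniteDimensional ℝ V] [FiniteDimensional ℝ V']

/-- A submersion has smooth local sections. -/
theorem exists_local_section {f : X → X'} {x : X} (hf : ∀ᶠ z in nhds x, ContMDiffAt I I' ∞ f z)
    (hs : Function.Surjective (mfderiv I I' f x)) :
    ∃ s : X' → X, (∀ᶠ y in nhds (f x), ContMDiffAt I' I ∞ s y) ∧ s (f x) = x ∧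
      ∀ᶠ y in nhds (f x), f (s y) = y := by
  have : IsManifold I 1 X := .of_le (n := ∞) (by simp)
  have : IsManifold I' 1 X' := .of_le (n := ∞) (by simp)
  have hxx := extChartAt_to_inv (I := I) x
  have hcev : ∀ᶠ z in nhds (extChartAt I x x),
      ContDiffAt ℝ ∞ (writtenInExtChartAt I I' x f) z := by
    have hcont : ContinuousAt (extChartAt I x).symm (extChartAt I x x) :=
      continuousAt_extChartAt_symm x
    rw [ContinuousAt, hxx] at hcont
    filter_upwards [hcont.eventually hf, eventually_mem_extChartAt_target (mem_extChartAt_target x),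
      hcont.eventually (hf.self_of_nhds.continuousAt.eventually_mem
        ((isOpen_extChartAt_source (I := I') (f x)).mem_nhds (mem_extChartAt_source _)))]
      with z hz1 hz2 hz3
    rw [← contMDiffAt_iff_contDiffAt]
    refine ContMDiffAt.comp (I' := I') (g := extChartAt I' (f x)) z
      (contMDiffAt_extChartAt' (by rwa [extChartAt_source] at hz3)) ?_
    exact ContMDiffAt.comp (I' := I) (g := f) z hz1 (contMDiffAt_extChartAt_symm hz2)
  have hc := hcev.self_of_nhds
  have hfx := hf.self_of_nhds
  have hd : ∀ v : V, fderiv ℝ (writtenInExtChartAt I I' x f) (extChartAt I x x) v =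
      (mfderiv I I' f x v : V') := by
    intro v
    have h : mfderiv I I' f x = fderivWithin ℝ (writtenInExtChartAt I I' x f) (Set.range I)
        (extChartAt I x x) := if_pos (hfx.mdifferentiableAt (by simp))
    have e : ∀ s : Set V, s = Set.univ → fderivWithin ℝ (writtenInExtChartAt I I' x f) s
        (extChartAt I x x) = fderiv ℝ (writtenInExtChartAt I I' x f) (extChartAt I x x) := by
      rintro s rfl; rw [fderivWithin_univ]
    exact (DFunLike.congr_fun (h.trans (e _ I.range_eq_univ)) v).symm
  obtain ⟨K, Θ, κ, -, hΘx, -, -, hfΘ, -, hΘev⟩ := exists_submersion_coordinates hc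
    (fun v' => (hs v').imp fun v hv => (hd v).trans hv)
  have hw : writtenInExtChartAt I I' x f (extChartAt I x x) = extChartAt I' (f x) (f x) := by
    rw [writtenInExtChartAt, Function.comp_apply, Function.comp_apply, hxx]
  have hΘ := hΘev hcev
  rw [hw] at hΘ hΘx hfΘ
  set y₀ := extChartAt I' (f x) (f x) with hy₀
  have hι : ContDiffAt ℝ ∞ (fun z : V' => (z, (0 : K))) y₀ := contDiffAt_id.prodMk contDiffAt_const
  -- The section is z ↦ Θ(z, 0) in charts. Smoothness is needed at all nearby points, because the
  -- section is later composed with maps defined on a neighbourhood.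
  have hσ : ∀ᶠ z in nhds y₀, ContDiffAt ℝ ∞ (fun z : V' => Θ (z, 0)) z :=
    (hι.continuousAt.eventually hΘ).mono fun z hz =>
      ContDiffAt.comp (g := Θ) z hz (contDiffAt_id.prodMk contDiffAt_const)
  have hev : ∀ᶠ z in nhds y₀, writtenInExtChartAt I I' x f (Θ (z, 0)) = z :=
    hι.continuousAt.eventually hfΘ
  have hφ : ContMDiffAt I' 𝓘(ℝ, V') ∞ (extChartAt I' (f x)) (f x) := contMDiffAt_extChartAt
  have hτ : ContMDiffAt I' 𝓘(ℝ, V) ∞ (fun y => Θ (extChartAt I' (f x) y, 0)) (f x) :=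
    ContMDiffAt.comp (I' := 𝓘(ℝ, V')) (g := fun z => Θ (z, 0)) (f x) hσ.self_of_nhds.contMDiffAt hφ
  have hy : Θ (y₀, 0) ∈ (extChartAt I x).target := by rw [hΘx]; exact mem_extChartAt_target x
  refine ⟨fun y => (extChartAt I x).symm (Θ (extChartAt I' (f x) y, 0)), ?_, ?_, ?_⟩
  · filter_upwards [hφ.continuousAt.eventually hσ, hτ.continuousAt.eventually_mem
      (extChartAt_target_mem_nhds_of_mem hy), (isOpen_extChartAt_source (I := I') (f x)).mem_nhds
      (mem_extChartAt_source _)] with y hy1 hy2 hy3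
    refine ContMDiffAt.comp (I' := 𝓘(ℝ, V)) (g := (extChartAt I x).symm) y
      (contMDiffAt_extChartAt_symm hy2) ?_
    exact ContMDiffAt.comp (I' := 𝓘(ℝ, V')) (g := fun z => Θ (z, 0)) y hy1.contMDiffAt
      (contMDiffAt_extChartAt' (by rwa [extChartAt_source] at hy3))
  · change (extChartAt I x).symm (Θ (y₀, 0)) = x
    rw [hΘx, hxx]
  · have hs' : ContinuousAt (fun y => (extChartAt I x).symm (Θ (extChartAt I' (f x) y, 0)))
        (f x) := ContinuousAt.comp (g := (extChartAt I x).symm)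
          (contMDiffAt_extChartAt_symm (I := I) hy).continuousAt hτ.continuousAt
    have hfs : ContinuousAt (fun y => f ((extChartAt I x).symm (Θ (extChartAt I' (f x) y, 0))))
        (f x) := by
      refine ContinuousAt.comp (g := f) ?_ hs'
      change ContinuousAt f ((extChartAt I x).symm (Θ (y₀, 0)))
      rw [hΘx, hxx]
      exact hfx.continuousAt
    have h0 : f ((extChartAt I x).symm (Θ (extChartAt I' (f x) (f x), 0))) = f x := by
      change f ((extChartAt I x).symm (Θ (y₀, 0))) = f x
      rw [hΘx, hxx]
    have h1 := hfs.eventually_mem (s := (extChartAt I' (f x)).source)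
      (by rw [h0]; exact (isOpen_extChartAt_source _).mem_nhds (mem_extChartAt_source _))
    have h2 := hφ.continuousAt.eventually hev
    filter_upwards [h1, h2, (isOpen_extChartAt_source (I := I') (f x)).mem_nhds
      (mem_extChartAt_source _)] with y hy1 hy2 hy3
    exact (extChartAt I' (f x)).injOn hy1 hy3 hy2

/-- A map out of the target of a surjective submersion is smooth if its composition with the
submersion is. -/
theorem ContMDiff.of_comp_submersion {V'' H'' X'' : Type*} [NormedAddCommGroup V'']
    [NormedSpace ℝ V''] [TopologicalSpace H''] {I'' : ModelWithCorners ℝ V'' H''}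
    [TopologicalSpace X''] [ChartedSpace H'' X''] {f : X → X'} (hf : ContMDiff I I' ∞ f)
    (hsurj : Function.Surjective f) (hs : ∀ x, Function.Surjective (mfderiv I I' f x))
    {g : X' → X''} (hg : ContMDiff I I'' ∞ (fun x => g (f x))) : ContMDiff I' I'' ∞ g := by
  intro y
  obtain ⟨x, rfl⟩ := hsurj y
  obtain ⟨s, hsc, hsx, hfs⟩ := exists_local_section (.of_forall hf) (hs x)
  have h : ContMDiffAt I' I'' ∞ (fun y => g (f (s y))) (f x) :=
    ContMDiffAt.comp (I' := I) (g := fun x => g (f x)) (f x) (hg _) hsc.self_of_nhds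
  refine h.congr_of_eventuallyEq ?_
  filter_upwards [hfs] with y hy
  rw [hy]

end Submersions

/-! ### The differential of a vector bundle morphism -/

section TotalMap

variable {B H M : Type*} [NormedAddCommGroup B] [NormedSpace ℝ B] [TopologicalSpace H]
  {I : ModelWithCorners ℝ B H} [I.Boundaryless] [TopologicalSpace M] [ChartedSpace H M]
  {F : Type*} [NormedAddCommGroup F] [NormedSpace ℝ F]
  {E : M → Type*} [TopologicalSpace (TotalSpace F E)] [∀ x, TopologicalSpace (E x)]
  [∀ x, AddCommGroup (E x)] [∀ x, Module ℝ (E x)] [FiberBundle F E] [VectorBundle ℝ F E]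
  [IsManifold I ∞ M] [ContMDiffVectorBundle ∞ F E I]
  {B' H' M' : Type*} [NormedAddCommGroup B'] [NormedSpace ℝ B'] [TopologicalSpace H']
  {I' : ModelWithCorners ℝ B' H'} [I'.Boundaryless] [TopologicalSpace M'] [ChartedSpace H' M']
  {F' : Type*} [NormedAddCommGroup F'] [NormedSpace ℝ F']
  {E' : M' → Type*} [TopologicalSpace (TotalSpace F' E')] [∀ x, TopologicalSpace (E' x)]
  [∀ x, AddCommGroup (E' x)] [∀ x, Module ℝ (E' x)] [FiberBundle F' E'] [VectorBundle ℝ F' E']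
  [IsManifold I' ∞ M'] [ContMDiffVectorBundle ∞ F' E' I']

theorem contMDiff_add_smul_vector {x : M} (e a : E x) :
    ContMDiff 𝓘(ℝ, ℝ) (I.prod 𝓘(ℝ, F)) ∞ (fun t : ℝ => (⟨x, e + t • a⟩ : TotalSpace F E)) := by
  intro t
  refine Bundle.contMDiffAt_totalSpace.mpr ⟨contMDiffAt_const, ?_⟩
  refine ContMDiffAt.congr_of_eventuallyEq
    (f := fun t : ℝ => fiberCoord F x ⟨x, e⟩ + t • fiberCoord F x ⟨x, a⟩)
    (contMDiffAt_const.add (contMDiffAt_id.smul contMDiffAt_const)) (.of_forall fun s => ?_)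
  have hb := FiberBundle.mem_baseSet_trivializationAt' (F := F) (E := E) x
  exact (fiberCoord_add hb e (s • a)).trans (congrArg (_ + ·) (fiberCoord_smul hb s a))

theorem mfderiv_add_smul_vector {x : M} (e a : E x) :
    (mfderiv 𝓘(ℝ, ℝ) (I.prod 𝓘(ℝ, F)) (fun t : ℝ => (⟨x, e + t • a⟩ : TotalSpace F E)) 0
      (1 : ℝ) : B × F) = (0, fiberCoord F x ⟨x, a⟩) := by
  refine (mfderiv_totalSpace_apply
    ((contMDiff_add_smul_vector (I := I) (F := F) e a (0 : ℝ)).mdifferentiableAt (by simp))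
    (1 : ℝ)).trans ?_
  refine Prod.ext ?_ ?_
  · exact DFunLike.congr_fun (mfderiv_const (I := 𝓘(ℝ, ℝ)) (I' := I) (c := x) (x := (0 : ℝ)))
      (1 : ℝ)
  have hb := FiberBundle.mem_baseSet_trivializationAt' (F := F) (E := E) x
  have e1 : (fun t : ℝ => fiberCoord F x (⟨x, e + t • a⟩ : TotalSpace F E)) =
      fun t => fiberCoord F x ⟨x, e⟩ + t • fiberCoord F x ⟨x, a⟩ :=
    funext fun s => (fiberCoord_add hb e (s • a)).trans (congrArg (_ + ·) (fiberCoord_smul hb s a))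
  have e2 : HasFDerivAt (fun t : ℝ => fiberCoord F x ⟨x, e⟩ + t • fiberCoord F x ⟨x, a⟩)
      ((ContinuousLinearMap.id ℝ ℝ).smulRight (fiberCoord F x ⟨x, a⟩)) 0 :=
    ((hasFDerivAt_id (𝕜 := ℝ) (0 : ℝ)).smul_const _).const_add _
  have e3 := congrArg (fun f : ℝ → F => (mfderiv 𝓘(ℝ, ℝ) 𝓘(ℝ, F) f 0 : ℝ →L[ℝ] F) 1) e1
  refine Eq.trans e3 ?_
  rw [mfderiv_eq_fderiv, e2.fderiv]
  exact one_smul ℝ _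

/-- The derivative in vertical directions of a function which is affine on a fibre. -/
theorem mfderiv_vertical_apply {G : Type*} [NormedAddCommGroup G] [NormedSpace ℝ G]
    {g : TotalSpace F E → G} {x : M} (e a : E x)
    (hg : MDifferentiableAt (I.prod 𝓘(ℝ, F)) 𝓘(ℝ, G) g ⟨x, e⟩) (c : G)
    (hc : ∀ t : ℝ, g ⟨x, e + t • a⟩ = g ⟨x, e⟩ + t • c) :
    (mfderiv (I.prod 𝓘(ℝ, F)) 𝓘(ℝ, G) g ⟨x, e⟩ ((0, fiberCoord F x ⟨x, a⟩) : B × F) : G) = c := by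
  have h0 : (⟨x, e + (0 : ℝ) • a⟩ : TotalSpace F E) = ⟨x, e⟩ := by simp
  have h := mfderiv_comp_of_eq (I := 𝓘(ℝ, ℝ)) (I' := I.prod 𝓘(ℝ, F)) (I'' := 𝓘(ℝ, G))
    (f := fun t : ℝ => (⟨x, e + t • a⟩ : TotalSpace F E)) (x := (0 : ℝ)) hg
    ((contMDiff_add_smul_vector (I := I) (F := F) e a (0 : ℝ)).mdifferentiableAt (by simp)) h0
  have e1 : g ∘ (fun t : ℝ => (⟨x, e + t • a⟩ : TotalSpace F E)) =
      fun t => g ⟨x, e⟩ + t • c := funext hc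
  have e2 : HasFDerivAt (fun t : ℝ => g ⟨x, e⟩ + t • c)
      ((ContinuousLinearMap.id ℝ ℝ).smulRight c) 0 :=
    ((hasFDerivAt_id (𝕜 := ℝ) (0 : ℝ)).smul_const _).const_add _
  have h1 := DFunLike.congr_fun h (1 : ℝ)
  have h2 : (mfderiv 𝓘(ℝ, ℝ) 𝓘(ℝ, G)
      (g ∘ (fun t : ℝ => (⟨x, e + t • a⟩ : TotalSpace F E))) 0 : ℝ →L[ℝ] G) 1 = c := by
    rw [e1, mfderiv_eq_fderiv, e2.fderiv]
    exact one_smul ℝ _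
  refine Eq.trans ?_ (h1.symm.trans h2)
  refine (congrArg (mfderiv (I.prod 𝓘(ℝ, F)) 𝓘(ℝ, G) g ⟨x, e⟩ : B × F →L[ℝ] G)
    (mfderiv_add_smul_vector (I := I) e a).symm).trans ?_
  exact congrArg (fun p => (mfderiv (I.prod 𝓘(ℝ, F)) 𝓘(ℝ, G) g p : B × F →L[ℝ] G)
    (mfderiv 𝓘(ℝ, ℝ) (I.prod 𝓘(ℝ, F)) (fun t : ℝ => (⟨x, e + t • a⟩ : TotalSpace F E)) 0
      (1 : ℝ) : B × F)) h0.symm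

variable {qM : M → M'} {q : ∀ x, E x →ₗ[ℝ] E' (qM x)}

theorem contMDiffAt_fiberCoord_totalMap
    (hE : ContMDiff (I.prod 𝓘(ℝ, F)) (I'.prod 𝓘(ℝ, F')) ∞
      (totalMap qM q : TotalSpace F E → TotalSpace F' E')) (p : TotalSpace F E) :
    ContMDiffAt (I.prod 𝓘(ℝ, F)) 𝓘(ℝ, F') ∞
      (fun p' : TotalSpace F E => fiberCoord F' (qM p.proj) (totalMap qM q p' : TotalSpace F' E')) p :=
  (Bundle.contMDiffAt_totalSpace.mp (hE p)).2

/-- On the line e + t a the fibre coordinate of the image is affine in t with slope the coordinate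
of q(a), as q is linear on fibres. -/
theorem mfderiv_fiberCoord_totalMap_vertical
    (hE : ContMDiff (I.prod 𝓘(ℝ, F)) (I'.prod 𝓘(ℝ, F')) ∞
      (totalMap qM q : TotalSpace F E → TotalSpace F' E')) {x : M} (e a : E x) :
    (mfderiv (I.prod 𝓘(ℝ, F)) 𝓘(ℝ, F')
      (fun p' : TotalSpace F E => fiberCoord F' (qM x) (totalMap qM q p' : TotalSpace F' E')) ⟨x, e⟩
      ((0, fiberCoord F x ⟨x, a⟩) : B × F) : F') = fiberCoord F' (qM x) ⟨qM x, q x a⟩ := by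
  refine mfderiv_vertical_apply (I := I) (F := F)
    (g := fun p' : TotalSpace F E => fiberCoord F' (qM x) (totalMap qM q p' : TotalSpace F' E')) e a
    ((contMDiffAt_fiberCoord_totalMap hE ⟨x, e⟩).mdifferentiableAt (by simp)) _ fun t => ?_
  have hb := FiberBundle.mem_baseSet_trivializationAt' (F := F') (E := E') (qM x)
  change fiberCoord F' (qM x) ⟨qM x, q x (e + t • a)⟩ = fiberCoord F' (qM x) ⟨qM x, q x e⟩ + _
  rw [map_add, map_smul, fiberCoord_add hb, fiberCoord_smul hb]

theorem mfderiv_totalMap_apply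
    (hE : ContMDiff (I.prod 𝓘(ℝ, F)) (I'.prod 𝓘(ℝ, F')) ∞
      (totalMap qM q : TotalSpace F E → TotalSpace F' E')) (hM : ContMDiff I I' ∞ qM)
    (p : TotalSpace F E) (W : B × F) :
    (mfderiv (I.prod 𝓘(ℝ, F)) (I'.prod 𝓘(ℝ, F'))
      (totalMap qM q : TotalSpace F E → TotalSpace F' E') p W : B' × F') =
      ((mfderiv I I' qM p.proj W.1 : B'), (mfderiv (I.prod 𝓘(ℝ, F)) 𝓘(ℝ, F')
      (fun p' : TotalSpace F E => fiberCoord F' (qM p.proj) (totalMap qM q p' : TotalSpace F' E')) p W : F')) := by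
  refine (mfderiv_totalSpace_apply ((hE p).mdifferentiableAt (by simp)) W).trans ?_
  refine Prod.ext ?_ rfl
  have h := mfderiv_comp (I := I.prod 𝓘(ℝ, F)) (I' := I) (I'' := I')
    (f := fun p : TotalSpace F E => p.proj) p ((hM p.proj).mdifferentiableAt (by simp))
    ((Bundle.contMDiff_proj (n := ∞) E p).mdifferentiableAt (by simp))
  refine (DFunLike.congr_fun h W).trans ?_
  exact congrArg (mfderiv I I' qM p.proj : B →L[ℝ] B') (mfderiv_totalSpace_proj_apply p W)

theorem mfderiv_totalMap_vertical
    (hE : ContMDiff (I.prod 𝓘(ℝ, F)) (I'.prod 𝓘(ℝ, F')) ∞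
      (totalMap qM q : TotalSpace F E → TotalSpace F' E')) (hM : ContMDiff I I' ∞ qM)
    {x : M} (e a : E x) :
    (mfderiv (I.prod 𝓘(ℝ, F)) (I'.prod 𝓘(ℝ, F'))
      (totalMap qM q : TotalSpace F E → TotalSpace F' E') ⟨x, e⟩
      ((0, fiberCoord F x ⟨x, a⟩) : B × F) : B' × F') =
      (0, fiberCoord F' (qM x) ⟨qM x, q x a⟩) :=
  (mfderiv_totalMap_apply hE hM ⟨x, e⟩ _).trans
    (Prod.ext (map_zero (mfderiv I I' qM x : B →L[ℝ] B'))
      (mfderiv_fiberCoord_totalMap_vertical hE e a))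

theorem exists_fiberCoord_eq (x : M) (u : F) : ∃ a : E x, fiberCoord F x ⟨x, a⟩ = u := by
  refine ⟨(trivializationAt F E x).symm x u, ?_⟩
  rw [fiberCoord, (trivializationAt F E x).apply_mk_symm
    (FiberBundle.mem_baseSet_trivializationAt' _)]

theorem fiberCoord_injective (x : M) {a a' : E x}
    (h : fiberCoord F x ⟨x, a⟩ = fiberCoord F x ⟨x, a'⟩) : a = a' := by
  have hb := FiberBundle.mem_baseSet_trivializationAt' (F := F) (E := E) x
  have h1 := (trivializationAt F E x).symm_apply_apply_mk hb a
  have h2 := (trivializationAt F E x).symm_apply_apply_mk hb a'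
  rw [← h1, ← h2]
  exact congrArg ((trivializationAt F E x).symm x) h

/-- The differential is block triangular: base vectors lift since q_M is a submersion, and the error
in the fibre component is corrected by a vertical vector since q is fibrewise surjective. -/
theorem IsSimpleQuotient.submersion_total (hq : IsSimpleQuotient I F I' F' qM q)
    (p : TotalSpace F E) : Function.Surjective (mfderiv (I.prod 𝓘(ℝ, F)) (I'.prod 𝓘(ℝ, F'))
      (totalMap qM q : TotalSpace F E → TotalSpace F' E') p) := by
  obtain ⟨x, e⟩ := p
  let D : B × F →L[ℝ] B' × F' := mfderiv (I.prod 𝓘(ℝ, F)) (I'.prod 𝓘(ℝ, F'))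
    (totalMap qM q : TotalSpace F E → TotalSpace F' E') ⟨x, e⟩
  have hD : Function.Surjective D := by
    rintro ⟨b', a'⟩
    obtain ⟨b, hb⟩ : ∃ b : B, (mfderiv I I' qM x b : B') = b' := hq.submersion_base x b'
    obtain ⟨c', hc'⟩ := exists_fiberCoord_eq (E := E') (qM x) (a' - (D (b, 0)).2)
    obtain ⟨a, ha⟩ := hq.surjective_fiber x c'
    refine ⟨(b, fiberCoord F x ⟨x, a⟩), ?_⟩
    have e1 : (b, fiberCoord F x ⟨x, a⟩) = (b, 0) + (0, fiberCoord F x ⟨x, a⟩) := by simp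
    have e2 : D (0, fiberCoord F x ⟨x, a⟩) = (0, a' - (D (b, 0)).2) :=
      (mfderiv_totalMap_vertical hq.contMDiff_total hq.contMDiff_base e a).trans
        (by rw [ha, hc'])
    have e3 : (D (b, 0)).1 = b' := (congrArg Prod.fst
      (mfderiv_totalMap_apply hq.contMDiff_total hq.contMDiff_base ⟨x, e⟩ (b, 0))).trans hb
    rw [e1, map_add, e2]
    exact Prod.ext (by simp [e3]) (by simp)
  exact hD

theorem IsSimpleQuotient.surjective_total (hq : IsSimpleQuotient I F I' F' qM q) :
    Function.Surjective (totalMap qM q : TotalSpace F E → TotalSpace F' E') := by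
  rintro ⟨y, e'⟩
  obtain ⟨x, rfl⟩ := hq.surjective_base y
  obtain ⟨e, rfl⟩ := hq.surjective_fiber x e'
  exact ⟨⟨x, e⟩, rfl⟩

end TotalMap

/-! ### Lifting sections, and connectedness of the fibres on the total space -/

section Lifts

variable {B H M : Type*} [NormedAddCommGroup B] [NormedSpace ℝ B] [TopologicalSpace H]
  {I : ModelWithCorners ℝ B H} [I.Boundaryless] [TopologicalSpace M] [ChartedSpace H M]
  {F : Type*} [NormedAddCommGroup F] [NormedSpace ℝ F]
  {E : M → Type*} [TopologicalSpace (TotalSpace F E)] [∀ x, TopologicalSpace (E x)]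
  [∀ x, AddCommGroup (E x)] [∀ x, Module ℝ (E x)] [FiberBundle F E] [VectorBundle ℝ F E]
  [IsManifold I ∞ M] [ContMDiffVectorBundle ∞ F E I]
  [FiniteDimensional ℝ B] [FiniteDimensional ℝ F]

theorem contMDiffAt_of_fiberCoord_eq {e : ∀ x, E x} {x : M} {s : M → TotalSpace F E}
    (hs : ContMDiffAt I (I.prod 𝓘(ℝ, F)) ∞ s x) (h : ∀ᶠ y in nhds x, s y = ⟨y, e y⟩) :
    ContMDiffAt I (I.prod 𝓘(ℝ, F)) ∞ (fun y => (⟨y, e y⟩ : TotalSpace F E)) x :=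
  hs.congr_of_eventuallyEq (h.mono fun _ hy => hy.symm)

/-- There is a smooth section through every vector. -/
theorem exists_section_through [T2Space M] [SigmaCompactSpace M] (x : M) (e : E x) :
    ∃ s : Cₛ^∞⟮I; F, E⟯, s x = e := by
  classical
  -- The convex condition prescribes the value over `x` and is empty elsewhere. Local solutions are
  -- constant in a trivialization, on neighbourhoods that avoid `x` unless centred at it.
  obtain ⟨s, hs⟩ := exists_contMDiffSection_forall_mem_convex_of_local (n := (⊤ : ℕ∞)) I
    (F_fiber := F) E (fun y => {v | ∀ h : x = y, v = h ▸ e}) (fun y v hv v' hv' a b _ _ hab => by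
      rintro rfl
      rw [hv rfl, hv' rfl, ← add_smul, hab, one_smul]) (fun x₀ => by
      let t := trivializationAt F E x₀
      refine ⟨t.baseSet ∩ (if x = x₀ then Set.univ else {x}ᶜ), Filter.inter_mem
        (t.open_baseSet.mem_nhds (FiberBundle.mem_baseSet_trivializationAt' _)) ?_, 
        fun y => t.symm y (fiberCoord F x₀ ⟨x, e⟩), ?_, ?_⟩
      · split_ifs with h
        · exact Filter.univ_mem
        · exact isOpen_compl_singleton.mem_nhds fun h' => h (by simpa using h'.symm)
      · intro y hy
        refine ContMDiffAt.contMDiffWithinAt ?_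
        have h1 : ContMDiffAt I (I.prod 𝓘(ℝ, F)) ∞ (fun y =>
            (⟨y, t.symm y (fiberCoord F x₀ ⟨x, e⟩)⟩ : TotalSpace F E)) y := by
          rw [t.contMDiffAt_section_iff hy.1]
          refine (contMDiffAt_const (c := fiberCoord F x₀ ⟨x, e⟩)).congr_of_eventuallyEq ?_
          filter_upwards [t.open_baseSet.mem_nhds hy.1] with z hz
          rw [t.apply_mk_symm hz]
        exact h1
      · rintro y hy rfl
        have hx : x = x₀ := by
          by_contra h
          have := hy.2
          rw [if_neg h] at this
          exact this rfl
        subst hx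
        exact t.symm_apply_apply_mk hy.1 e)
  exact ⟨s, hs x rfl⟩

variable {B' H' M' : Type*} [NormedAddCommGroup B'] [NormedSpace ℝ B'] [TopologicalSpace H']
  {I' : ModelWithCorners ℝ B' H'} [I'.Boundaryless] [TopologicalSpace M'] [ChartedSpace H' M']
  {F' : Type*} [NormedAddCommGroup F'] [NormedSpace ℝ F']
  {E' : M' → Type*} [TopologicalSpace (TotalSpace F' E')] [∀ x, TopologicalSpace (E' x)]
  [∀ x, AddCommGroup (E' x)] [∀ x, Module ℝ (E' x)] [FiberBundle F' E'] [VectorBundle ℝ F' E']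
  [IsManifold I' ∞ M'] [ContMDiffVectorBundle ∞ F' E' I']
  [FiniteDimensional ℝ B'] [FiniteDimensional ℝ F']
  {qM : M → M'} {q : ∀ x, E x →ₗ[ℝ] E' (qM x)}

/-- The section `e` of `E` projects to the section `b` of `E'`. -/
def ProjectsTo (q : ∀ x, E x →ₗ[ℝ] E' (qM x)) (e : ∀ x, E x) (b : ∀ y, E' y) : Prop :=
  ∀ x, q x (e x) = b (qM x)

/-- The map Ψ sending p to its base point together with the fibre coordinate of q(p) is a submersion
at `e₀`. A local section of Ψ through `e₀`, applied to the base point and the coordinate of `b` over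
it, gives vectors over the right points that project to `b`. -/
theorem IsSimpleQuotient.exists_local_lift (hq : IsSimpleQuotient I F I' F' qM q)
    (b : Cₛ^∞⟮I'; F', E'⟯) (x₀ : M) (e₀ : E x₀) (he : q x₀ e₀ = b (qM x₀)) :
    ∃ e : ∀ x, E x, e x₀ = e₀ ∧ ∀ᶠ x in nhds x₀,
      ContMDiffAt I (I.prod 𝓘(ℝ, F)) ∞ (fun y => (⟨y, e y⟩ : TotalSpace F E)) x ∧
      q x (e x) = b (qM x) := by
  let g : TotalSpace F E → F' := fun p => fiberCoord F' (qM x₀) (totalMap qM q p)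
  let Ψ : TotalSpace F E → M × F' := fun p => (p.proj, g p)
  have hgev : ∀ᶠ p in nhds (⟨x₀, e₀⟩ : TotalSpace F E),
      ContMDiffAt (I.prod 𝓘(ℝ, F)) 𝓘(ℝ, F') ∞ g p := by
    let t := trivializationAt F' E' (qM x₀)
    have hmem : (totalMap qM q (⟨x₀, e₀⟩ : TotalSpace F E) : TotalSpace F' E') ∈ t.source :=
      t.mem_source.mpr (FiberBundle.mem_baseSet_trivializationAt' _)
    filter_upwards [(hq.contMDiff_total ⟨x₀, e₀⟩).continuousAt.eventually_mem
      (t.open_source.mem_nhds hmem)] with p hp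
    have h1 : ContMDiffAt (I'.prod 𝓘(ℝ, F')) (I'.prod 𝓘(ℝ, F')) ∞ t (totalMap qM q p) :=
      t.contMDiffOn.contMDiffAt (t.open_source.mem_nhds hp)
    have h2 : ContMDiffAt (I.prod 𝓘(ℝ, F)) (I'.prod 𝓘(ℝ, F')) ∞
        (fun p : TotalSpace F E => t (totalMap qM q p)) p :=
      ContMDiffAt.comp (I' := I'.prod 𝓘(ℝ, F')) (g := t) p h1 (hq.contMDiff_total p)
    exact h2.snd
  have hΨev : ∀ᶠ p in nhds (⟨x₀, e₀⟩ : TotalSpace F E),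
      ContMDiffAt (I.prod 𝓘(ℝ, F)) (I.prod 𝓘(ℝ, F')) ∞ Ψ p :=
    hgev.mono fun p hp => (Bundle.contMDiff_proj (n := ∞) (IB := I) (F := F) E p).prodMk hp
  have hg := hgev.self_of_nhds
  have hpr := Bundle.contMDiff_proj (n := ∞) (IB := I) (F := F) E ⟨x₀, e₀⟩
  let D : B × F →L[ℝ] F' := mfderiv (I.prod 𝓘(ℝ, F)) 𝓘(ℝ, F') g ⟨x₀, e₀⟩
  have hD : ∀ W : B × F, (mfderiv (I.prod 𝓘(ℝ, F)) (I.prod 𝓘(ℝ, F')) Ψ ⟨x₀, e₀⟩ W : B × F') =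
      (W.1, D W) := by
    intro W
    have h := mfderiv_prodMk (hpr.mdifferentiableAt (by simp)) (hg.mdifferentiableAt (by simp))
    refine (DFunLike.congr_fun h W).trans ?_
    exact Prod.ext (mfderiv_totalSpace_proj_apply _ W) rfl
  have hs : Function.Surjective (mfderiv (I.prod 𝓘(ℝ, F)) (I.prod 𝓘(ℝ, F')) Ψ ⟨x₀, e₀⟩) := by
    intro Z
    let v : B := Z.1
    let u : F' := Z.2
    obtain ⟨c', hc'⟩ := exists_fiberCoord_eq (F := F') (E := E') (qM x₀) (u - D (v, 0))
    obtain ⟨a, ha⟩ := hq.surjective_fiber x₀ c'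
    refine ⟨((v, fiberCoord F x₀ ⟨x₀, a⟩) : B × F), (hD _).trans (Prod.ext rfl ?_)⟩
    have e1 : (v, fiberCoord F x₀ ⟨x₀, a⟩) = (v, 0) + (0, fiberCoord F x₀ ⟨x₀, a⟩) := by simp
    have e2 : D (0, fiberCoord F x₀ ⟨x₀, a⟩) = u - D (v, 0) := by
      refine (mfderiv_fiberCoord_totalMap_vertical hq.contMDiff_total e₀ a).trans ?_
      rw [ha, hc']
    change D (v, fiberCoord F x₀ ⟨x₀, a⟩) = u
    rw [e1, map_add, e2, add_sub_cancel]
  obtain ⟨s, hsc, hsx, hfs⟩ := exists_local_section hΨev hs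
  let j : M → M × F' := fun x => (x, fiberCoord F' (qM x₀) ⟨qM x, b (qM x)⟩)
  have hjev : ∀ᶠ x in nhds x₀, ContMDiffAt I (I.prod 𝓘(ℝ, F')) ∞ j x := by
    filter_upwards [(hq.contMDiff_base x₀).continuousAt.eventually_mem
      ((trivializationAt F' E' (qM x₀)).open_baseSet.mem_nhds
      (FiberBundle.mem_baseSet_trivializationAt' (qM x₀)))] with x hx
    refine contMDiffAt_id.prodMk ?_
    exact ContMDiffAt.comp (I' := I') (g := fun y => fiberCoord F' (qM x₀) ⟨y, b y⟩) x
      (((trivializationAt F' E' (qM x₀)).contMDiffAt_section_iff hx).mp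
        (b.contMDiff (qM x))) (hq.contMDiff_base x)
  have hj := hjev.self_of_nhds
  have hjx : j x₀ = Ψ ⟨x₀, e₀⟩ := by
    change (x₀, fiberCoord F' (qM x₀) ⟨qM x₀, b (qM x₀)⟩) =
      (x₀, fiberCoord F' (qM x₀) ⟨qM x₀, q x₀ e₀⟩)
    rw [he]
  have hjt : Filter.Tendsto j (nhds x₀) (nhds (Ψ ⟨x₀, e₀⟩)) := by
    rw [← hjx]; exact hj.continuousAt
  have hσ : ∀ᶠ x in nhds x₀, ContMDiffAt I (I.prod 𝓘(ℝ, F)) ∞ (fun x => s (j x)) x := by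
    filter_upwards [hjev, hjt.eventually hsc] with x hx1 hx2
    exact ContMDiffAt.comp (I' := I.prod 𝓘(ℝ, F')) (g := s) x hx2 hx1
  -- The point `s (j x)` lies over `x` only for `x` near `x₀`. Reading off its coordinate and
  -- placing it over `x` gives a globally defined section that agrees with it near `x₀`.
  let e : ∀ x, E x := fun x => (trivializationAt F E x₀).symm x (fiberCoord F x₀ (s (j x)))
  have hfj : ∀ᶠ x in nhds x₀, Ψ (s (j x)) = j x := hjt.eventually hfs
  have hbase := (trivializationAt F E x₀).open_baseSet.mem_nhds
    (FiberBundle.mem_baseSet_trivializationAt' x₀)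
  have hbase' := (hq.contMDiff_base x₀).continuousAt.eventually
    ((trivializationAt F' E' (qM x₀)).open_baseSet.mem_nhds
    (FiberBundle.mem_baseSet_trivializationAt' (qM x₀)))
  have hse : ∀ᶠ x in nhds x₀, s (j x) = ⟨x, e x⟩ := by
    filter_upwards [hfj, hbase] with x hx hxb
    have hp : (s (j x)).proj = x := congrArg Prod.fst hx
    have key : ∀ p : TotalSpace F E, p.proj = x →
        p = ⟨x, (trivializationAt F E x₀).symm x (fiberCoord F x₀ p)⟩ := by
      rintro ⟨_, v⟩ rfl
      exact congrArg (TotalSpace.mk' F _) ((trivializationAt F E x₀).symm_apply_apply_mk hxb v).symm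
    exact key _ hp
  refine ⟨e, ?_, ?_⟩
  · change (trivializationAt F E x₀).symm x₀ (fiberCoord F x₀ (s (j x₀))) = e₀
    rw [hjx, hsx]
    exact (trivializationAt F E x₀).symm_apply_apply_mk
      (FiberBundle.mem_baseSet_trivializationAt' x₀) e₀
  · filter_upwards [hσ, hse.eventually_nhds, hfj, hbase'] with x hx1 hx2 hx3 hx4
    refine ⟨contMDiffAt_of_fiberCoord_eq hx1 hx2, ?_⟩
    have h3 : g (s (j x)) = fiberCoord F' (qM x₀) ⟨qM x, b (qM x)⟩ :=
      congrArg (fun z : M × F' => z.2) hx3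
    rw [hx2.self_of_nhds] at h3
    have h4 := (trivializationAt F' E' (qM x₀)).symm_apply_apply_mk hx4 (q x (e x))
    have h5 := (trivializationAt F' E' (qM x₀)).symm_apply_apply_mk hx4 (b (qM x))
    rw [← h4, ← h5]
    exact congrArg ((trivializationAt F' E' (qM x₀)).symm (qM x)) h3

/-- Sections of `E'` lift to sections of `E` with a prescribed value. -/
theorem IsSimpleQuotient.exists_lift [T2Space M] [SigmaCompactSpace M]
    (hq : IsSimpleQuotient I F I' F' qM q)
    (b : Cₛ^∞⟮I'; F', E'⟯) (x : M) (e : E x) (he : q x e = b (qM x)) :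
    ∃ s : Cₛ^∞⟮I; F, E⟯, ProjectsTo q s b ∧ s x = e := by
  -- Projecting to `b` is an affine condition in each fibre, hence convex, and so is fixing the
  -- value at `x`; a partition of unity glues the local lifts.
  obtain ⟨s, hs⟩ := exists_contMDiffSection_forall_mem_convex_of_local (n := (⊤ : ℕ∞)) I
    (F_fiber := F) E (fun y => {v | q y v = b (qM y) ∧ ∀ h : x = y, v = h ▸ e})
    (fun y v hv v' hv' c c' _ _ hab => by
      refine ⟨?_, ?_⟩
      · rw [map_add, map_smul, map_smul, hv.1, hv'.1, ← add_smul, hab, one_smul]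
      · rintro rfl
        rw [hv.2 rfl, hv'.2 rfl, ← add_smul, hab, one_smul]) (fun x₀ => by
      rcases eq_or_ne x x₀ with rfl | hne
      · obtain ⟨e', he', hev⟩ := hq.exists_local_lift b x e he
        refine ⟨_, hev, e', fun y hy => hy.1.contMDiffWithinAt, fun y hy => ⟨hy.2, ?_⟩⟩
        rintro rfl
        exact he'
      · obtain ⟨v, hv⟩ := hq.surjective_fiber x₀ (b (qM x₀))
        obtain ⟨e', he', hev⟩ := hq.exists_local_lift b x₀ v hv
        refine ⟨_, Filter.inter_mem hev (isOpen_compl_singleton.mem_nhds hne.symm), e',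
          fun y hy => hy.1.1.contMDiffWithinAt, fun y hy => ⟨hy.1.2, ?_⟩⟩
        rintro rfl
        exact absurd rfl hy.2)
  exact ⟨s, fun y => (hs y).1, (hs x).2 rfl⟩

theorem IsSimpleQuotient.exists_projectsTo [T2Space M] [SigmaCompactSpace M]
    (hq : IsSimpleQuotient I F I' F' qM q)
    (b : Cₛ^∞⟮I'; F', E'⟯) : ∃ s : Cₛ^∞⟮I; F, E⟯, ProjectsTo q s b := by
  rcases isEmpty_or_nonempty M with h | ⟨⟨x⟩⟩
  · exact ⟨0, fun x => (h.false x).elim⟩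
  · obtain ⟨v, hv⟩ := hq.surjective_fiber x (b (qM x))
    obtain ⟨s, hs, -⟩ := hq.exists_lift b x v hv
    exact ⟨s, hs⟩

/-- A lift of a section through the given vector embeds the connected fibre of q_M into the fibre of
q. Every other point of the fibre of q is joined to this copy by a straight line inside one fibre of
E. -/
theorem IsSimpleQuotient.isPreconnected_fiber_total [T2Space M] [SigmaCompactSpace M]
    [T2Space M'] [SigmaCompactSpace M']
    (hq : IsSimpleQuotient I F I' F' qM q) (p' : TotalSpace F' E') :
    IsPreconnected ((totalMap qM q : TotalSpace F E → TotalSpace F' E') ⁻¹' {p'}) := by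
  obtain ⟨y, e'⟩ := p'
  obtain ⟨b, hb⟩ := exists_section_through (I := I') (F := F') y e'
  obtain ⟨s, hs⟩ := hq.exists_projectsTo b
  have hmem : ∀ x, qM x = y → ∀ v : E x, q x v = b (qM x) →
      (⟨x, v⟩ : TotalSpace F E) ∈
        (totalMap qM q : TotalSpace F E → TotalSpace F' E') ⁻¹' {⟨y, e'⟩} := by
    rintro x rfl v hv
    change (⟨qM x, q x v⟩ : TotalSpace F' E') = ⟨qM x, e'⟩
    rw [hv, hb]
  have hmem' : ∀ p ∈ (totalMap qM q : TotalSpace F E → TotalSpace F' E') ⁻¹' {⟨y, e'⟩},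
      qM p.proj = y ∧ q p.proj p.2 = b (qM p.proj) := by
    rintro ⟨x, v⟩ hp
    have h : (⟨qM x, q x v⟩ : TotalSpace F' E') = ⟨y, e'⟩ := hp
    have h1 : qM x = y := congrArg TotalSpace.proj h
    subst h1
    refine ⟨rfl, ?_⟩
    rw [hb]
    exact TotalSpace.mk_inj.mp h
  have hS : IsPreconnected ((fun x => (⟨x, s x⟩ : TotalSpace F E)) '' (qM ⁻¹' {y})) :=
    (hq.connected_fibers y).isPreconnected.image _ s.contMDiff.continuous.continuousOn
  have hA : ∀ (x : M) (v : E x), IsPreconnected (Set.range fun t : ℝ =>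
      (⟨x, s x + t • (v - s x)⟩ : TotalSpace F E)) := fun x v =>
    isPreconnected_range (contMDiff_add_smul_vector (I := I) (F := F) (s x) (v - s x)).continuous
  refine isPreconnected_of_forall_pair ?_
  rintro ⟨x₁, v₁⟩ h₁ ⟨x₂, v₂⟩ h₂
  obtain ⟨hx₁, hv₁⟩ := hmem' _ h₁
  obtain ⟨hx₂, hv₂⟩ := hmem' _ h₂
  have h0 : ∀ (x : M) (v : E x), (⟨x, s x⟩ : TotalSpace F E) ∈ Set.range fun t : ℝ =>
      (⟨x, s x + t • (v - s x)⟩ : TotalSpace F E) := fun x v => ⟨0, by simp⟩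
  have h1 : ∀ (x : M) (v : E x), (⟨x, v⟩ : TotalSpace F E) ∈ Set.range fun t : ℝ =>
      (⟨x, s x + t • (v - s x)⟩ : TotalSpace F E) := fun x v => ⟨1, by simp⟩
  have hsub : ∀ (x : M) (v : E x), qM x = y → q x v = b (qM x) → (Set.range fun t : ℝ =>
      (⟨x, s x + t • (v - s x)⟩ : TotalSpace F E)) ⊆
      (totalMap qM q : TotalSpace F E → TotalSpace F' E') ⁻¹' {⟨y, e'⟩} := by
    rintro x v hx hv _ ⟨t, rfl⟩
    refine hmem x hx _ ?_
    rw [map_add, map_smul, map_sub, hv, hs x, sub_self, smul_zero, add_zero]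
  refine ⟨(Set.range fun t : ℝ => (⟨x₁, s x₁ + t • (v₁ - s x₁)⟩ : TotalSpace F E)) ∪
    (fun x => (⟨x, s x⟩ : TotalSpace F E)) '' (qM ⁻¹' {y}) ∪
    (Set.range fun t : ℝ => (⟨x₂, s x₂ + t • (v₂ - s x₂)⟩ : TotalSpace F E)),
    Set.union_subset (Set.union_subset (hsub x₁ v₁ hx₁ hv₁) ?_) (hsub x₂ v₂ hx₂ hv₂),
    Or.inl (Or.inl (h1 x₁ v₁)), Or.inr (h1 x₂ v₂), ?_⟩
  · rintro _ ⟨x, hx, rfl⟩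
    exact hmem x hx _ (hs x)
  · refine IsPreconnected.union ⟨x₂, s x₂⟩ (Or.inr ⟨x₂, hx₂, rfl⟩) (h0 x₂ v₂) ?_ (hA x₂ v₂)
    exact IsPreconnected.union ⟨x₁, s x₁⟩ (h0 x₁ v₁) ⟨x₁, hx₁, rfl⟩ (hA x₁ v₁) hS

end Lifts

/-! ### Kernels of forms under pullback -/

section Kernels

variable {V H X : Type*} [NormedAddCommGroup V] [NormedSpace ℝ V] [TopologicalSpace H]
  {I : ModelWithCorners ℝ V H} [TopologicalSpace X] [ChartedSpace H X]
  {V' H' X' : Type*} [NormedAddCommGroup V'] [NormedSpace ℝ V']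
  [TopologicalSpace H'] {I' : ModelWithCorners ℝ V' H'} [TopologicalSpace X']
  [ChartedSpace H' X']
  {V'' H'' X'' : Type*} [NormedAddCommGroup V''] [NormedSpace ℝ V'']
  [TopologicalSpace H''] {I'' : ModelWithCorners ℝ V'' H''} [TopologicalSpace X'']
  [ChartedSpace H'' X'']

theorem FormField.pullback_pullback {k : ℕ} {f : X → X'} {g : X' → X''}
    (hf : ContMDiff I I' ∞ f) (hg : ContMDiff I' I'' ∞ g) (Ω : FormField I'' X'' k) :
    FormField.pullback (I := I) f (FormField.pullback (I := I') g Ω) =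
      FormField.pullback (fun x => g (f x)) Ω := by
  refine FormField.ext fun x w => ?_
  have h := mfderiv_comp x ((hg (f x)).mdifferentiableAt (by simp))
    ((hf x).mdifferentiableAt (by simp))
  exact congrArg (Ω (g (f x)) : V'' [⋀^Fin k]→L[ℝ] ℝ)
    (funext fun i => (DFunLike.congr_fun h (w i)).symm)

theorem FormField.mem_ker_iff {k : ℕ} (Ω : FormField I X (k + 1)) {x : X}
    {v : TangentSpace I x} : v ∈ Ω.ker x ↔ ∀ w, Ω x (Matrix.vecCons v w) = 0 :=
  ⟨fun h w => DFunLike.congr_fun (F := V [⋀^Fin k]→L[ℝ] ℝ) h w,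
    fun h => ContinuousAlternatingMap.ext (M := V) (N := ℝ) h⟩

theorem FormField.apply_eq_zero_of_mem_ker {k : ℕ} (Ω : FormField I X (k + 1)) {x : X}
    (w : Fin (k + 1) → TangentSpace I x) {i : Fin (k + 1)} (h : w i ∈ Ω.ker x) : Ω x w = 0 := by
  have h1 := alternating_update_eq (V := V) (Ω x) w i (w i)
  have h2 : (Function.update (w : Fin (k + 1) → V) i (w i)) = w := Function.update_eq_self i w
  refine (congrArg (Ω x : V [⋀^Fin (k + 1)]→L[ℝ] ℝ) h2).symm.trans
    (h1.trans (mul_eq_zero_of_right _ ?_))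
  exact Ω.mem_ker_iff.mp h _

/-- A form which is the pullback of a form by a surjective submersion `f` and whose kernel is the
kernel of the derivative of `f` descends to a form with trivial kernel. -/
theorem FormField.ker_eq_bot_of_pullback {k : ℕ} {f : X → X'} (hsurj : Function.Surjective f)
    (hs : ∀ x, Function.Surjective (mfderiv I I' f x)) {Ω' : FormField I' X' (k + 1)}
    (h : ∀ x (v : TangentSpace I x), v ∈ (FormField.pullback (I := I) f Ω').ker x →
      mfderiv I I' f x v = 0) (y : X') : Ω'.ker y = ⊥ := by
  refine (Submodule.eq_bot_iff _).mpr fun v' hv' => ?_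
  obtain ⟨x, rfl⟩ := hsurj y
  obtain ⟨v, rfl⟩ := hs x v'
  refine h x v ((FormField.mem_ker_iff _).mpr fun w => ?_)
  refine Eq.trans ?_ ((FormField.mem_ker_iff _).mp hv' fun i => mfderiv I I' f x (w i))
  refine congrArg (Ω' (f x) : V' [⋀^Fin (k + 1)]→L[ℝ] ℝ) (funext fun i => ?_)
  exact Fin.cases rfl (fun _ => rfl) i

end Kernels

/-! ### Nondegeneracy of the components and descent of the linear form -/

section Descent

variable {B H M : Type*} [NormedAddCommGroup B] [NormedSpace ℝ B] [TopologicalSpace H]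
  {I : ModelWithCorners ℝ B H} [I.Boundaryless] [TopologicalSpace M] [ChartedSpace H M]
  {F : Type*} [NormedAddCommGroup F] [NormedSpace ℝ F]
  {E : M → Type*} [TopologicalSpace (TotalSpace F E)] [∀ x, TopologicalSpace (E x)]
  [∀ x, AddCommGroup (E x)] [∀ x, Module ℝ (E x)] [FiberBundle F E] [VectorBundle ℝ F E]
  [IsManifold I ∞ M] [ContMDiffVectorBundle ∞ F E I]
  [FiniteDimensional ℝ B] [FiniteDimensional ℝ F]

/-- A linear form at the zero section in terms of its component `μ`. -/
theorem IsLinearForm.apply_zero {k : ℕ} {Ω : FormField (I.prod 𝓘(ℝ, F)) (TotalSpace F E) (k + 1)}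
    (hΩ : Ω.IsSmooth) (hl : IsLinearForm Ω) (x : M) (v : Fin (k + 1) → B)
    (a : Fin (k + 1) → E x) :
    (Ω ⟨x, 0⟩ : (B × F) [⋀^Fin (k + 1)]→L[ℝ] ℝ) (fun i => (v i, fiberCoord F x ⟨x, a i⟩)) =
      ∑ i : Fin (k + 1), (-1 : ℝ) ^ (i : ℕ) *
        (muComp Ω x (a i) : B [⋀^Fin k]→L[ℝ] ℝ) (fun l => v (i.succAbove l)) := by
  rw [hl.apply_eq hΩ]
  have h0 : ((0 : B), fiberCoord F x (⟨x, 0⟩ : TotalSpace F E)) = 0 := by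
    rw [fiberCoord_zero (FiberBundle.mem_baseSet_trivializationAt' _)]; rfl
  rw [h0, map_zero]
  refine (zero_add _).trans (Finset.sum_congr rfl fun i _ => ?_)
  refine (ContinuousAlternatingMap.map_update_eq_cons (V := B × F) (Ω ⟨x, 0⟩) _ i _).trans ?_
  exact congrArg ((-1 : ℝ) ^ (i : ℕ) * ·) (coreContraction_apply Ω x (a i) _).symm

/-- The vertical vector of `e` at zero lies in the kernel of Ω. By `IsLinearForm.apply_zero`,
contraction with it leaves only μ(e), since every other term has the zero base vector as an
argument. -/
theorem eq_zero_of_muComp_eq_zero {k : ℕ}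
    {Ω : FormField (I.prod 𝓘(ℝ, F)) (TotalSpace F E) (k + 1)} (hΩ : Ω.IsSmooth)
    (hl : IsLinearForm Ω) (hk : ∀ p, Ω.ker p = ⊥) (x : M) (e : E x) (he : muComp Ω x e = 0) :
    e = 0 := by
  have hmem : ((0, fiberCoord F x ⟨x, e⟩) : B × F) ∈ Ω.ker (⟨x, 0⟩ : TotalSpace F E) := by
    refine Ω.mem_ker_iff.mpr fun w => ?_
    choose a ha using fun i => exists_fiberCoord_eq (F := F) (E := E) x (w i : B × F).2
    have h1 := hl.apply_zero hΩ x (Matrix.vecCons 0 fun i => (w i : B × F).1)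
      (Matrix.vecCons e a)
    have h2 : (fun i => ((Matrix.vecCons (0 : B) fun i => (w i : B × F).1) i,
        fiberCoord F x ⟨x, (Matrix.vecCons e a : Fin (k + 1) → E x) i⟩)) =
        Matrix.vecCons (0, fiberCoord F x ⟨x, e⟩) (w : Fin k → B × F) := by
      funext i
      refine Fin.cases rfl (fun i => ?_) i
      exact Prod.ext rfl (ha i)
    refine (congrArg (Ω ⟨x, 0⟩ : (B × F) [⋀^Fin (k + 1)]→L[ℝ] ℝ) h2).symm.trans
      (h1.trans (Finset.sum_eq_zero fun i _ => mul_eq_zero_of_right _ ?_))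
    rcases Fin.eq_zero_or_eq_succ i with rfl | ⟨j, rfl⟩
    · exact DFunLike.congr_fun (F := B [⋀^Fin k]→L[ℝ] ℝ) he _
    · cases k with
      | zero => exact j.elim0
      | succ k =>
        refine ContinuousAlternatingMap.map_coord_zero (M := B) _ 0 ?_
        rw [Fin.succ_succAbove_zero]
        rfl
  rw [hk] at hmem
  have h0 : fiberCoord F x ⟨x, e⟩ = 0 := congrArg (fun z : B × F => z.2) hmem
  refine fiberCoord_injective (F := F) x ?_
  rw [fiberCoord_zero (FiberBundle.mem_baseSet_trivializationAt' _)]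
  exact h0

/-- The horizontal vector (v, 0) at zero lies in the kernel of Ω: the term of its own slot contains
μ(0), and every other term is some μ(a) contracted with `v`. -/
theorem eq_zero_of_contract_muComp_eq_zero {k : ℕ}
    {Ω : FormField (I.prod 𝓘(ℝ, F)) (TotalSpace F E) (k + 2)} (hΩ : Ω.IsSmooth)
    (hl : IsLinearForm Ω) (hk : ∀ p, Ω.ker p = ⊥) (x : M) (v : TangentSpace I x)
    (hv : ∀ e : E x, contract (muComp Ω x e) v = 0) : v = 0 := by
  have hmem : (((v : B), (0 : F)) : B × F) ∈ Ω.ker (⟨x, 0⟩ : TotalSpace F E) := by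
    refine Ω.mem_ker_iff.mpr fun w => ?_
    choose a ha using fun i => exists_fiberCoord_eq (F := F) (E := E) x (w i : B × F).2
    have h1 := hl.apply_zero hΩ x (Matrix.vecCons v fun i => (w i : B × F).1)
      (Matrix.vecCons 0 a)
    have h2 : (fun i => ((Matrix.vecCons (v : B) fun i => (w i : B × F).1) i,
        fiberCoord F x ⟨x, (Matrix.vecCons 0 a : Fin (k + 2) → E x) i⟩)) =
        Matrix.vecCons ((v : B), (0 : F)) (w : Fin (k + 1) → B × F) := by
      funext i
      refine Fin.cases ?_ (fun i => ?_) i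
      · exact Prod.ext rfl (fiberCoord_zero (FiberBundle.mem_baseSet_trivializationAt' _))
      · exact Prod.ext rfl (ha i)
    refine (congrArg (Ω ⟨x, 0⟩ : (B × F) [⋀^Fin (k + 2)]→L[ℝ] ℝ) h2).symm.trans
      (h1.trans (Finset.sum_eq_zero fun i _ => mul_eq_zero_of_right _ ?_))
    rcases Fin.eq_zero_or_eq_succ i with rfl | ⟨j, rfl⟩
    · refine (coreContraction_apply Ω x _ _).trans ?_
      refine ContinuousAlternatingMap.map_coord_zero (M := B × F) _ 0 ?_
      have h0 := fiberCoord_zero (F := F) (E := E) (FiberBundle.mem_baseSet_trivializationAt' x)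
      exact Prod.ext rfl h0
    · have h3 := DFunLike.congr_fun (F := B [⋀^Fin k]→L[ℝ] ℝ) (hv (a j))
        (fun l => (w (j.succAbove l) : B × F).1)
      refine Eq.trans ?_ h3
      refine congrArg (muComp Ω x (a j) : B [⋀^Fin (k + 1)]→L[ℝ] ℝ) (funext fun l => ?_)
      refine Fin.cases ?_ (fun l => ?_) l
      · rw [Fin.succ_succAbove_zero]; rfl
      · rw [Fin.succ_succAbove_succ]; rfl
  rw [hk] at hmem
  exact congrArg (fun z : B × F => z.1) hmem

variable {B' H' M' : Type*} [NormedAddCommGroup B'] [NormedSpace ℝ B'] [TopologicalSpace H']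
  {I' : ModelWithCorners ℝ B' H'} [I'.Boundaryless] [TopologicalSpace M'] [ChartedSpace H' M']
  {F' : Type*} [NormedAddCommGroup F'] [NormedSpace ℝ F']
  {E' : M' → Type*} [TopologicalSpace (TotalSpace F' E')] [∀ x, TopologicalSpace (E' x)]
  [∀ x, AddCommGroup (E' x)] [∀ x, Module ℝ (E' x)] [FiberBundle F' E'] [VectorBundle ℝ F' E']
  [IsManifold I' ∞ M'] [ContMDiffVectorBundle ∞ F' E' I']
  [FiniteDimensional ℝ B'] [FiniteDimensional ℝ F']
  {qM : M → M'} {q : ∀ x, E x →ₗ[ℝ] E' (qM x)}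

/-- The morphism carries the zero section to the zero section, so its differential intertwines the
two maps T0. -/
theorem mfderiv_totalMap_zero (hE : ContMDiff (I.prod 𝓘(ℝ, F)) (I'.prod 𝓘(ℝ, F')) ∞
      (totalMap qM q : TotalSpace F E → TotalSpace F' E')) (hM : ContMDiff I I' ∞ qM)
    (x : M) (b : B) :
    (mfderiv (I.prod 𝓘(ℝ, F)) (I'.prod 𝓘(ℝ, F'))
      (totalMap qM q : TotalSpace F E → TotalSpace F' E') ⟨x, 0⟩ ((b, 0) : B × F) : B' × F') =
      ((mfderiv I I' qM x b : B'), 0) := by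
  have h1 := mfderiv_comp (I := I) (I' := I.prod 𝓘(ℝ, F)) (I'' := I'.prod 𝓘(ℝ, F'))
    (f := fun y : M => (⟨y, (0 : E y)⟩ : TotalSpace F E)) x ((hE _).mdifferentiableAt (by simp))
    ((contMDiff_zero_totalSpace x).mdifferentiableAt (by simp))
  have h2 := mfderiv_comp (I := I) (I' := I') (I'' := I'.prod 𝓘(ℝ, F'))
    (g := fun y : M' => (⟨y, (0 : E' y)⟩ : TotalSpace F' E')) (f := qM) x
    ((contMDiff_zero_totalSpace _).mdifferentiableAt (by simp))
    ((hM x).mdifferentiableAt (by simp))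
  have e : (totalMap qM q : TotalSpace F E → TotalSpace F' E') ∘
      (fun y : M => (⟨y, (0 : E y)⟩ : TotalSpace F E)) =
      (fun y : M' => (⟨y, (0 : E' y)⟩ : TotalSpace F' E')) ∘ qM := by
    funext y
    exact congrArg (TotalSpace.mk' F' (qM y)) (map_zero (q y))
  have h3 : (mfderiv I (I'.prod 𝓘(ℝ, F')) ((totalMap qM q : TotalSpace F E → TotalSpace F' E') ∘
      (fun y : M => (⟨y, (0 : E y)⟩ : TotalSpace F E))) x b : B' × F') =
      (mfderiv I (I'.prod 𝓘(ℝ, F')) ((fun y : M' => (⟨y, (0 : E' y)⟩ : TotalSpace F' E')) ∘ qM) x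
        b : B' × F') :=
    congrArg (fun f : M → TotalSpace F' E' => (mfderiv I (I'.prod 𝓘(ℝ, F')) f x b : B' × F')) e
  have h4 := (DFunLike.congr_fun h1 b).symm.trans (h3.trans (DFunLike.congr_fun h2 b))
  refine Eq.trans ?_ (h4.trans ?_)
  · exact congrArg (mfderiv (I.prod 𝓘(ℝ, F)) (I'.prod 𝓘(ℝ, F'))
      (totalMap qM q : TotalSpace F E → TotalSpace F' E') ⟨x, 0⟩ : B × F →L[ℝ] B' × F')
      (tangentZero_apply (I := I) (F := F) (E := E) x b).symm
  · exact tangentZero_apply (I := I') (F := F') (E := E') (qM x) (mfderiv I I' qM x b)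

/-- Naturality of the contraction at the zero section. -/
theorem coreContraction_pullback_totalMap
    (hE : ContMDiff (I.prod 𝓘(ℝ, F)) (I'.prod 𝓘(ℝ, F')) ∞
      (totalMap qM q : TotalSpace F E → TotalSpace F' E')) (hM : ContMDiff I I' ∞ qM) {k : ℕ}
    (Ω' : FormField (I'.prod 𝓘(ℝ, F')) (TotalSpace F' E') (k + 1)) (x : M) (e : E x) :
    coreContraction (FormField.pullback (I := I.prod 𝓘(ℝ, F)) (totalMap qM q) Ω') x e =
      (coreContraction Ω' (qM x) (q x e)).compContinuousLinearMap (mfderiv I I' qM x) := by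
  refine ContinuousAlternatingMap.ext (M := B) (N := ℝ) fun b => ?_
  refine (coreContraction_apply _ x e b).trans ?_
  refine Eq.trans ?_ (coreContraction_apply Ω' (qM x) (q x e)
    (fun i => mfderiv I I' qM x (b i))).symm
  have h0 : (totalMap qM q (⟨x, 0⟩ : TotalSpace F E) : TotalSpace F' E') = ⟨qM x, 0⟩ :=
    congrArg (TotalSpace.mk' F' (qM x)) (map_zero (q x))
  refine (congrArg (fun p => (Ω' p : (B' × F') [⋀^Fin (k + 1)]→L[ℝ] ℝ) (fun i =>
    (mfderiv (I.prod 𝓘(ℝ, F)) (I'.prod 𝓘(ℝ, F'))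
      (totalMap qM q : TotalSpace F E → TotalSpace F' E') ⟨x, 0⟩
      ((Matrix.vecCons ((0 : B), fiberCoord F x ⟨x, e⟩) fun i => (b i, (0 : F))) i) : B' × F')))
    h0).trans ?_
  refine congrArg (Ω' ⟨qM x, 0⟩ : (B' × F') [⋀^Fin (k + 1)]→L[ℝ] ℝ) (funext fun i => ?_)
  refine Fin.cases ?_ (fun i => ?_) i
  · exact mfderiv_totalMap_vertical hE hM 0 e
  · exact mfderiv_totalMap_zero hE hM x (b i)

/-- The equality Ker(Tq) = Ker(Ω) makes Ω horizontal, and Ker(Ω) ⊆ Ker(dΩ) makes dΩ horizontal; the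
fibres on the total space are connected. -/
theorem IsKernelReducible.exists_eq_pullback [T2Space M] [SigmaCompactSpace M]
    [T2Space M'] [SigmaCompactSpace M'] {k : ℕ}
    {Ω : FormField (I.prod 𝓘(ℝ, F)) (TotalSpace F E) (k + 1)} (hΩ : Ω.IsSmooth)
    (h : IsKernelReducible I' F' Ω qM q) :
    ∃ Ω' : FormField (I'.prod 𝓘(ℝ, F')) (TotalSpace F' E') (k + 1), Ω'.IsSmooth ∧
      Ω = FormField.pullback (totalMap qM q) Ω' := by
  have : IsManifold (I.prod 𝓘(ℝ, F)) ∞ (TotalSpace F E) := inferInstance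
  refine FormField.exists_eq_pullback h.simple.contMDiff_total h.simple.surjective_total
    h.simple.submersion_total h.simple.isPreconnected_fiber_total hΩ ?_ ?_
  · rintro p w ⟨i, hi⟩
    refine Ω.apply_eq_zero_of_mem_ker w (i := i) ?_
    rw [← h.ker_tangent p]
    exact hi
  · rintro p w ⟨i, hi⟩
    refine Ω.d.apply_eq_zero_of_mem_ker w (i := i) (h.ker_le p ?_)
    rw [← h.ker_tangent p]
    exact hi

/-- The morphism commutes with fibrewise scaling, and pullback along it is injective. -/
theorem IsLinearForm.of_pullback (hq : IsSimpleQuotient I F I' F' qM q) {k : ℕ}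
    {Ω' : FormField (I'.prod 𝓘(ℝ, F')) (TotalSpace F' E') k}
    (hl : IsLinearForm (FormField.pullback (I := I.prod 𝓘(ℝ, F))
      (totalMap qM q : TotalSpace F E → TotalSpace F' E') Ω')) : IsLinearForm Ω' := by
  intro c
  refine FormField.pullback_injective (I := I.prod 𝓘(ℝ, F)) hq.contMDiff_total hq.surjective_total
    hq.submersion_total ?_
  refine Eq.trans ?_ (hl c)
  rw [FormField.pullback_pullback hq.contMDiff_total (contMDiff_smul_totalSpace c),
    FormField.pullback_pullback (contMDiff_smul_totalSpace c) hq.contMDiff_total]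
  refine congrArg (fun f : TotalSpace F E → TotalSpace F' E' =>
    FormField.pullback (I := I.prod 𝓘(ℝ, F)) f Ω') (funext fun p => ?_)
  exact congrArg (TotalSpace.mk' F' (qM p.proj)) (map_smul (q p.proj) c p.2).symm

end Descent

/-! ### Horizontal forms and calculus with related vector fields -/

section RelatedFields

variable {V H X : Type*} [NormedAddCommGroup V] [NormedSpace ℝ V] [TopologicalSpace H]
  {I : ModelWithCorners ℝ V H} [TopologicalSpace X] [ChartedSpace H X]
  {V' H' X' : Type*} [NormedAddCommGroup V'] [NormedSpace ℝ V']
  [TopologicalSpace H'] {I' : ModelWithCorners ℝ V' H'} [TopologicalSpace X']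
  [ChartedSpace H' X'] {f : X → X'}

theorem alternating_eq_zero_of_coord {V : Type*} [NormedAddCommGroup V] [NormedSpace ℝ V] {k : ℕ}
    (α : V [⋀^Fin k]→L[ℝ] ℝ) {w : Fin k → V} (i : Fin k) (hi : w i = 0) : α w = 0 :=
  α.map_coord_zero i hi

theorem FormField.isHorizontal_pullback {k : ℕ} (Ω : FormField I' X' k) :
    (FormField.pullback (I := I) f Ω).IsHorizontal I' f := by
  rintro x w ⟨i, hi⟩
  exact alternating_eq_zero_of_coord (V := V') (Ω (f x)) i hi

theorem FormField.IsHorizontal.interior {k : ℕ} {Ω : FormField I X (k + 1)}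
    (h : Ω.IsHorizontal I' f) (v : ∀ x : X, TangentSpace I x) :
    (Ω.interior v).IsHorizontal I' f := by
  rintro x w ⟨i, hi⟩
  exact h x (Matrix.vecCons (v x) w) ⟨i.succ, hi⟩

theorem FormField.IsHorizontal.add {k : ℕ} {Ω Ω' : FormField I X k}
    (h : Ω.IsHorizontal I' f) (h' : Ω'.IsHorizontal I' f) : (Ω + Ω').IsHorizontal I' f :=
  fun x w hw => (congrArg₂ (· + ·) (h x w hw) (h' x w hw)).trans (add_zero 0)

theorem FormField.IsHorizontal.sub {k : ℕ} {Ω Ω' : FormField I X k}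
    (h : Ω.IsHorizontal I' f) (h' : Ω'.IsHorizontal I' f) : (Ω - Ω').IsHorizontal I' f :=
  fun x w hw => (congrArg₂ (· - ·) (h x w hw) (h' x w hw)).trans (sub_zero 0)

theorem FormField.interior_pullback {k : ℕ} {v : ∀ x : X, TangentSpace I x}
    {v' : ∀ y : X', TangentSpace I' y} (hv : ∀ x, mfderiv I I' f x (v x) = v' (f x))
    (Ω : FormField I' X' (k + 1)) :
    (FormField.pullback (I := I) f Ω).interior v = FormField.pullback f (Ω.interior v') := by
  refine FormField.ext fun x w => ?_
  refine congrArg (Ω (f x) : V' [⋀^Fin (k + 1)]→L[ℝ] ℝ) (funext fun i => ?_)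
  exact Fin.cases (hv x) (fun _ => rfl) i

theorem FormField.lieDeriv_pullback [I.Boundaryless] [I'.Boundaryless] [IsManifold I ∞ X]
    [IsManifold I' ∞ X'] [FiniteDimensional ℝ V] [FiniteDimensional ℝ V']
    (hf : ContMDiff I I' ∞ f) {k : ℕ} {v : ∀ x : X, TangentSpace I x}
    {v' : ∀ y : X', TangentSpace I' y} (hv' : IsSmoothField v')
    (hv : ∀ x, mfderiv I I' f x (v x) = v' (f x))
    {Ω : FormField I' X' (k + 1)} (hΩ : Ω.IsSmooth) :
    (FormField.pullback (I := I) f Ω).lieDeriv v = FormField.pullback f (Ω.lieDeriv v') := by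
  unfold FormField.lieDeriv
  rw [FormField.d_pullback hf hΩ, FormField.interior_pullback hv, FormField.interior_pullback hv,
    FormField.d_pullback hf (hΩ.interior hv')]
  rfl

end RelatedFields

/-! ### Descent of the anchor -/

section Descent

variable {B H M : Type*} [NormedAddCommGroup B] [NormedSpace ℝ B] [TopologicalSpace H]
  {I : ModelWithCorners ℝ B H} [I.Boundaryless] [TopologicalSpace M] [ChartedSpace H M]
  {F : Type*} [NormedAddCommGroup F] [NormedSpace ℝ F]
  {E : M → Type*} [TopologicalSpace (TotalSpace F E)] [∀ x, TopologicalSpace (E x)]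
  [∀ x, AddCommGroup (E x)] [∀ x, Module ℝ (E x)] [FiberBundle F E] [VectorBundle ℝ F E]
  [IsManifold I ∞ M] [ContMDiffVectorBundle ∞ F E I]
  [FiniteDimensional ℝ B] [FiniteDimensional ℝ F]
  {B' H' M' : Type*} [NormedAddCommGroup B'] [NormedSpace ℝ B'] [TopologicalSpace H']
  {I' : ModelWithCorners ℝ B' H'} [I'.Boundaryless] [TopologicalSpace M'] [ChartedSpace H' M']
  {F' : Type*} [NormedAddCommGroup F'] [NormedSpace ℝ F']
  {E' : M' → Type*} [TopologicalSpace (TotalSpace F' E')] [∀ x, TopologicalSpace (E' x)]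
  [∀ x, AddCommGroup (E' x)] [∀ x, Module ℝ (E' x)] [FiberBundle F' E'] [VectorBundle ℝ F' E']
  [IsManifold I' ∞ M'] [ContMDiffVectorBundle ∞ F' E' I']
  [FiniteDimensional ℝ B'] [FiniteDimensional ℝ F']
  {qM : M → M'} {q : ∀ x, E x →ₗ[ℝ] E' (qM x)}

section Components

variable (hE : ContMDiff (I.prod 𝓘(ℝ, F)) (I'.prod 𝓘(ℝ, F')) ∞
      (totalMap qM q : TotalSpace F E → TotalSpace F' E')) (hM : ContMDiff I I' ∞ qM) {k : ℕ}
  {Ω : FormField (I.prod 𝓘(ℝ, F)) (TotalSpace F E) (k + 1)}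
  {Ω' : FormField (I'.prod 𝓘(ℝ, F')) (TotalSpace F' E') (k + 1)}
  (h : Ω = FormField.pullback (totalMap qM q) Ω')
include hE hM h

theorem muComp_eq_of_pullback (x : M) (e : E x) : muComp Ω x e =
    (muComp Ω' (qM x) (q x e)).compContinuousLinearMap (mfderiv I I' qM x) := by
  subst h
  exact coreContraction_pullback_totalMap hE hM Ω' x e

theorem etaComp_eq_of_pullback (hΩ' : Ω'.IsSmooth) (x : M) (e : E x) : etaComp Ω x e =
    (etaComp Ω' (qM x) (q x e)).compContinuousLinearMap (mfderiv I I' qM x) := by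
  subst h
  unfold etaComp
  rw [FormField.d_pullback hE hΩ']
  exact coreContraction_pullback_totalMap hE hM Ω'.d x e

theorem muSection_eq_of_projectsTo {e : Cₛ^∞⟮I; F, E⟯} {b : Cₛ^∞⟮I'; F', E'⟯}
    (hb : ProjectsTo q e b) : Ω.muSection e = FormField.pullback qM (Ω'.muSection b) := by
  funext x
  refine (muComp_eq_of_pullback hE hM h x (e x)).trans ?_
  rw [hb x]
  rfl

theorem etaSection_eq_of_projectsTo (hΩ' : Ω'.IsSmooth) {e : Cₛ^∞⟮I; F, E⟯}
    {b : Cₛ^∞⟮I'; F', E'⟯}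
    (hb : ProjectsTo q e b) : Ω.etaSection e = FormField.pullback qM (Ω'.etaSection b) := by
  funext x
  refine (etaComp_eq_of_pullback hE hM h hΩ' x (e x)).trans ?_
  rw [hb x]
  rfl

/-- Holds for every section, projectable or not. This is what allows the bracket of two lifts to be
used before it is known to be projectable. -/
theorem muSection_isHorizontal (e : Cₛ^∞⟮I; F, E⟯) : (Ω.muSection e).IsHorizontal I' qM := by
  rintro x w ⟨i, hi⟩
  refine (DFunLike.congr_fun (muComp_eq_of_pullback hE hM h x (e x)) w).trans ?_
  exact alternating_eq_zero_of_coord (V := B') (muComp Ω' (qM x) (q x (e x))) i hi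

end Components

variable [T2Space M] [SigmaCompactSpace M] [T2Space M'] [SigmaCompactSpace M']
  (hq : IsSimpleQuotient I F I' F' qM q) {n : ℕ} {A : LieAlgebroid I F E}
  {Ω : FormField (I.prod 𝓘(ℝ, F)) (TotalSpace F E) (n + 2)}
  {Ω' : FormField (I'.prod 𝓘(ℝ, F')) (TotalSpace F' E') (n + 2)}
  (hΩ : Ω.IsSmooth) (hIM : SatisfiesIM A (muComp Ω) (etaComp Ω))
  (h : Ω = FormField.pullback (totalMap qM q) Ω') (hΩ' : Ω'.IsSmooth) (hl : IsLinearForm Ω')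
  (hk : ∀ p, Ω'.ker p = ⊥)
include hq hΩ hIM h hΩ' hl hk

/-- The second IM equation is solved for d(i_{ρ(e)}μ(e₂)). The μ of the bracket is horizontal, and
the other terms are contractions of pullbacks, which stay horizontal for any vector field; nothing
about projectability of ρ(e) enters. -/
theorem d_interior_muSection_isHorizontal {e e₂ : Cₛ^∞⟮I; F, E⟯} {b b₂ : Cₛ^∞⟮I'; F', E'⟯}
    (hb : ProjectsTo q e b) (hb₂ : ProjectsTo q e₂ b₂) :
    ((Ω.muSection e₂).interior (A.anchorField e)).d.IsHorizontal I' qM := by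
  have hE := hq.contMDiff_total
  have hM := hq.contMDiff_base
  have hμ := muSection_eq_of_projectsTo hE hM h hb
  have hμ₂ := muSection_eq_of_projectsTo hE hM h hb₂
  have hη := etaSection_eq_of_projectsTo hE hM h hΩ' hb
  have e1 : ((Ω.muSection e₂).interior (A.anchorField e)).d =
      Ω.muSection (A.bracket e e₂) + (Ω.muSection e).d.interior (A.anchorField e₂) +
        (Ω.etaSection e).interior (A.anchorField e₂) -
        (Ω.muSection e₂).d.interior (A.anchorField e) := by
    have h2 : Ω.muSection (A.bracket e e₂) = ((Ω.muSection e₂).d.interior (A.anchorField e) +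
      ((Ω.muSection e₂).interior (A.anchorField e)).d) -
      (Ω.muSection e).d.interior (A.anchorField e₂) -
      (Ω.etaSection e).interior (A.anchorField e₂) := hIM.eq₂ e e₂
    rw [h2]
    abel
  rw [e1, hη, hμ, hμ₂, FormField.d_pullback hM (hΩ'.muSection b),
    FormField.d_pullback hM (hΩ'.muSection b₂)]
  exact ((muSection_isHorizontal hE hM h _).add
    ((FormField.isHorizontal_pullback _).interior _)).add
    ((FormField.isHorizontal_pullback _).interior _) |>.sub
    ((FormField.isHorizontal_pullback _).interior _)

/-- The form i_{ρ(e)}μ(e₂) and its differential are horizontal, so its values agree along the fibre.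
Letting `e₂` range over lifts of all sections and using injectivity of μ̃^♯ isolates the projected
anchor. -/
theorem anchorField_agree {e : Cₛ^∞⟮I; F, E⟯} {b : Cₛ^∞⟮I'; F', E'⟯} (hb : ProjectsTo q e b)
    {x x' : M} (hxx : qM x = qM x') :
    (mfderiv I I' qM x (A.anchorField e x) : B') = mfderiv I I' qM x' (A.anchorField e x') := by
  have hE := hq.contMDiff_total
  have hM := hq.contMDiff_base
  let v : B' := mfderiv I I' qM x (A.anchorField e x)
  let v' : B' := mfderiv I I' qM x' (A.anchorField e x')
  have key : ∀ e' : E' (qM x), contract (muComp Ω' (qM x) e') (v - v' : B') = 0 := by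
    intro e'
    obtain ⟨b₂, rfl⟩ := exists_section_through (I := I') (F := F') (qM x) e'
    obtain ⟨e₂, hb₂⟩ := hq.exists_projectsTo b₂
    have hμ₂ := muSection_eq_of_projectsTo hE hM h hb₂
    have hag := FormField.agreeAt_of_connected_fibers hM hq.submersion_base
      (fun y => (hq.connected_fibers y).isPreconnected)
      ((hΩ.muSection e₂).interior (A.isSmoothField_anchorField e))
      ((muSection_isHorizontal hE hM h e₂).interior _)
      (d_interior_muSection_isHorizontal hq hΩ hIM h hΩ' hl hk hb hb₂) hxx
    let β : B' [⋀^Fin (n + 1)]→L[ℝ] ℝ := Ω'.muSection b₂ (qM x)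
    have h1 : β.curryLeft v = β.curryLeft v' := by
      ext u
      choose w hw using fun i => hq.submersion_base x (u i)
      choose w' hw' using fun i => hq.submersion_base x' (u i)
      have h2 := hag w w' fun i => (hw i).trans (hw' i).symm
      rw [hμ₂] at h2
      have h3 : β (Matrix.vecCons v u) = (FormField.pullback (I := I) qM
          (Ω'.muSection b₂)).interior (A.anchorField e) x w := by
        refine congrArg β (funext fun i => ?_)
        exact Fin.cases rfl (fun j => (hw j).symm) i
      have h4 : (Ω'.muSection b₂ (qM x') : B' [⋀^Fin (n + 1)]→L[ℝ] ℝ) (Matrix.vecCons v' u) =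
          (FormField.pullback (I := I) qM
          (Ω'.muSection b₂)).interior (A.anchorField e) x' w' := by
        refine congrArg (Ω'.muSection b₂ (qM x') : B' [⋀^Fin (n + 1)]→L[ℝ] ℝ)
          (funext fun i => ?_)
        exact Fin.cases rfl (fun j => (hw' j).symm) i
      have h5 : (Ω'.muSection b₂ (qM x') : B' [⋀^Fin (n + 1)]→L[ℝ] ℝ) = β := by
        have h6 : ∀ y, y = qM x → (Ω'.muSection b₂ y : B' [⋀^Fin (n + 1)]→L[ℝ] ℝ) = β := by
          rintro _ rfl
          rfl
        exact h6 _ hxx.symm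
      rw [h5] at h4
      exact h3.trans (h2.trans h4.symm)
    exact (map_sub β.curryLeft v v').trans (sub_eq_zero.mpr h1)
  exact sub_eq_zero.mp (eq_zero_of_contract_muComp_eq_zero hΩ' hl hk (qM x) (v - v' : B') key)

/-- Here μ(e) = 0, so the first IM equation gives i_{ρ(e)}μ(e₂) = 0 for every projectable `e₂`, and
injectivity of μ̃^♯ applies. -/
theorem anchor_ker {e : Cₛ^∞⟮I; F, E⟯} (he : ProjectsTo q e (0 : Cₛ^∞⟮I'; F', E'⟯)) (x : M) :
    mfderiv I I' qM x (A.anchorField e x) = 0 := by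
  have hE := hq.contMDiff_total
  have hM := hq.contMDiff_base
  refine eq_zero_of_contract_muComp_eq_zero hΩ' hl hk (qM x) _ fun e' => ?_
  obtain ⟨b₂, rfl⟩ := exists_section_through (I := I') (F := F') (qM x) e'
  obtain ⟨e₂, hb₂⟩ := hq.exists_projectsTo b₂
  have hμ₂ := muSection_eq_of_projectsTo hE hM h hb₂
  have h1 : (Ω.muSection e₂).interior (A.anchorField e) =
    -(Ω.muSection e).interior (A.anchorField e₂) := hIM.eq₁ e e₂
  rw [hμ₂] at h1
  refine ContinuousAlternatingMap.ext (M := B') (N := ℝ) fun u => ?_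
  choose w hw using fun i => hq.submersion_base x (u i)
  have h2 := DFunLike.congr_fun (congrFun h1 x) w
  have h3 : (Ω'.muSection b₂ (qM x) : B' [⋀^Fin (n + 1)]→L[ℝ] ℝ)
      (Matrix.vecCons (mfderiv I I' qM x (A.anchorField e x) : B') u) = (FormField.pullback (I := I)
      qM (Ω'.muSection b₂)).interior (A.anchorField e) x w := by
    refine congrArg (Ω'.muSection b₂ (qM x) : B' [⋀^Fin (n + 1)]→L[ℝ] ℝ) (funext fun i => ?_)
    exact Fin.cases rfl (fun j => (hw j).symm) i
  refine h3.trans (h2.trans ?_)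
  have h4 : muComp Ω x (e x) = 0 := by
    refine (muComp_eq_of_pullback hE hM h x (e x)).trans ?_
    rw [he x]
    refine ContinuousAlternatingMap.ext (M := B) (N := ℝ) fun u => ?_
    refine (coreContraction_apply Ω' (qM x) _ _).trans ?_
    refine ContinuousAlternatingMap.map_coord_zero (M := B' × F') _ 0 ?_
    have h0 := fiberCoord_zero (F := F') (E := E')
      (FiberBundle.mem_baseSet_trivializationAt' (qM x))
    exact Prod.ext rfl h0
  have h5 : (Ω.muSection e x : B [⋀^Fin (n + 1)]→L[ℝ] ℝ)
    (Matrix.vecCons (A.anchorField e₂ x : B) w) = 0 :=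
    DFunLike.congr_fun (F := B [⋀^Fin (n + 1)]→L[ℝ] ℝ) h4 _
  exact neg_eq_zero.mpr h5

/-- Take a section of the quotient through the common image and lift it through each of the two
points. Moving one lift along the fibre preserves the projected anchor, and the difference of the
two lifts projects to zero. -/
theorem anchor_agree (p p' : TotalSpace F E)
    (hp : (totalMap qM q p : TotalSpace F' E') = totalMap qM q p') :
    (mfderiv I I' qM p.proj (A.anchor p.proj p.2) : B') =
      mfderiv I I' qM p'.proj (A.anchor p'.proj p'.2) := by
  obtain ⟨x, e⟩ := p
  obtain ⟨x', e'⟩ := p'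
  have hxx : qM x = qM x' := congrArg TotalSpace.proj hp
  obtain ⟨b, hb⟩ := exists_section_through (I := I') (F := F') (qM x) (q x e)
  obtain ⟨s, hs, rfl⟩ := hq.exists_lift b x e hb.symm
  have hb' : q x' e' = b (qM x') := by
    have h1 : ∀ y (u : E' y), (⟨qM x, b (qM x)⟩ : TotalSpace F' E') = ⟨y, u⟩ → u = b y := by
      rintro y u hu
      obtain ⟨rfl, hu⟩ := TotalSpace.mk.inj hu
      exact (eq_of_heq hu).symm
    refine h1 _ _ ?_
    rw [hb]
    exact hp
  obtain ⟨s', hs', rfl⟩ := hq.exists_lift b x' e' hb'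
  refine (anchorField_agree hq hΩ hIM h hΩ' hl hk hs hxx).trans ?_
  have h0 : ProjectsTo q (s - s' : Cₛ^∞⟮I; F, E⟯) (0 : Cₛ^∞⟮I'; F', E'⟯) := by
    intro z
    have h1 : (s - s' : Cₛ^∞⟮I; F, E⟯) z = s z - s' z := rfl
    rw [h1, map_sub, hs z, hs' z, sub_self]
    rfl
  have h1 := anchor_ker hq hΩ hIM h hΩ' hl hk h0 x'
  have h2 : (A.anchorField (s - s') x' : B) = (A.anchorField s x' : B) - A.anchorField s' x' :=
    map_sub (A.anchor x') (s x') (s' x')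
  have h3 := (congrArg (mfderiv I I' qM x' : B →L[ℝ] B') h2).symm.trans h1
  exact sub_eq_zero.mp ((map_sub (mfderiv I I' qM x' : B →L[ℝ] B') _ _).symm.trans h3)

/-- The anchor descends to the quotient. -/
theorem exists_quotient_anchor : ∃ L : ∀ y : M', E' y →ₗ[ℝ] TangentSpace I' y,
    (∀ x (e : E x), mfderiv I I' qM x (A.anchor x e) = L (qM x) (q x e)) ∧
    ContMDiff (I'.prod 𝓘(ℝ, F')) I'.tangent ∞
      (fun p : TotalSpace F' E' => (⟨p.proj, L p.proj p.2⟩ : TangentBundle I' M')) := by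
  have h1 : ∀ y : M', ∃ L : E' y →ₗ[ℝ] TangentSpace I' y, ∀ (p : TotalSpace F E) (e' : E' y),
      (totalMap qM q p : TotalSpace F' E') = ⟨y, e'⟩ →
      (mfderiv I I' qM p.proj (A.anchor p.proj p.2) : B') = L e' := by
    intro y
    obtain ⟨x, rfl⟩ := hq.surjective_base y
    obtain ⟨R, hR⟩ := LinearMap.exists_rightInverse_of_surjective (q x)
      (LinearMap.range_eq_top.mpr (hq.surjective_fiber x))
    -- The fibre map is defined linearly from one chosen `x` over `y` and a right inverse of `q x`;
    -- `anchor_agree` shows that it gives the right value at every point above `y`.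
    refine ⟨((mfderiv I I' qM x).toLinearMap.comp (A.anchor x)).comp R, fun p e' hp => ?_⟩
    refine anchor_agree hq hΩ hIM h hΩ' hl hk p ⟨x, R e'⟩ (hp.trans ?_)
    exact congrArg (TotalSpace.mk' F' (qM x)) (LinearMap.congr_fun hR e').symm
  choose L hL using h1
  refine ⟨L, fun x e => hL (qM x) ⟨x, e⟩ (q x e) rfl, ?_⟩
  refine ContMDiff.of_comp_submersion (I := I.prod 𝓘(ℝ, F)) hq.contMDiff_total hq.surjective_total
    hq.submersion_total ?_
  have h2 := (hq.contMDiff_base.contMDiff_tangentMap (m := ∞) (by simp)).comp A.contMDiff_anchor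
  refine h2.congr fun p => ?_
  exact congrArg (TotalSpace.mk' B' (qM p.proj)) (hL (qM p.proj) p (q p.proj p.2) rfl).symm

end Descent

/-! ### Descent of the bracket -/

section QuotientBracket

variable {B H M : Type*} [NormedAddCommGroup B] [NormedSpace ℝ B] [TopologicalSpace H]
  {I : ModelWithCorners ℝ B H} [I.Boundaryless] [TopologicalSpace M] [ChartedSpace H M]
  {F : Type*} [NormedAddCommGroup F] [NormedSpace ℝ F]
  {E : M → Type*} [TopologicalSpace (TotalSpace F E)] [∀ x, TopologicalSpace (E x)]
  [∀ x, AddCommGroup (E x)] [∀ x, Module ℝ (E x)] [FiberBundle F E] [VectorBundle ℝ F E]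
  [IsManifold I ∞ M] [ContMDiffVectorBundle ∞ F E I]
  [FiniteDimensional ℝ B] [FiniteDimensional ℝ F]

theorem muComp_injective {k : ℕ}
    {Ω : FormField (I.prod 𝓘(ℝ, F)) (TotalSpace F E) (k + 1)} (hΩ : Ω.IsSmooth)
    (hl : IsLinearForm Ω) (hk : ∀ p, Ω.ker p = ⊥) {x : M} {e e' : E x}
    (he : muComp Ω x e = muComp Ω x e') : e = e' := by
  refine sub_eq_zero.mp (eq_zero_of_muComp_eq_zero hΩ hl hk x (e - e') ?_)
  refine ContinuousAlternatingMap.ext (M := B) (N := ℝ) fun u => ?_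
  refine (coreContraction_apply Ω x _ u).trans ?_
  have hb := FiberBundle.mem_baseSet_trivializationAt' (F := F) (E := E) x
  have h1 : fiberCoord F x ⟨x, e - e'⟩ = fiberCoord F x ⟨x, e⟩ - fiberCoord F x ⟨x, e'⟩ := by
    refine eq_sub_of_add_eq ((fiberCoord_add hb (e - e') e').symm.trans ?_)
    rw [sub_add_cancel]
  have h2 : ((0, fiberCoord F x ⟨x, e - e'⟩) : B × F) =
      ((0, fiberCoord F x ⟨x, e⟩) : B × F) - (0, fiberCoord F x ⟨x, e'⟩) := by
    rw [h1, Prod.mk_sub_mk, sub_zero]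
  have h3 := (coreContraction_apply Ω x e u).symm.trans
    ((DFunLike.congr_fun (F := B [⋀^Fin k]→L[ℝ] ℝ) he u).trans (coreContraction_apply Ω x e' u))
  let α : (B × F) [⋀^Fin (k + 1)]→L[ℝ] ℝ := Ω ⟨x, 0⟩
  have h4 := DFunLike.congr_fun (congrArg α.curryLeft h2) fun i => ((u i, 0) : B × F)
  refine h4.trans ((DFunLike.congr_fun (map_sub α.curryLeft _ _) _).trans ?_)
  exact sub_eq_zero.mpr h3

variable {B' H' M' : Type*} [NormedAddCommGroup B'] [NormedSpace ℝ B'] [TopologicalSpace H']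
  {I' : ModelWithCorners ℝ B' H'} [I'.Boundaryless] [TopologicalSpace M'] [ChartedSpace H' M']
  {F' : Type*} [NormedAddCommGroup F'] [NormedSpace ℝ F']
  {E' : M' → Type*} [TopologicalSpace (TotalSpace F' E')] [∀ x, TopologicalSpace (E' x)]
  [∀ x, AddCommGroup (E' x)] [∀ x, Module ℝ (E' x)] [FiberBundle F' E'] [VectorBundle ℝ F' E']
  [IsManifold I' ∞ M'] [ContMDiffVectorBundle ∞ F' E' I']
  [FiniteDimensional ℝ B'] [FiniteDimensional ℝ F']
  {qM : M → M'} {q : ∀ x, E x →ₗ[ℝ] E' (qM x)}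
  {n : ℕ} {A : LieAlgebroid I F E}
  {Ω : FormField (I.prod 𝓘(ℝ, F)) (TotalSpace F E) (n + 2)}
  {Ω' : FormField (I'.prod 𝓘(ℝ, F')) (TotalSpace F' E') (n + 2)}

theorem interior_muSection_eq_pullback (hq : IsSimpleQuotient I F I' F' qM q)
    (h : Ω = FormField.pullback (totalMap qM q) Ω')
    {e₁ e₂ : Cₛ^∞⟮I; F, E⟯} {b₂ : Cₛ^∞⟮I'; F', E'⟯} (h₂ : ProjectsTo q e₂ b₂)
    {v₁ : ∀ y : M', TangentSpace I' y}
    (hv₁ : ∀ x, mfderiv I I' qM x (A.anchorField e₁ x) = v₁ (qM x)) :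
    (Ω.muSection e₂).interior (A.anchorField e₁) =
      FormField.pullback qM ((Ω'.muSection b₂).interior v₁) := by
  rw [muSection_eq_of_projectsTo hq.contMDiff_total hq.contMDiff_base h h₂]
  exact FormField.interior_pullback hv₁ _

variable (hq : IsSimpleQuotient I F I' F' qM q) (hIM : SatisfiesIM A (muComp Ω) (etaComp Ω))
  (h : Ω = FormField.pullback (totalMap qM q) Ω') (hΩ' : Ω'.IsSmooth)

section Pullback

variable {e₁ e₂ : Cₛ^∞⟮I; F, E⟯} {b₁ b₂ : Cₛ^∞⟮I'; F', E'⟯} (h₁ : ProjectsTo q e₁ b₁)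
  (h₂ : ProjectsTo q e₂ b₂)
  {v₁ v₂ : ∀ y : M', TangentSpace I' y} (hs₁ : IsSmoothField v₁)
  (hv₁ : ∀ x, mfderiv I I' qM x (A.anchorField e₁ x) = v₁ (qM x))
  (hv₂ : ∀ x, mfderiv I I' qM x (A.anchorField e₂ x) = v₂ (qM x))
include hq hIM h hΩ' h₁ h₂ hs₁ hv₁ hv₂

/-- Every term on the right of the second IM equation is natural for related vector fields. The
result depends on the lifts only through their projections. -/
theorem muSection_bracket_eq_pullback : Ω.muSection (A.bracket e₁ e₂) =
    FormField.pullback qM ((Ω'.muSection b₂).lieDeriv v₁ - (Ω'.muSection b₁).d.interior v₂ -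
      (Ω'.etaSection b₁).interior v₂) := by
  have hE := hq.contMDiff_total
  have hM := hq.contMDiff_base
  have h0 : Ω.muSection (A.bracket e₁ e₂) = (Ω.muSection e₂).lieDeriv (A.anchorField e₁) -
      (Ω.muSection e₁).d.interior (A.anchorField e₂) -
      (Ω.etaSection e₁).interior (A.anchorField e₂) := hIM.eq₂ e₁ e₂
  rw [h0, muSection_eq_of_projectsTo hE hM h h₁, muSection_eq_of_projectsTo hE hM h h₂,
    etaSection_eq_of_projectsTo hE hM h hΩ' h₁,
    FormField.lieDeriv_pullback hM hs₁ hv₁ (hΩ'.muSection b₂),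
    FormField.d_pullback hM (hΩ'.muSection b₁), FormField.interior_pullback hv₂,
    FormField.interior_pullback hv₂]
  rfl

theorem etaSection_bracket_eq_pullback : Ω.etaSection (A.bracket e₁ e₂) =
    FormField.pullback qM ((Ω'.etaSection b₂).lieDeriv v₁ -
      (Ω'.etaSection b₁).d.interior v₂) := by
  have hE := hq.contMDiff_total
  have hM := hq.contMDiff_base
  have h0 : Ω.etaSection (A.bracket e₁ e₂) = (Ω.etaSection e₂).lieDeriv (A.anchorField e₁) -
      (Ω.etaSection e₁).d.interior (A.anchorField e₂) := hIM.eq₃ e₁ e₂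
  rw [h0, etaSection_eq_of_projectsTo hE hM h hΩ' h₁, etaSection_eq_of_projectsTo hE hM h hΩ' h₂,
    FormField.lieDeriv_pullback hM hs₁ hv₁ (hΩ'.etaSection b₂),
    FormField.d_pullback hM (hΩ'.etaSection b₁), FormField.interior_pullback hv₂]
  rfl

end Pullback

include hq hIM h hΩ'

/-- The brackets of projectable sections are projectable. -/
theorem exists_quotient_bracket [T2Space M] [SigmaCompactSpace M]
    (hl : IsLinearForm Ω') (hk : ∀ p, Ω'.ker p = ⊥)
    {L : ∀ y : M', E' y →ₗ[ℝ] TangentSpace I' y}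
    (hL : ∀ x (e : E x), mfderiv I I' qM x (A.anchor x e) = L (qM x) (q x e))
    (hLs : ContMDiff (I'.prod 𝓘(ℝ, F')) I'.tangent ∞
      (fun p : TotalSpace F' E' => (⟨p.proj, L p.proj p.2⟩ : TangentBundle I' M')))
    (b₁ b₂ : Cₛ^∞⟮I'; F', E'⟯) : ∃ b₃ : Cₛ^∞⟮I'; F', E'⟯, ∀ e₁ e₂ : Cₛ^∞⟮I; F, E⟯,
      ProjectsTo q e₁ b₁ → ProjectsTo q e₂ b₂ → ProjectsTo q (A.bracket e₁ e₂) b₃ := by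
  have hE := hq.contMDiff_total
  have hM := hq.contMDiff_base
  have hrel : ∀ {e : Cₛ^∞⟮I; F, E⟯} {b : Cₛ^∞⟮I'; F', E'⟯}, ProjectsTo q e b → ∀ x,
      mfderiv I I' qM x (A.anchorField e x) = L (qM x) (b (qM x)) :=
    fun {e b} hb x => (hL x (e x)).trans (congrArg (L (qM x)) (hb x))
  have hs : ∀ b : Cₛ^∞⟮I'; F', E'⟯, IsSmoothField (fun y => L y (b y)) :=
    fun b => hLs.comp b.contMDiff
  -- The right side of the second IM equation on the quotient, written with the descended anchor; it
  -- is the only possible value of μ̃ on the bracket of `b₁` and `b₂`.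
  let Θ : FormField I' M' (n + 1) := (Ω'.muSection b₂).lieDeriv (fun y => L y (b₁ y)) -
    (Ω'.muSection b₁).d.interior (fun y => L y (b₂ y)) -
      (Ω'.etaSection b₁).interior (fun y => L y (b₂ y))
  have key : ∀ e₁ e₂ : Cₛ^∞⟮I; F, E⟯, ProjectsTo q e₁ b₁ → ProjectsTo q e₂ b₂ → ∀ x,
      muComp Ω' (qM x) (q x (A.bracket e₁ e₂ x)) = Θ (qM x) := by
    intro e₁ e₂ h₁ h₂ x
    have h3 := (muComp_eq_of_pullback hE hM h x (A.bracket e₁ e₂ x)).symm.trans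
      (congrFun (muSection_bracket_eq_pullback (v₂ := fun y => L y (b₂ y)) hq hIM h hΩ' h₁ h₂
        (hs b₁) (hrel h₁) (hrel h₂)) x)
    refine ContinuousAlternatingMap.ext (M := B') (N := ℝ) fun u => ?_
    choose w hw using fun i => hq.submersion_base x (u i)
    obtain rfl := funext hw
    exact DFunLike.congr_fun (F := B [⋀^Fin (n + 1)]→L[ℝ] ℝ) h3 w
  have hex : ∀ y : M', ∃ u : E' y, muComp Ω' y u = Θ y := by
    intro y
    obtain ⟨x, rfl⟩ := hq.surjective_base y
    obtain ⟨e₁, h₁⟩ := hq.exists_projectsTo b₁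
    obtain ⟨e₂, h₂⟩ := hq.exists_projectsTo b₂
    exact ⟨_, key e₁ e₂ h₁ h₂ x⟩
  -- The vector is unique since μ̃ is injective, so brackets of all lifts project to the same β. Its
  -- smoothness follows by descent from the bracket of one pair of lifts.
  choose β hβ using hex
  have key' : ∀ e₁ e₂ : Cₛ^∞⟮I; F, E⟯, ProjectsTo q e₁ b₁ → ProjectsTo q e₂ b₂ →
      ProjectsTo q (A.bracket e₁ e₂) β := fun e₁ e₂ h₁ h₂ x =>
    muComp_injective hΩ' hl hk ((key e₁ e₂ h₁ h₂ x).trans (hβ _).symm)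
  obtain ⟨e₁, h₁⟩ := hq.exists_projectsTo b₁
  obtain ⟨e₂, h₂⟩ := hq.exists_projectsTo b₂
  refine ⟨⟨β, ?_⟩, key'⟩
  refine ContMDiff.of_comp_submersion (I := I) hM hq.surjective_base hq.submersion_base ?_
  refine (hE.comp (A.bracket e₁ e₂).contMDiff).congr fun x => ?_
  exact congrArg (TotalSpace.mk' F' (qM x)) (key' e₁ e₂ h₁ h₂ x).symm

end QuotientBracket

/-! ### From projectable brackets to a Lie algebroid morphism -/

section QuotientAlgebroid

variable {B H M : Type*} [NormedAddCommGroup B] [NormedSpace ℝ B] [TopologicalSpace H]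
  {I : ModelWithCorners ℝ B H} [I.Boundaryless] [TopologicalSpace M] [ChartedSpace H M]
  {F : Type*} [NormedAddCommGroup F] [NormedSpace ℝ F]
  {E : M → Type*} [TopologicalSpace (TotalSpace F E)] [∀ x, TopologicalSpace (E x)]
  [∀ x, AddCommGroup (E x)] [∀ x, Module ℝ (E x)] [FiberBundle F E] [VectorBundle ℝ F E]
  [IsManifold I ∞ M] [ContMDiffVectorBundle ∞ F E I]
  [FiniteDimensional ℝ B] [FiniteDimensional ℝ F]

/-- Evaluation of sections at a point. -/
def sectionEval (x : M) : Cₛ^∞⟮I; F, E⟯ →ₗ[ℝ] E x where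
  toFun s := s x
  map_add' _ _ := rfl
  map_smul' _ _ := rfl

theorem exists_fun_smul_section {f : M → ℝ} (hf : ContMDiff I 𝓘(ℝ, ℝ) ∞ f)
    (s : Cₛ^∞⟮I; F, E⟯) : ∃ fs : Cₛ^∞⟮I; F, E⟯, ∀ x, fs x = f x • s x :=
  ⟨⟨fun x => f x • s x, hf.smul_section s.contMDiff⟩, fun _ => rfl⟩

theorem dirDeriv_add_vector {x : M} (v w : TangentSpace I x) (f : M → ℝ) :
    dirDeriv (v + w) f = dirDeriv v f + dirDeriv w f :=
  map_add (mfderiv I 𝓘(ℝ, ℝ) f x : B →L[ℝ] ℝ) v w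

theorem dirDeriv_sum_smul_vector {ι : Type*} (s : Finset ι) {x : M} (c : ι → ℝ)
    (v : ι → TangentSpace I x) (f : M → ℝ) :
    dirDeriv (∑ a ∈ s, c a • v a) f = ∑ a ∈ s, c a * dirDeriv (v a) f := by
  have h : ∀ (D : B →L[ℝ] ℝ) (v : ι → B), D (∑ a ∈ s, c a • v a) = ∑ a ∈ s, c a * D (v a) :=
    fun D v => by simp
  exact h (mfderiv I 𝓘(ℝ, ℝ) f x) v

variable {B' H' M' : Type*} [NormedAddCommGroup B'] [NormedSpace ℝ B'] [TopologicalSpace H']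
  {I' : ModelWithCorners ℝ B' H'} [I'.Boundaryless] [TopologicalSpace M'] [ChartedSpace H' M']
  {F' : Type*} [NormedAddCommGroup F'] [NormedSpace ℝ F']
  {E' : M' → Type*} [TopologicalSpace (TotalSpace F' E')] [∀ x, TopologicalSpace (E' x)]
  [∀ x, AddCommGroup (E' x)] [∀ x, Module ℝ (E' x)] [FiberBundle F' E'] [VectorBundle ℝ F' E']
  [IsManifold I' ∞ M'] [ContMDiffVectorBundle ∞ F' E' I']
  [FiniteDimensional ℝ B'] [FiniteDimensional ℝ F']
  {qM : M → M'} {q : ∀ x, E x →ₗ[ℝ] E' (qM x)} {A : LieAlgebroid I F E}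

theorem ProjectsTo.unique (hsurj : Function.Surjective qM) {e : ∀ x, E x}
    {b b' : Cₛ^∞⟮I'; F', E'⟯} (h : ProjectsTo q e b) (h' : ProjectsTo q e b') : b = b' := by
  refine ContMDiffSection.ext fun y => ?_
  obtain ⟨x, rfl⟩ := hsurj y
  exact (h x).symm.trans (h' x)

theorem ProjectsTo.add {e₁ e₂ : Cₛ^∞⟮I; F, E⟯} {b₁ b₂ : Cₛ^∞⟮I'; F', E'⟯}
    (h₁ : ProjectsTo q e₁ b₁) (h₂ : ProjectsTo q e₂ b₂) :
    ProjectsTo q (e₁ + e₂ : Cₛ^∞⟮I; F, E⟯) (b₁ + b₂ : Cₛ^∞⟮I'; F', E'⟯) := fun x =>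
  (map_add (q x) _ _).trans (congrArg₂ (· + ·) (h₁ x) (h₂ x))

theorem ProjectsTo.smul (c : ℝ) {e : Cₛ^∞⟮I; F, E⟯} {b : Cₛ^∞⟮I'; F', E'⟯}
    (h : ProjectsTo q e b) :
    ProjectsTo q (c • e : Cₛ^∞⟮I; F, E⟯) (c • b : Cₛ^∞⟮I'; F', E'⟯) := fun x =>
  (map_smul (q x) _ _).trans (congrArg (c • ·) (h x))

/-- The brackets of lifts of two sections project to the bracket of the sections. -/
def BracketProjects (q : ∀ x, E x →ₗ[ℝ] E' (qM x)) (A : LieAlgebroid I F E)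
    (A' : LieAlgebroid I' F' E') : Prop :=
  ∀ (e₁ e₂ : Cₛ^∞⟮I; F, E⟯) (b₁ b₂ : Cₛ^∞⟮I'; F', E'⟯), ProjectsTo q e₁ b₁ →
    ProjectsTo q e₂ b₂ → ProjectsTo q (A.bracket e₁ e₂) (A'.bracket b₁ b₂)

section Morphism

variable [T2Space M] [SigmaCompactSpace M] (hq : IsSimpleQuotient I F I' F' qM q)

include hq in
/-- A section which projects to a combination `∑ g_c (b_c ∘ q_M)` is `∑ g_c e_c + κ`, where `e_c`
projects to `b_c` and `κ` projects to zero. -/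
theorem IsSimpleQuotient.exists_decomposition {n : ℕ} {g : Fin n → M → ℝ}
    (hg : ∀ c, ContMDiff I 𝓘(ℝ, ℝ) ∞ (g c)) {b : Fin n → Cₛ^∞⟮I'; F', E'⟯} {e : Cₛ^∞⟮I; F, E⟯}
    (he : ∀ x, q x (e x) = ∑ c, g c x • b c (qM x)) :
    ∃ (s gs : Fin n → Cₛ^∞⟮I; F, E⟯) (κ : Cₛ^∞⟮I; F, E⟯), (∀ c, ProjectsTo q (s c) (b c)) ∧
      (∀ c x, gs c x = g c x • s c x) ∧ ProjectsTo q κ (0 : Cₛ^∞⟮I'; F', E'⟯) ∧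
      e = ∑ c, gs c + κ := by
  choose s hs using fun c => hq.exists_projectsTo (b c)
  choose gs hgs using fun c => exists_fun_smul_section (hg c) (s c)
  refine ⟨s, gs, e - ∑ c, gs c, hs, hgs, fun x => ?_, (add_sub_cancel _ _).symm⟩
  have h1 : (e - ∑ c, gs c : Cₛ^∞⟮I; F, E⟯) x = e x - ∑ c, g c x • s c x := by
    refine (map_sub (sectionEval x) e _).trans (congrArg (e x - ·) ?_)
    exact (map_sum (sectionEval x) gs _).trans (Finset.sum_congr rfl fun c _ => hgs c x)
  rw [h1, map_sub, he, map_sum]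
  refine sub_eq_zero.mpr (Finset.sum_congr rfl fun c _ => ?_)
  rw [map_smul, hs c x]

variable {A' : LieAlgebroid I' F' E'} (hbr : BracketProjects q A A')
include hq hbr

/-- Decompose the second section into multiples of lifts and a remainder projecting to zero. The
Leibniz identity treats the multiples, and the bracket with the remainder projects to a bracket with
zero. -/
theorem BracketProjects.apply_bracket_right {e₁ e₂ : Cₛ^∞⟮I; F, E⟯} {b : Cₛ^∞⟮I'; F', E'⟯}
    (h₁ : ProjectsTo q e₁ b) {n : ℕ} {g : Fin n → M → ℝ}
    (hg : ∀ c, ContMDiff I 𝓘(ℝ, ℝ) ∞ (g c)) {b' : Fin n → Cₛ^∞⟮I'; F', E'⟯}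
    (h₂ : ∀ x, q x (e₂ x) = ∑ c, g c x • b' c (qM x)) (x : M) :
    q x (A.bracket e₁ e₂ x) = ∑ c, g c x • A'.bracket b (b' c) (qM x) +
      ∑ c, dirDeriv (A.anchor x (e₁ x)) (g c) • b' c (qM x) := by
  obtain ⟨s, gs, κ, hs, hgs, hκ, rfl⟩ := hq.exists_decomposition hg h₂
  have h1 : A.bracket e₁ (∑ c, gs c + κ) x = ∑ c, A.bracket e₁ (gs c) x + A.bracket e₁ κ x := by
    rw [map_add, map_sum]
    exact (map_add (sectionEval x) _ _).trans (congrArg (· + _) (map_sum (sectionEval x) _ _))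
  have h2 : q x (A.bracket e₁ κ x) = 0 := by
    rw [hbr _ _ _ _ h₁ hκ x, map_zero]
    rfl
  rw [h1, map_add, map_sum, h2, add_zero, ← Finset.sum_add_distrib]
  refine Finset.sum_congr rfl fun c _ => ?_
  rw [A.leibniz e₁ (s c) (gs c) (g c) (hg c) (hgs c), map_add, map_smul, map_smul, hs c x,
    hbr _ _ _ _ h₁ (hs c) x]

/-- The first section is decomposed in the same way. Its remainder κ projects to zero but
contributes the derivatives of `g` along ρ(κ), and these complete the anchor term of the whole
section. -/
theorem BracketProjects.isLieAlgebroidMorphism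
    (hanchor : ∀ x (e : E x), mfderiv I I' qM x (A.anchor x e) = A'.anchor (qM x) (q x e)) :
    IsLieAlgebroidMorphism A A' qM q where
  contMDiff_base := hq.contMDiff_base
  contMDiff_total := hq.contMDiff_total
  anchor := hanchor
  bracket := by
    intro e₁ e₂ m n f g b b' hf hg h₁ h₂ x
    obtain ⟨s, fs, κ, hs, hfs, hκ, rfl⟩ := hq.exists_decomposition hf h₁
    have h1 : A.bracket (∑ a, fs a + κ) e₂ x = ∑ a, A.bracket (fs a) e₂ x + A.bracket κ e₂ x := by
      rw [map_add, map_sum, LinearMap.add_apply, LinearMap.sum_apply]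
      exact (map_add (sectionEval x) _ _).trans (congrArg (· + _) (map_sum (sectionEval x) _ _))
    have h2 : q x (A.bracket κ e₂ x) = ∑ c, dirDeriv (A.anchor x (κ x)) (g c) • b' c (qM x) := by
      rw [hbr.apply_bracket_right hq hκ hg h₂ x]
      refine (congrArg (· + _) (Finset.sum_eq_zero fun c _ => ?_)).trans (zero_add _)
      rw [map_zero, LinearMap.zero_apply]
      exact smul_zero _
    have h3 : ∀ a, q x (A.bracket (fs a) e₂ x) =
        f a x • (∑ c, g c x • A'.bracket (b a) (b' c) (qM x) +
          ∑ c, dirDeriv (A.anchor x (s a x)) (g c) • b' c (qM x)) -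
        dirDeriv (A.anchor x (e₂ x)) (f a) • b a (qM x) := by
      intro a
      -- The Leibniz identity concerns the second entry, so antisymmetry is used before and after;
      -- this produces the minus sign of the derivative of `f`.
      rw [A.bracket_swap, ← hbr.apply_bracket_right hq (hs a) hg h₂ x, A.bracket_swap (s a) e₂]
      have h4 : (-A.bracket e₂ (fs a) : Cₛ^∞⟮I; F, E⟯) x =
        -(f a x • A.bracket e₂ (s a) x + dirDeriv (A.anchor x (e₂ x)) (f a) • s a x) :=
        congrArg (- ·) (A.leibniz e₂ (s a) (fs a) (f a) (hf a) (hfs a) x)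
      have h5 : (-A.bracket e₂ (s a) : Cₛ^∞⟮I; F, E⟯) x = -A.bracket e₂ (s a) x := rfl
      rw [h4, h5, map_neg, map_add, map_smul, map_smul, map_neg, hs a x, smul_neg, neg_add,
        sub_eq_add_neg]
    have h6 : ∀ c, dirDeriv (A.anchor x ((∑ a, fs a + κ : Cₛ^∞⟮I; F, E⟯) x)) (g c) =
        ∑ a, f a x * dirDeriv (A.anchor x (s a x)) (g c) +
          dirDeriv (A.anchor x (κ x)) (g c) := by
      intro c
      have h7 : (∑ a, fs a + κ : Cₛ^∞⟮I; F, E⟯) x = ∑ a, f a x • s a x + κ x := by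
        refine (map_add (sectionEval x) _ κ).trans (congrArg (· + κ x) ?_)
        exact (map_sum (sectionEval x) fs _).trans (Finset.sum_congr rfl fun a _ => hfs a x)
      have h8 : A.anchor x ((∑ a, fs a + κ : Cₛ^∞⟮I; F, E⟯) x) =
          ∑ a, f a x • A.anchor x (s a x) + A.anchor x (κ x) := by
        rw [h7, map_add, map_sum]
        exact congrArg (· + _) (Finset.sum_congr rfl fun a _ => map_smul _ _ _)
      rw [h8, dirDeriv_add_vector, dirDeriv_sum_smul_vector]
    rw [h1, map_add, map_sum, h2, Finset.sum_congr rfl fun a _ => h3 a, Finset.sum_sub_distrib,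
      Finset.sum_congr rfl fun c _ => congrArg (· • b' c (qM x)) (h6 c)]
    simp only [smul_add, add_smul, Finset.sum_add_distrib, Finset.smul_sum, Finset.sum_smul,
      smul_smul]
    rw [Finset.sum_comm (f := fun c a => (f a x * dirDeriv (A.anchor x (s a x)) (g c)) •
      b' c (qM x))]
    abel

end Morphism

end QuotientAlgebroid

/-! ### The quotient Lie algebroid and the theorem -/

section QuotientTheorem

variable {B H M : Type*} [NormedAddCommGroup B] [NormedSpace ℝ B] [TopologicalSpace H]
  {I : ModelWithCorners ℝ B H} [I.Boundaryless] [TopologicalSpace M] [ChartedSpace H M]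
  {F : Type*} [NormedAddCommGroup F] [NormedSpace ℝ F]
  {E : M → Type*} [TopologicalSpace (TotalSpace F E)] [∀ x, TopologicalSpace (E x)]
  [∀ x, AddCommGroup (E x)] [∀ x, Module ℝ (E x)] [FiberBundle F E] [VectorBundle ℝ F E]
  [IsManifold I ∞ M] [ContMDiffVectorBundle ∞ F E I]
  [FiniteDimensional ℝ B] [FiniteDimensional ℝ F]
  {B' H' M' : Type*} [NormedAddCommGroup B'] [NormedSpace ℝ B'] [TopologicalSpace H']
  {I' : ModelWithCorners ℝ B' H'} [I'.Boundaryless] [TopologicalSpace M'] [ChartedSpace H' M']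
  {F' : Type*} [NormedAddCommGroup F'] [NormedSpace ℝ F']
  {E' : M' → Type*} [TopologicalSpace (TotalSpace F' E')] [∀ x, TopologicalSpace (E' x)]
  [∀ x, AddCommGroup (E' x)] [∀ x, Module ℝ (E' x)] [FiberBundle F' E'] [VectorBundle ℝ F' E']
  [IsManifold I' ∞ M'] [ContMDiffVectorBundle ∞ F' E' I']
  [FiniteDimensional ℝ B'] [FiniteDimensional ℝ F']
  {qM : M → M'} {q : ∀ x, E x →ₗ[ℝ] E' (qM x)} {A : LieAlgebroid I F E}

theorem dirDeriv_comp {f : M' → ℝ} (hf : ContMDiff I' 𝓘(ℝ, ℝ) ∞ f) (hM : ContMDiff I I' ∞ qM)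
    {x : M} (v : TangentSpace I x) :
    dirDeriv v (fun z => f (qM z)) = dirDeriv (mfderiv I I' qM x v) f :=
  DFunLike.congr_fun (mfderiv_comp (I' := I') (g := f) x ((hf _).mdifferentiableAt (by simp))
    ((hM x).mdifferentiableAt (by simp))) v

/-- The morphism condition with a single summand of constant coefficient 1 on each side. -/
theorem IsLieAlgebroidMorphism.bracketProjects {A' : LieAlgebroid I' F' E'}
    (h : IsLieAlgebroidMorphism A A' qM q) : BracketProjects q A A' := by
  intro e₁ e₂ b₁ b₂ h₁ h₂ x
  have h3 := h.bracket e₁ e₂ 1 1 (fun _ _ => 1) (fun _ _ => 1) (fun _ => b₁) (fun _ => b₂)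
    (fun _ => contMDiff_const) (fun _ => contMDiff_const) (fun x => by simpa using h₁ x)
    (fun x => by simpa using h₂ x) x
  simpa [dirDeriv_const] using h3

variable [T2Space M] [SigmaCompactSpace M] (hq : IsSimpleQuotient I F I' F' qM q)
include hq

/-- Every vector and every section of the quotient lifts, so anchor and bracket are forced by the
morphism property. -/
theorem IsLieAlgebroidMorphism.unique {A' A'' : LieAlgebroid I' F' E'}
    (h : IsLieAlgebroidMorphism A A' qM q) (h' : IsLieAlgebroidMorphism A A'' qM q) :
    A' = A'' := by
  refine LieAlgebroid.ext (funext fun y => LinearMap.ext fun u => ?_)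
    (LinearMap.ext₂ fun b₁ b₂ => ?_)
  · obtain ⟨x, rfl⟩ := hq.surjective_base y
    obtain ⟨e, rfl⟩ := hq.surjective_fiber x u
    exact (h.anchor x e).symm.trans (h'.anchor x e)
  · obtain ⟨e₁, h₁⟩ := hq.exists_projectsTo b₁
    obtain ⟨e₂, h₂⟩ := hq.exists_projectsTo b₂
    exact (h.bracketProjects e₁ e₂ b₁ b₂ h₁ h₂).unique hq.surjective_base
      (h'.bracketProjects e₁ e₂ b₁ b₂ h₁ h₂)

/-- Each axiom holds for lifts upstairs, and both sides of it are projections of the same section;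
projections are unique because q_M is surjective. -/
theorem IsSimpleQuotient.exists_lieAlgebroid {L : ∀ y : M', E' y →ₗ[ℝ] TangentSpace I' y}
    (hL : ∀ x (e : E x), mfderiv I I' qM x (A.anchor x e) = L (qM x) (q x e))
    (hLs : ContMDiff (I'.prod 𝓘(ℝ, F')) I'.tangent ∞
      (fun p : TotalSpace F' E' => (⟨p.proj, L p.proj p.2⟩ : TangentBundle I' M')))
    (hbr : ∀ b₁ b₂ : Cₛ^∞⟮I'; F', E'⟯, ∃ b₃ : Cₛ^∞⟮I'; F', E'⟯, ∀ e₁ e₂ : Cₛ^∞⟮I; F, E⟯,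
      ProjectsTo q e₁ b₁ → ProjectsTo q e₂ b₂ → ProjectsTo q (A.bracket e₁ e₂) b₃) :
    ∃ A' : LieAlgebroid I' F' E', IsLieAlgebroidMorphism A A' qM q := by
  choose β hβ using hbr
  choose ℓ hℓ using fun b => hq.exists_projectsTo (I := I) (F := F) b
  have huniq : ∀ {e : Cₛ^∞⟮I; F, E⟯} {b b' : Cₛ^∞⟮I'; F', E'⟯}, ProjectsTo q e b →
    ProjectsTo q e b' → b = b' := fun h h' => h.unique hq.surjective_base h'
  have hself : ∀ b, β b b = 0 := fun b => by
    have h := hβ b b _ _ (hℓ b) (hℓ b)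
    rw [A.bracket_self] at h
    exact huniq h fun x => map_zero (q x)
  let A' : LieAlgebroid I' F' E' :=
    { anchor := L
      contMDiff_anchor := hLs
      bracket := LinearMap.mk₂ ℝ β
        (fun b₁ b₂ b => by
          have h := hβ _ _ _ _ ((hℓ b₁).add (hℓ b₂)) (hℓ b)
          rw [map_add, LinearMap.add_apply] at h
          exact huniq h ((hβ _ _ _ _ (hℓ b₁) (hℓ b)).add (hβ _ _ _ _ (hℓ b₂) (hℓ b))))
        (fun c b₁ b => by
          have h := hβ _ _ _ _ ((hℓ b₁).smul c) (hℓ b)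
          rw [map_smul, LinearMap.smul_apply] at h
          exact huniq h ((hβ _ _ _ _ (hℓ b₁) (hℓ b)).smul c))
        (fun b b₁ b₂ => by
          have h := hβ _ _ _ _ (hℓ b) ((hℓ b₁).add (hℓ b₂))
          rw [map_add] at h
          exact huniq h ((hβ _ _ _ _ (hℓ b) (hℓ b₁)).add (hβ _ _ _ _ (hℓ b) (hℓ b₂))))
        (fun c b b₁ => by
          have h := hβ _ _ _ _ (hℓ b) ((hℓ b₁).smul c)
          rw [map_smul] at h
          exact huniq h ((hβ _ _ _ _ (hℓ b) (hℓ b₁)).smul c))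
      bracket_self := hself
      jacobi := fun b₁ b₂ b₃ => by
        have h := hβ _ _ _ _ (hℓ b₁) (hβ _ _ _ _ (hℓ b₂) (hℓ b₃))
        rw [A.jacobi] at h
        exact huniq h ((hβ _ _ _ _ (hβ _ _ _ _ (hℓ b₁) (hℓ b₂)) (hℓ b₃)).add
          (hβ _ _ _ _ (hℓ b₂) (hβ _ _ _ _ (hℓ b₁) (hℓ b₃))))
      leibniz := fun b₁ b₂ fb₂ f hf hfb y => by
        obtain ⟨x, rfl⟩ := hq.surjective_base y
        have hfM : ContMDiff I 𝓘(ℝ, ℝ) ∞ (fun x => f (qM x)) := hf.comp hq.contMDiff_base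
        -- The lift of f b₂ is (f ∘ q_M) times the lift of b₂; the chain rule then converts the
        -- derivative along the anchor upstairs into the one downstairs.
        obtain ⟨fs, hfs⟩ := exists_fun_smul_section hfM (ℓ b₂)
        have hfs' : ProjectsTo q fs fb₂ := fun x => by
          rw [hfs, map_smul, hℓ b₂ x, hfb]
        refine (hβ _ _ _ _ (hℓ b₁) hfs' x).symm.trans ?_
        rw [A.leibniz _ _ _ _ hfM hfs, map_add, map_smul, map_smul,
          hβ _ _ _ _ (hℓ b₁) (hℓ b₂) x, hℓ b₂ x, dirDeriv_comp hf hq.contMDiff_base, hL, hℓ b₁ x]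
        rfl }
  have hbr : BracketProjects q A A' := fun e₁ e₂ b₁ b₂ h₁ h₂ => hβ b₁ b₂ e₁ e₂ h₁ h₂
  exact ⟨A', hbr.isLieAlgebroidMorphism hq hL⟩

/-- The IM equations descend along simple quotients. -/
theorem IsLieAlgebroidMorphism.satisfiesIM {n : ℕ}
    {Ω : FormField (I.prod 𝓘(ℝ, F)) (TotalSpace F E) (n + 2)}
    {Ω' : FormField (I'.prod 𝓘(ℝ, F')) (TotalSpace F' E') (n + 2)}
    (hIM : SatisfiesIM A (muComp Ω) (etaComp Ω))
    (h : Ω = FormField.pullback (totalMap qM q) Ω') (hΩ' : Ω'.IsSmooth)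
    {A' : LieAlgebroid I' F' E'} (hA : IsLieAlgebroidMorphism A A' qM q) :
    SatisfiesIM A' (muComp Ω') (etaComp Ω') := by
  have hE := hq.contMDiff_total
  have hM := hq.contMDiff_base
  have hrel : ∀ {e : Cₛ^∞⟮I; F, E⟯} {b : Cₛ^∞⟮I'; F', E'⟯}, ProjectsTo q e b → ∀ x,
      mfderiv I I' qM x (A.anchorField e x) = A'.anchorField b (qM x) :=
    fun {e b} hb x => (hA.anchor x (e x)).trans (congrArg (A'.anchor (qM x)) (hb x))
  have hinj : ∀ {k : ℕ} {α β : FormField I' M' k},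
      FormField.pullback (I := I) qM α = FormField.pullback qM β → α = β := fun {k α β} hαβ =>
    FormField.pullback_injective (I := I) hM hq.surjective_base hq.submersion_base hαβ
  constructor
  · intro b₁ b₂
    obtain ⟨e₁, h₁⟩ := hq.exists_projectsTo b₁
    obtain ⟨e₂, h₂⟩ := hq.exists_projectsTo b₂
    refine hinj ((interior_muSection_eq_pullback hq h h₂ (hrel h₁)).symm.trans ?_)
    exact (hIM.eq₁ e₁ e₂).trans
      (congrArg (- ·) (interior_muSection_eq_pullback hq h h₁ (hrel h₂)))
  · intro b₁ b₂
    obtain ⟨e₁, h₁⟩ := hq.exists_projectsTo b₁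
    obtain ⟨e₂, h₂⟩ := hq.exists_projectsTo b₂
    refine hinj ((muSection_eq_of_projectsTo hE hM h
      (hA.bracketProjects e₁ e₂ b₁ b₂ h₁ h₂)).symm.trans ?_)
    exact muSection_bracket_eq_pullback hq hIM h hΩ' h₁ h₂ (A'.isSmoothField_anchorField b₁)
      (hrel h₁) (hrel h₂)
  · intro b₁ b₂
    obtain ⟨e₁, h₁⟩ := hq.exists_projectsTo b₁
    obtain ⟨e₂, h₂⟩ := hq.exists_projectsTo b₂
    refine hinj ((etaSection_eq_of_projectsTo hE hM h hΩ'
      (hA.bracketProjects e₁ e₂ b₁ b₂ h₁ h₂)).symm.trans ?_)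
    exact etaSection_bracket_eq_pullback hq hIM h hΩ' h₁ h₂ (A'.isSmoothField_anchorField b₁)
      (hrel h₁) (hrel h₂)

end QuotientTheorem

theorem mainTheorem1
    {B : Type*} [NormedAddCommGroup B] [NormedSpace ℝ B] [FiniteDimensional ℝ B]
    {M : Type*} [TopologicalSpace M] [T2Space M] [SigmaCompactSpace M]
    [ChartedSpace B M] [IsManifold 𝓘(ℝ, B) ∞ M]
    {F : Type*} [NormedAddCommGroup F] [NormedSpace ℝ F] [FiniteDimensional ℝ F]
    {E : M → Type*} [TopologicalSpace (TotalSpace F E)] [∀ x, TopologicalSpace (E x)]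
    [∀ x, AddCommGroup (E x)] [∀ x, Module ℝ (E x)] [FiberBundle F E] [VectorBundle ℝ F E]
    [ContMDiffVectorBundle ∞ F E 𝓘(ℝ, B)]
    {B' : Type*} [NormedAddCommGroup B'] [NormedSpace ℝ B'] [FiniteDimensional ℝ B']
    {M' : Type*} [TopologicalSpace M'] [T2Space M'] [SigmaCompactSpace M']
    [ChartedSpace B' M'] [IsManifold 𝓘(ℝ, B') ∞ M']
    {F' : Type*} [NormedAddCommGroup F'] [NormedSpace ℝ F'] [FiniteDimensional ℝ F']
    {E' : M' → Type*} [TopologicalSpace (TotalSpace F' E')] [∀ x, TopologicalSpace (E' x)]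
    [∀ x, AddCommGroup (E' x)] [∀ x, Module ℝ (E' x)] [FiberBundle F' E'] [VectorBundle ℝ F' E']
    [ContMDiffVectorBundle ∞ F' E' 𝓘(ℝ, B')]
    (qM : M → M') (q : ∀ x, E x →ₗ[ℝ] E' (qM x))
    (A : LieAlgebroid 𝓘(ℝ, B) F E) (n : ℕ)
    (Ω : FormField (𝓘(ℝ, B).prod 𝓘(ℝ, F)) (TotalSpace F E) (n + 2))
    (hΩ_smooth : Ω.IsSmooth) (hΩ_linear : IsLinearForm Ω) (hΩ_morphic : IsMorphic A Ω)
    (hΩ_kernel : IsKernelReducible 𝓘(ℝ, B') F' Ω qM q) :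
    (∃! A' : LieAlgebroid 𝓘(ℝ, B') F' E', IsLieAlgebroidMorphism A A' qM q) ∧
    (∃! Ω' : FormField (𝓘(ℝ, B').prod 𝓘(ℝ, F')) (TotalSpace F' E') (n + 2),
      Ω'.IsSmooth ∧ Ω = FormField.pullback (totalMap qM q) Ω') ∧
    ∀ (A' : LieAlgebroid 𝓘(ℝ, B') F' E')
      (Ω' : FormField (𝓘(ℝ, B').prod 𝓘(ℝ, F')) (TotalSpace F' E') (n + 2)),
      IsLieAlgebroidMorphism A A' qM q →
      Ω'.IsSmooth → Ω = FormField.pullback (totalMap qM q) Ω' →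
      IsLinearForm Ω' ∧
      IsMorphic A' Ω' ∧
      (∀ p, Ω'.ker p = ⊥) ∧
      (∀ (x : M) (e : E x), muComp Ω x e =
        (muComp Ω' (qM x) (q x e)).compContinuousLinearMap
          (mfderiv 𝓘(ℝ, B) 𝓘(ℝ, B') qM x)) ∧
      (∀ (x : M) (e : E x), etaComp Ω x e =
        (etaComp Ω' (qM x) (q x e)).compContinuousLinearMap
          (mfderiv 𝓘(ℝ, B) 𝓘(ℝ, B') qM x)) ∧
      (∀ (y : M') (e : E' y), muComp Ω' y e = 0 → e = 0) ∧
      (∀ (y : M') (v : TangentSpace 𝓘(ℝ, B') y),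
        (∀ e : E' y, contract (muComp Ω' y e) v = 0) → v = 0) ∧
      SatisfiesIM A' (muComp Ω') (etaComp Ω') := by
  have hq := hΩ_kernel.simple
  obtain ⟨Ω₀, hΩ₀, h₀⟩ := hΩ_kernel.exists_eq_pullback hΩ_smooth
  have hIM : SatisfiesIM A (muComp Ω) (etaComp Ω) :=
    (isMorphic_iff hΩ_smooth hΩ_linear).mp hΩ_morphic
  have hlin : ∀ Ω' : FormField (𝓘(ℝ, B').prod 𝓘(ℝ, F')) (TotalSpace F' E') (n + 2),
      Ω = FormField.pullback (totalMap qM q) Ω' → IsLinearForm Ω' :=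
    fun Ω' h => .of_pullback hq (h ▸ hΩ_linear)
  have hker : ∀ Ω' : FormField (𝓘(ℝ, B').prod 𝓘(ℝ, F')) (TotalSpace F' E') (n + 2),
      Ω = FormField.pullback (totalMap qM q) Ω' → ∀ p, Ω'.ker p = ⊥ := by
    rintro Ω' rfl
    refine FormField.ker_eq_bot_of_pullback (I := 𝓘(ℝ, B).prod 𝓘(ℝ, F)) hq.surjective_total
      hq.submersion_total fun p v hv => ?_
    rw [← hΩ_kernel.ker_tangent p] at hv
    exact hv
  refine ⟨?_, ⟨Ω₀, ⟨hΩ₀, h₀⟩, fun Ω₁ h₁ => ?_⟩, fun A' Ω' hA hΩ' h => ?_⟩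
  · obtain ⟨L, hL, hLs⟩ := exists_quotient_anchor hq hΩ_smooth hIM h₀ hΩ₀ (hlin Ω₀ h₀)
      (hker Ω₀ h₀)
    obtain ⟨A', hA'⟩ := hq.exists_lieAlgebroid hL hLs
      (exists_quotient_bracket hq hIM h₀ hΩ₀ (hlin Ω₀ h₀) (hker Ω₀ h₀) hL hLs)
    exact ⟨A', hA', fun A'' hA'' => hA''.unique hq hA'⟩
  · exact FormField.pullback_injective (I := 𝓘(ℝ, B).prod 𝓘(ℝ, F)) hq.contMDiff_total
      hq.surjective_total hq.submersion_total (h₁.2.symm.trans h₀)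
  · have hl := hlin Ω' h
    have hk := hker Ω' h
    -- The IM equations are pushed down first; that the quotient form is morphic then follows from
    -- the equivalence applied to the quotient algebroid.
    have hIM' := hA.satisfiesIM hq hIM h hΩ'
    exact ⟨hl, (isMorphic_iff hΩ' hl).mpr hIM', hk,
      muComp_eq_of_pullback hq.contMDiff_total hq.contMDiff_base h,
      etaComp_eq_of_pullback hq.contMDiff_total hq.contMDiff_base h hΩ',
      eq_zero_of_muComp_eq_zero hΩ' hl hk, eq_zero_of_contract_muComp_eq_zero hΩ' hl hk, hIM'⟩
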